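/- Let $\alpha>\tfrac12$ and $\alpha>\beta>-\tfrac12$ be real, put $\rho=\alpha+\beta+1$, let $N$ be the least integer $\ge\alpha+\tfrac32$, and let $\Omega_1=\{\lambda\in\mathbb C:|\Im\lambda|<\rho\}$. Let $$\varphi_\lambda(t)={}_2F_1\bigl(\tfrac12(\rho-i\lambda),\tfrac12(\rho+i\lambda);\alpha+1;-\sinh^2t\bigr),\qquad \mathbf c(\lambda)=\frac{2^\rho\,\Gamma(\tfrac{i\lambda}{2})\,\Gamma(\tfrac12(1+i\lambda))}{\Gamma(\tfrac12(\rho+i\lambda))\,\Gamma(\tfrac12(\rho+i\lambda)-\beta)}$$ be the Jacobi function (${}_2F_1$ being analytically continued) and the $\mathbf c$-function, and write $$m^\vee(t)=\int_0^\infty m(\lambda)\varphi_\lambda(t)\,\frac{d\lambda}{\mathbf c(\lambda)\mathbf c(-\lambda)} .$$ Let $R_0>1$ and let $\psi$ be an even smooth function on $\mathbb R$ with $0\le\psi\le1$, $\psi(t)=1$ for $|t|\le R_0^{1/2}$ and $\psi(t)=0$ for $|t|\ge R_0$. Let $c_{a,y}$ ($0\le a\le N$, $|y|<\rho$) be given constants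 and let $\varepsilon\in(0,1)$. Then there are constants $c_\varepsilon$ and $B_\varepsilon$, depending only on $\alpha,\beta,\psi,R_0,\varepsilon$ and the $c_{a,y}$, such that the following holds for every function $m$ that is even and holomorphic in $\Omega_1$, is bounded on each closed substrip $\{|\Im\lambda|\le\delta\}$, $\delta<\rho$, and satisfies $$\Bigl|\frac{d^a}{dx^a}m(x+iy)\Bigr|\le c_{a,y}(1+|x|)^{-a}\qquad(0\le a\le N,\ x+iy\in\Omega_1).$$ There is a nonnegative function $K_\varepsilon\in L^2(\mathbb R^+)$ (Lebesgue measure) with $\|K_\varepsilon\|_{L^2}\le B_\varepsilon$ such that $$|(1-\psi(t))\,m^\vee(t)|\le c_\varepsilon e^{-(1+\varepsilon)\rho t}\,(1+K_\varepsilon(t))$$ for all $t\ge0$ for which the integral defining $m^\vee(t)$ converges absolutely. If $m$ is rapidly decreasing on $\mathbb R$, i.e. $\sup_{x\in\mathbb R}(1+|x|)^n|m(x)|<\infty$ for all $n\in\mathbb N$, then that integral converges absolutely for every $t\ge0$, so that the estimate holds for all $t\ge0$. -/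

import Mathlib

open MeasureTheory Set

namespace JacobiAnalysis

/-- The Gauss hypergeometric function `₂F₁(a, b; c; z)` on the half plane `Re z < 1/2`, i.e. the
analytic continuation of the hypergeometric series `₂F₁` from the disc `‖z‖ < 1` to that half
plane. There `‖z / (z - 1)‖ < 1`, so the series below converges, and the expression is analytic in
`z`; it coincides with the series in `z` by `hyp_eq_series`. -/
noncomputable def hyp (a b c z : ℂ) : ℂ :=
  (1 - z) ^ (-a) * ₂F₁ a (c - b) c (z / (z - 1))

section Helpers

open Finset


lemma pochAdd (a : ℂ) (n k : ℕ) : (ascPochhammer ℂ (n + k)).eval a =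
    (ascPochhammer ℂ n).eval a * (ascPochhammer ℂ k).eval (a + n) := by
  rw [← ascPochhammer_mul]; simp

lemma pochLeft (a : ℂ) (n : ℕ) : (ascPochhammer ℂ (n + 1)).eval a =
    a * (ascPochhammer ℂ n).eval (a + 1) := by
  rw [ascPochhammer_succ_left]; simp

lemma vander (m : ℕ) : ∀ c d : ℂ, ∑ n ∈ range (m + 1), (m.choose n : ℂ) * (-1) ^ n *
    (ascPochhammer ℂ n).eval d * (ascPochhammer ℂ (m - n)).eval (c + n) =
    (ascPochhammer ℂ m).eval (c - d) := by
  induction m with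
  | zero => intro c d; simp
  | succ m ih =>
    intro c d
    have h1 := ih c d
    have h2 := ih (c + 1) (d + 1)
    rw [show c + 1 - (d + 1) = c - d by ring] at h2
    rw [ascPochhammer_succ_eval]
    have e : (ascPochhammer ℂ m).eval (c - d) * (c - d + m) =
      (c + m) * (ascPochhammer ℂ m).eval (c - d) - d * (ascPochhammer ℂ m).eval (c - d) := by ring
    rw [e]
    nth_rw 1 [← h1]
    rw [← h2, mul_sum, mul_sum, sum_range_succ']
    have h3 : ∀ n ∈ range (m + 1), (((m + 1).choose (n + 1) : ℕ) : ℂ) * (-1) ^ (n + 1) *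
        (ascPochhammer ℂ (n + 1)).eval d * (ascPochhammer ℂ (m + 1 - (n + 1))).eval
          (c + ((n + 1 : ℕ) : ℂ)) =
        ((m.choose (n + 1) : ℕ) : ℂ) * (-1) ^ (n + 1) *
        (ascPochhammer ℂ (n + 1)).eval d * (ascPochhammer ℂ (m - n)).eval
          (c + ((n + 1 : ℕ) : ℂ)) - d * ((m.choose n : ℂ) * (-1) ^ n *
          (ascPochhammer ℂ n).eval (d + 1) * (ascPochhammer ℂ (m - n)).eval (c + 1 + n)) := by
      intro n _
      rw [Nat.choose_succ_succ, pochLeft d n, show m + 1 - (n + 1) = m - n by omega,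
        show c + 1 + (n : ℂ) = c + ((n + 1 : ℕ) : ℂ) by push_cast; ring]
      push_cast
      ring
    rw [sum_congr rfl h3, sum_sub_distrib, sub_add_eq_add_sub]
    congr 1
    have h4 : ∑ n ∈ range (m + 2), ((m.choose n : ℕ) : ℂ) * (-1) ^ n *
        (ascPochhammer ℂ n).eval d * (ascPochhammer ℂ (m + 1 - n)).eval (c + n) =
        ∑ n ∈ range (m + 1), (c + m) * ((m.choose n : ℂ) * (-1) ^ n *
    (ascPochhammer ℂ n).eval d * (ascPochhammer ℂ (m - n)).eval (c + n)) := by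
      rw [sum_range_succ]
      simp only [Nat.choose_succ_self, Nat.cast_zero, zero_mul, add_zero]
      refine sum_congr rfl fun n hn => ?_
      have hn' : n ≤ m := by simpa [Nat.lt_succ_iff] using hn
      rw [show m + 1 - n = (m - n) + 1 by omega, ascPochhammer_succ_eval, Nat.cast_sub hn']
      ring
    rw [← h4, sum_range_succ' _ (m + 1)]
    simp

lemma binom {z : ℂ} (hz : ‖z‖ < 1) (a : ℂ) :
    HasSum (fun k : ℕ => (ascPochhammer ℂ k).eval a / (k.factorial : ℂ) * z ^ k)
      ((1 - z) ^ (-a)) := by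
  have h := (Complex.one_add_cpow_hasFPowerSeriesOnBall_zero (a := -a)).hasSum (y := -z)
    (by simpa [← ENNReal.ofReal_one, Metric.eball_ofReal] using hz)
  rw [zero_add, ← sub_eq_add_neg] at h
  suffices e : (fun k : ℕ => (ascPochhammer ℂ k).eval a / (k.factorial : ℂ) * z ^ k) =
      fun k : ℕ => binomialSeries ℂ (-a) k fun _ => -z by
    rw [e]; exact h
  ext k
  rw [binomialSeries_eq_ordinaryHypergeometricSeries (b := 1)
    (by intro k hk; have := congrArg Complex.re hk; simp at this; linarith [k.cast_nonneg (α := ℝ)])]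
  have h1 : (ascPochhammer ℂ k).eval 1 ≠ 0 := by
    rw [ascPochhammer_eval_one]; exact_mod_cast k.factorial_ne_zero
  rw [FormalMultilinearSeries.compContinuousLinearMap_apply,
    show ((-ContinuousLinearMap.id ℂ ℂ : ℂ →L[ℂ] ℂ) ∘ fun _ : Fin k => -z) = fun _ => z by
      ext; simp, neg_neg, ordinaryHypergeometricSeries_apply_eq, smul_eq_mul]
  field_simp

lemma pochNorm (a : ℂ) (k : ℕ) {s : ℝ} (h : ‖a‖ ≤ s) :
    ‖(ascPochhammer ℂ k).eval a‖ ≤ ‖(ascPochhammer ℂ k).eval (s : ℂ)‖ := by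
  induction k with
  | zero => simp
  | succ k ih =>
    rw [ascPochhammer_succ_eval, ascPochhammer_succ_eval, norm_mul, norm_mul]
    gcongr
    have : ‖(s : ℂ) + k‖ = s + k := by
      rw [← Complex.ofReal_natCast, ← Complex.ofReal_add, Complex.norm_real, Real.norm_eq_abs,
        abs_of_nonneg]
      have := (norm_nonneg a).trans h
      positivity
    rw [this]
    calc ‖a + k‖ ≤ ‖a‖ + ‖(k : ℂ)‖ := norm_add_le _ _
      _ ≤ s + k := by simp [h]

lemma pochReal (k : ℕ) {s : ℝ} (h : 0 ≤ s) :
    ((‖(ascPochhammer ℂ k).eval (s : ℂ)‖ : ℝ) : ℂ) = (ascPochhammer ℂ k).eval (s : ℂ) := by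
  induction k with
  | zero => simp
  | succ k ih =>
    rw [ascPochhammer_succ_eval, norm_mul, Complex.ofReal_mul, ih]
    congr 1
    rw [← Complex.ofReal_natCast, ← Complex.ofReal_add, Complex.norm_real, Real.norm_eq_abs,
        abs_of_nonneg (by positivity)]

lemma binomNorm {r : ℝ} (h0 : 0 ≤ r) (h1 : r < 1) {s : ℝ} (hs : 0 ≤ s) :
    HasSum (fun k : ℕ => ‖(ascPochhammer ℂ k).eval (s : ℂ)‖ / (k.factorial : ℝ) * r ^ k)
      ((1 - r) ^ (-s)) := by
  have h := binom (z := (r : ℂ)) (by simpa [abs_of_nonneg h0] using h1) (s : ℂ)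
  rw [← Complex.hasSum_ofReal]
  convert h using 1
  · ext k
    push_cast
    rw [pochReal k hs]
  · rw [Complex.ofReal_cpow (by linarith)]
    push_cast
    rfl

lemma hypSummable {a b c : ℂ} (hc : ∀ n : ℕ, c + n ≠ 0) {w : ℂ} (hw : ‖w‖ < 1) :
    Summable fun n : ℕ => ‖((n.factorial : ℂ)⁻¹ * (ascPochhammer ℂ n).eval a *
      (ascPochhammer ℂ n).eval b * ((ascPochhammer ℂ n).eval c)⁻¹) * w ^ n‖ := by
  have hr : 1 ≤ (ordinaryHypergeometricSeries ℂ a b c).radius := by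
    by_cases h : ∀ k : ℕ, (k : ℂ) ≠ -a ∧ (k : ℂ) ≠ -b ∧ (k : ℂ) ≠ -c
    · exact (ordinaryHypergeometricSeries_radius_eq_one ℂ a b c h).ge
    · push Not at h
      obtain ⟨k, hk⟩ := h
      by_cases ha : (k : ℂ) = -a
      · rw [show a = -(k : ℂ) by rw [ha, neg_neg], ordinaryHypergeometric_radius_top_of_neg_nat₁]
        exact le_top
      by_cases hb : (k : ℂ) = -b
      · rw [show b = -(k : ℂ) by rw [hb, neg_neg], ordinaryHypergeometric_radius_top_of_neg_nat₂]
        exact le_top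
      · exact absurd (by rw [hk ha hb]; ring) (hc k)
  have := (ordinaryHypergeometricSeries ℂ a b c).summable_norm_apply (x := w) (by
    rw [Metric.mem_eball, edist_zero_right]
    refine lt_of_lt_of_le ?_ hr
    rw [← ofReal_norm, ← ENNReal.ofReal_one]
    exact (ENNReal.ofReal_lt_ofReal_iff one_pos).2 hw)
  simpa only [ordinaryHypergeometricSeries_apply_eq, smul_eq_mul] using this

/-- On the overlap with the disc of convergence, `hyp a b c` is the hypergeometric series. -/
theorem hyp_eq_series (a b : ℂ) {c : ℂ} (hc : ∀ n : ℕ, c + n ≠ 0) {z : ℂ} (hz : ‖z‖ < 1 / 2) :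
    hyp a b c z = ₂F₁ a b c z := by
  rw [hyp]
  have hz1 : ‖z‖ < 1 := by linarith
  have hz0 : (1 - z) ≠ 0 := by
    intro h
    have : z = 1 := by linear_combination -h
    rw [this] at hz1; simp at hz1
  have hz0' : z - 1 ≠ 0 := by rw [← neg_ne_zero]; simpa using hz0
  have hr0 := norm_nonneg z
  set A : ℕ → ℂ := fun n => (n.factorial : ℂ)⁻¹ * (ascPochhammer ℂ n).eval a *
      (ascPochhammer ℂ n).eval (c - b) * ((ascPochhammer ℂ n).eval c)⁻¹ with hA
  let f : ℕ × ℕ → ℂ := fun p => A p.1 * (-z) ^ p.1 *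
    ((ascPochhammer ℂ p.2).eval (a + p.1) / (p.2.factorial : ℂ) * z ^ p.2)
  have hin : ∀ n, HasSum (fun k => f (n, k)) ((1 - z) ^ (-a) * (A n * (z / (z - 1)) ^ n)) := by
    intro n
    have := (binom hz1 (a + n)).mul_left (A n * (-z) ^ n)
    suffices e : A n * (-z) ^ n * (1 - z) ^ (-(a + n)) =
        (1 - z) ^ (-a) * (A n * (z / (z - 1)) ^ n) by
      rw [← e]; exact this
    rw [neg_add, Complex.cpow_add _ _ hz0, Complex.cpow_neg _ (n : ℂ), Complex.cpow_natCast,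
      show z / (z - 1) = (-z) / (1 - z) by rw [← neg_sub z 1, neg_div_neg_eq], div_pow]
    ring
  have hsum : Summable f := by
    rw [← summable_norm_iff]
    let g : ℕ × ℕ → ℝ := fun p => ‖A p.1‖ * ‖z‖ ^ p.1 *
      (‖(ascPochhammer ℂ p.2).eval (((‖a‖ + p.1 : ℝ)) : ℂ)‖ / (p.2.factorial : ℝ) * ‖z‖ ^ p.2)
    have hgin : ∀ n, HasSum (fun k => g (n, k))
        (‖A n‖ * ‖z‖ ^ n * (1 - ‖z‖) ^ (-(‖a‖ + n))) := fun n =>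
      (binomNorm hr0 hz1 (s := ‖a‖ + n) (by positivity)).mul_left _
    have hg : Summable g := by
      rw [summable_prod_of_nonneg (fun p => by positivity)]
      refine ⟨fun n => (hgin n).summable, ?_⟩
      simp_rw [(hgin _).tsum_eq]
      have hw : ‖((‖z‖ / (1 - ‖z‖) : ℝ) : ℂ)‖ < 1 := by
        have h1 : 0 < 1 - ‖z‖ := by linarith
        rw [Complex.norm_real, Real.norm_eq_abs, abs_of_nonneg (by positivity), div_lt_one h1]
        linarith
      have := (hypSummable (a := a) (b := c - b) hc hw).mul_left ((1 - ‖z‖) ^ (-‖a‖))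
      refine this.congr fun n => ?_
      have h1 : 0 < 1 - ‖z‖ := by linarith
      rw [neg_add, Real.rpow_add h1, Real.rpow_neg h1.le (n : ℝ), Real.rpow_natCast, norm_mul,
        norm_pow, Complex.norm_real, Real.norm_eq_abs, abs_of_nonneg (by positivity), div_pow]
      simp only [hA]
      ring
    refine Summable.of_nonneg_of_le (fun _ => norm_nonneg _) (fun p => ?_) hg
    simp only [f, g, norm_mul, norm_pow, norm_neg, norm_div, Complex.norm_natCast]
    gcongr
    refine pochNorm _ _ ?_
    exact (norm_add_le _ _).trans (by simp)
  have hL : ∑' p, f p = (1 - z) ^ (-a) * ₂F₁ a (c - b) c (z / (z - 1)) := by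
    rw [hsum.tsum_prod' fun n => (hin n).summable]
    simp_rw [(hin _).tsum_eq]
    rw [tsum_mul_left, ordinaryHypergeometric_eq_tsum]
    simp [hA]
  have hs : Summable fun q => f (Finset.HasAntidiagonal.sigmaAntidiagonalEquivProd q) :=
    (Finset.HasAntidiagonal.sigmaAntidiagonalEquivProd.summable_iff (f := f)).2 hsum
  rw [← hL, ← Finset.HasAntidiagonal.sigmaAntidiagonalEquivProd.tsum_eq f,
    hs.tsum_sigma' (fun n => (hasSum_fintype _).summable), ordinaryHypergeometric_eq_tsum]
  refine tsum_congr fun m => ?_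
  have hcm : ∀ n, (ascPochhammer ℂ n).eval c ≠ 0 := by
    intro n h
    obtain ⟨k, _, hk⟩ := (ascPochhammer_eval_eq_zero_iff n c).1 h
    exact hc k (by rw [hk]; ring)
  have h0 : ∑ q : antidiagonal m, f (Finset.HasAntidiagonal.sigmaAntidiagonalEquivProd ⟨m, q⟩) =
      ∑ p ∈ antidiagonal m, f p := Finset.sum_coe_sort (antidiagonal m) fun p => f p
  rw [tsum_fintype, h0, Finset.Nat.sum_antidiagonal_eq_sum_range_succ_mk]
  have hv := vander m c (c - b)
  rw [sub_sub_cancel] at hv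
  rw [← hv, smul_eq_mul, mul_sum, sum_mul, sum_mul]
  refine sum_congr rfl fun n hn => ?_
  have hn' : n ≤ m := by simpa [Nat.lt_succ_iff] using hn
  obtain ⟨k, rfl⟩ := Nat.exists_eq_add_of_le hn'
  simp only [f, hA, Nat.add_sub_cancel_left]
  have e1 := pochAdd a n k
  have e2 := pochAdd c n k
  have e3 : ((n + k).factorial : ℂ) = ((n + k).choose n : ℂ) * n.factorial * k.factorial := by
    rw [← Nat.add_choose_mul_factorial_mul_factorial n k, ← Nat.choose_symm_add]; push_cast; ring
  have h1 := hcm n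
  have h2 := hcm (n + k)
  have h3 : (n.factorial : ℂ) ≠ 0 := by exact_mod_cast n.factorial_ne_zero
  have h4 : (k.factorial : ℂ) ≠ 0 := by exact_mod_cast k.factorial_ne_zero
  have h5 : ((n + k).choose n : ℂ) ≠ 0 := by
    exact_mod_cast (Nat.choose_pos (Nat.le_add_right n k)).ne'
  have h6 : (ascPochhammer ℂ k).eval (c + n) ≠ 0 := by
    rw [e2] at h2; exact right_ne_zero_of_mul h2
  rw [e1, e2, e3, neg_pow, pow_add]
  field_simp

end Helpers

/-- `ρ = α + β + 1`. -/
def rho (α β : ℝ) : ℝ := α + β + 1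

/-- The Jacobi function
`φ_λ^{(α,β)}(t) = ₂F₁((α+β+1-iλ)/2, (α+β+1+iλ)/2; α+1; -sinh² t)`. -/
noncomputable def jacobiFunction (α β : ℝ) (l : ℂ) (t : ℝ) : ℂ :=
  hyp ((α + β + 1 - Complex.I * l) / 2) ((α + β + 1 + Complex.I * l) / 2) (α + 1)
    (-((Real.sinh t : ℝ) : ℂ) ^ 2)

/-- The `c`-function
`c(λ) = 2^ρ Γ(iλ/2) Γ((1+iλ)/2) / (Γ((ρ+iλ)/2) Γ((ρ+iλ)/2 - β))`. -/
noncomputable def cFunction (α β : ℝ) (l : ℂ) : ℂ :=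
  (2 : ℂ) ^ (rho α β : ℂ) * Complex.Gamma (Complex.I * l / 2) *
      Complex.Gamma ((1 + Complex.I * l) / 2) /
    (Complex.Gamma ((rho α β + Complex.I * l) / 2) *
      Complex.Gamma ((rho α β + Complex.I * l) / 2 - β))

/-- The open strip `Ω₁ = {λ : |Im λ| < ρ}`. -/
def strip (α β : ℝ) : Set ℂ := {l | |l.im| < rho α β}

/-- The integrand `m(λ) φ_λ(t) / (c(λ) c(-λ))` of the inverse Jacobi transform. -/
noncomputable def inversionIntegrand (α β : ℝ) (m : ℂ → ℂ) (t x : ℝ) : ℂ :=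
  m x * jacobiFunction α β x t / (cFunction α β x * cFunction α β (-x))

/-- The kernel `m^∨(t) = ∫₀^∞ m(λ) φ_λ(t) dλ / (c(λ) c(-λ))`. -/
noncomputable def kernel (α β : ℝ) (m : ℂ → ℂ) (t : ℝ) : ℂ :=
  ∫ x in Ioi (0 : ℝ), inversionIntegrand α β m t x

/-- `N`, the least integer `≥ α + 3/2` (a positive number, as `α > 1/2`). -/
noncomputable def derivOrder (α : ℝ) : ℕ := ⌈α + 3 / 2⌉₊

/-- An even smooth cutoff `ψ : ℝ → [0, 1]`, equal to `1` for `|t| ≤ R₀^{1/2}` and to `0` for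
`|t| ≥ R₀`. -/
structure IsCutoff (R₀ : ℝ) (ψ : ℝ → ℝ) : Prop where
  smooth : ContDiff ℝ (⊤ : ℕ∞) ψ
  even : ∀ t, ψ (-t) = ψ t
  nonneg : ∀ t, 0 ≤ ψ t
  le_one : ∀ t, ψ t ≤ 1
  eq_one : ∀ t, |t| ≤ Real.sqrt R₀ → ψ t = 1
  eq_zero : ∀ t, R₀ ≤ |t| → ψ t = 0

/-- `m` is even and holomorphic in `Ω₁`, bounded on each closed substrip, and satisfies
`|D_x^a m(x+iy)| ≤ c_{a,y} (1+|x|)^{-a}` for `0 ≤ a ≤ N` and `x + iy ∈ Ω₁`. -/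
structure IsHormanderMultiplier (α β : ℝ) (c : ℕ → ℝ → ℝ) (m : ℂ → ℂ) : Prop where
  even : ∀ l ∈ strip α β, m (-l) = m l
  holomorphic : DifferentiableOn ℂ m (strip α β)
  bounded : ∀ δ < rho α β, ∃ C : ℝ, ∀ l : ℂ, |l.im| ≤ δ → ‖m l‖ ≤ C
  deriv_le : ∀ a ≤ derivOrder α, ∀ x y : ℝ, |y| < rho α β →
    ‖iteratedDeriv a (fun s : ℝ => m (s + y * Complex.I)) x‖ ≤ c a y * ((1 + |x|) ^ a)⁻¹

/-- `m` is rapidly decreasing on the real line. -/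
def RapidlyDecreasing (m : ℂ → ℂ) : Prop :=
  ∀ n : ℕ, ∃ C : ℝ, ∀ x : ℝ, (1 + |x|) ^ n * ‖m x‖ ≤ C

end JacobiAnalysis

/-! Write `Φ_λ` for the solution of the Jacobi equation with `Φ_λ(t) ~ e^{(iλ-ρ)t}` at infinity
(`jacobiSecond`). For real `λ ≠ 0` the connection formula `jacobiFunction_eq_jacobiSecond` says `φ_λ
= κ (c(λ) Φ_λ + c(-λ) Φ_{-λ})` with `κ = Γ(α+1) / (2√π)`. Dividing by `c(λ) c(-λ)` and using that
`m` is even turns the half-line integral into `m^∨(t) = κ ∫_ℝ m(λ) c(-λ)⁻¹ Φ_λ(t) dλ`. The integrand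
is holomorphic for `0 ≤ Im λ < ρ`, so the contour can be moved to `Im λ = h` with `h = ερ`, which
produces the factor `e^{-(ρ+h)t} = e^{-(1+ε)ρt}`.

On the new line `Φ_λ` is expanded as `e^{(iλ-ρ)t} ∑ Γ_k(λ) e^{-2kt}`, and the `k`-th term of the
integral is `e^{-2kt}` times a Fourier transform `F_k(t)` of `m c(-·)⁻¹ Γ_k`. Since `c(-λ)⁻¹ =
O(|λ|^{α+1/2})` and every derivative gains a power of `1 + |x|`, the `N`-th derivative of this
function is `O((1+|x|)⁻¹)` as soon as `N ≥ α + 3/2`, hence square integrable. By Plancherel `t^N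
F_k(t)` is in `L²`, so `F_k` is in `L²(1, ∞)`, with a norm growing only polynomially in `k`. For `t
> 1` the factors `e^{-2kt} ≤ e^{-2k}` make the series of these `L²` functions converge, and its sum
gives `K`. Small `t` do not matter, because `1 - ψ` vanishes on `[0, 1]`.

The integrals need not converge for a general `m`, so all this is done for `m(λ) e^{-ηλ²}` with
bounds independent of `η ∈ (0, 1]`; Fatou's lemma then removes `η` at every `t` where the inversion
integral converges absolutely. The boundedness of `m` on substrips serves only to justify these
manipulations and never enters a final constant. The carrying lemmas are
`jacobiFunction_eq_jacobiSecond`, `exists_norm_hcCoeff_le`, `exists_norm_Gamma_ratio_le`,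
`exists_lintegral_fourier_amplitude_le`, `kernel_regularized_eq`, `hasSum_integral_unfolded` and
`exists_majorant`. -/

namespace JacobiAnalysis

/-! ### Power series in the unit disc and their derivatives -/

/-- The power series with coefficients `u` converges absolutely in the unit disc. -/
def DiscSummable (u : ℕ → ℂ) : Prop :=
  ∀ r : ℝ, 0 ≤ r → r < 1 → Summable fun n => ‖u n‖ * r ^ n

/-- The coefficients of the derivative of a power series. -/
def derivCoeff (u : ℕ → ℂ) (n : ℕ) : ℂ := ((n + 1 : ℕ) : ℂ) * u (n + 1)

/-- The sum of the power series with coefficients `u`. -/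
noncomputable def pseries (u : ℕ → ℂ) (z : ℂ) : ℂ := ∑' n, u n * z ^ n

lemma DiscSummable.summable_norm {u : ℕ → ℂ} (hu : DiscSummable u) {z : ℂ} (hz : ‖z‖ < 1) :
    Summable fun n => ‖u n * z ^ n‖ := by
  simpa [norm_mul, norm_pow] using hu ‖z‖ (norm_nonneg z) hz

lemma DiscSummable.hasSum {u : ℕ → ℂ} (hu : DiscSummable u) {z : ℂ} (hz : ‖z‖ < 1) :
    HasSum (fun n => u n * z ^ n) (pseries u z) :=
  (hu.summable_norm hz).of_norm.hasSum

lemma DiscSummable.hasSum_deriv {u : ℕ → ℂ} (hu : DiscSummable u) {z : ℂ} (hz : ‖z‖ < 1) :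
    HasSum (fun n : ℕ => u n * (n * z ^ (n - 1))) (deriv (pseries u) z) := by
  obtain ⟨r, hr1, hr2⟩ := exists_between hz
  have hr0 : 0 ≤ r := (norm_nonneg z).trans hr1.le
  have := Complex.hasSum_deriv_of_summable_norm (F := fun n w => u n * w ^ n)
    (U := Metric.ball 0 r) (hu r hr0 hr2) (fun n => by fun_prop) Metric.isOpen_ball
    (fun n w hw => by
      rw [norm_mul, norm_pow]
      have : ‖w‖ < r := by simpa using hw
      gcongr) (z := z) (by simpa using hr1)
  convert! this using 1
  ext n
  simp

lemma DiscSummable.hasSum_derivCoeff {u : ℕ → ℂ} (hu : DiscSummable u) {z : ℂ} (hz : ‖z‖ < 1) :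
    HasSum (fun n : ℕ => derivCoeff u n * z ^ n) (deriv (pseries u) z) := by
  have := (hasSum_nat_add_iff' 1).2 (hu.hasSum_deriv hz)
  simp only [Finset.range_one, Finset.sum_singleton, Nat.cast_zero, zero_mul, mul_zero,
    sub_zero, Nat.add_sub_cancel] at this
  convert! this using 1
  ext n
  simp [derivCoeff]
  ring

lemma DiscSummable.derivCoeff {u : ℕ → ℂ} (hu : DiscSummable u) :
    DiscSummable (derivCoeff u) := by
  intro r h0 h1
  -- For the nonnegative coefficients `‖u n‖` at the real point `r`, convergence of the
  -- differentiated series is already absolute convergence.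
  have h : DiscSummable fun n => (‖u n‖ : ℂ) := fun r h0 h1 => by simpa using hu r h0 h1
  have := (h.hasSum_derivCoeff (z := r) (by simpa [abs_of_nonneg h0] using h1)).summable.norm
  refine this.congr fun n => ?_
  simp [JacobiAnalysis.derivCoeff, abs_of_nonneg h0]

lemma DiscSummable.hasDerivAt {u : ℕ → ℂ} (hu : DiscSummable u) {z : ℂ} (hz : ‖z‖ < 1) :
    HasDerivAt (pseries u) (pseries (JacobiAnalysis.derivCoeff u) z) z := by
  have hd : DifferentiableAt ℂ (pseries u) z := by
    obtain ⟨r, hr1, hr2⟩ := exists_between hz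
    have hr0 : 0 ≤ r := (norm_nonneg z).trans hr1.le
    have := Complex.differentiableOn_tsum_of_summable_norm (F := fun n w => u n * w ^ n)
      (U := Metric.ball 0 r) (hu r hr0 hr2) (fun n => by fun_prop) Metric.isOpen_ball
      (fun n w hw => by
        rw [norm_mul, norm_pow]
        have : ‖w‖ < r := by simpa using hw
        gcongr)
    exact this.differentiableAt (Metric.isOpen_ball.mem_nhds (by simpa using hr1))
  have := hd.hasDerivAt
  rwa [← (hu.hasSum_derivCoeff hz).tsum_eq] at this

/-- With `z d/dz` and `z² d²/dz²` acting coefficientwise, a differential equation for the sum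
becomes a recurrence for the coefficients. -/
lemma DiscSummable.hasSum_mul_deriv {u : ℕ → ℂ} (hu : DiscSummable u) {z : ℂ} (hz : ‖z‖ < 1) :
    HasSum (fun n : ℕ => n * u n * z ^ n) (z * pseries (JacobiAnalysis.derivCoeff u) z) := by
  rw [← hasSum_nat_add_iff' 1]
  convert! (hu.derivCoeff.hasSum hz).mul_left z using 1
  · ext n
    simp [JacobiAnalysis.derivCoeff]
    ring
  · simp

lemma DiscSummable.hasSum_mul_deriv_deriv {u : ℕ → ℂ} (hu : DiscSummable u) {z : ℂ}
    (hz : ‖z‖ < 1) : HasSum (fun n : ℕ => n * (n - 1) * u n * z ^ n)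
      (z ^ 2 * pseries (JacobiAnalysis.derivCoeff (JacobiAnalysis.derivCoeff u)) z) := by
  rw [← hasSum_nat_add_iff' 2]
  convert! (hu.derivCoeff.derivCoeff.hasSum hz).mul_left (z ^ 2) using 1
  · ext n
    simp [JacobiAnalysis.derivCoeff]
    ring
  · simp [Finset.sum_range_succ]

lemma pseries_zero (u : ℕ → ℂ) : pseries u 0 = u 0 := by
  rw [pseries, tsum_eq_single 0 (by intro n hn; simp [hn])]
  simp

/-! ### The Harish-Chandra coefficients and their uniform bounds -/

/-- The region `-Im λ < 1/2 + |Re λ|` in which `k - iλ`, `k ≥ 1`, is comparable to `k + |λ|`. -/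
def sector : Set ℂ := {l | -l.im < 1 / 2 + |l.re|}

lemma isOpen_sector : IsOpen sector :=
  isOpen_lt (by fun_prop) (by fun_prop)

/-- The real part of `k - iλ` is `k + Im λ` and its imaginary part is `-Re λ`; when `Im λ` is very
negative, `|Re λ|` takes over. The sector avoids the points `-ij`, `j ≥ 1`, where the coefficients
may have poles, and unlike a half plane it contains discs about `x + ih` of radius proportional to
`1 + |x|`, which Cauchy's estimate will need. -/
lemma add_norm_le_of_mem_sector {l : ℂ} (hl : l ∈ sector) {k : ℝ} (hk : 1 ≤ k) :
    k + ‖l‖ ≤ 8 * ‖(k : ℂ) - Complex.I * l‖ := by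
  have h1 := Complex.norm_le_abs_re_add_abs_im l
  have h2 := Complex.abs_re_le_norm ((k : ℂ) - Complex.I * l)
  have h3 := Complex.abs_im_le_norm ((k : ℂ) - Complex.I * l)
  simp only [Complex.sub_re, Complex.ofReal_re, Complex.mul_re, Complex.I_re, Complex.I_im,
    Complex.sub_im, Complex.ofReal_im, Complex.mul_im, zero_mul, one_mul, zero_sub, sub_neg_eq_add,
    zero_add, abs_neg] at h2 h3
  have hl' : -l.im < 1 / 2 + |l.re| := hl
  have h4 := le_abs_self (k + l.im)
  have h5 := abs_nonneg l.re
  rcases abs_cases l.im with h | h <;> linarith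

lemma ne_zero_of_mem_sector {l : ℂ} (hl : l ∈ sector) {k : ℝ} (hk : 1 ≤ k) :
    (k : ℂ) - Complex.I * l ≠ 0 := by
  have h := add_norm_le_of_mem_sector hl hk
  have := norm_nonneg l
  intro h0
  rw [h0, norm_zero] at h
  linarith

/-- The coefficients of the Harish-Chandra series at infinity. -/
noncomputable def hcCoeff (α β : ℝ) (l : ℂ) : ℕ → ℂ
  | 0 => 1
  | 1 => -((α - β) * (Complex.I * l - rho α β)) / (1 - Complex.I * l)
  | k + 2 => (-((α - β) * (Complex.I * l - rho α β - 2 * (k + 1))) * hcCoeff α β l (k + 1) +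
      (rho α β + k) * (rho α β + k - Complex.I * l) * hcCoeff α β l k) /
        ((k + 2) * (k + 2 - Complex.I * l))

/-- The sequence `∏_{j ≤ k} (1 + C / j)`. -/
noncomputable def growth (C : ℝ) : ℕ → ℝ
  | 0 => 1
  | k + 1 => (1 + C / (k + 1)) * growth C k

lemma growth_pos {C : ℝ} (hC : 0 ≤ C) (k : ℕ) : 0 < growth C k := by
  induction k with
  | zero => simp [growth]
  | succ k ih => rw [growth]; positivity

lemma growth_le_succ {C : ℝ} (hC : 0 ≤ C) (k : ℕ) : growth C k ≤ growth C (k + 1) := by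
  have := growth_pos hC k
  rw [growth]
  have : 0 ≤ C / (k + 1) := by positivity
  nlinarith

lemma summable_growth {C : ℝ} (hC : 0 ≤ C) {r : ℝ} (h0 : 0 ≤ r) (h1 : r < 1) :
    Summable fun k => growth C k * r ^ k := by
  rcases h0.eq_or_lt with rfl | h0
  · exact summable_of_ne_finset_zero (s := {0}) (by intro b hb; simp at hb; simp [hb])
  refine summable_of_ratio_test_tendsto_lt_one h1
    (Filter.Eventually.of_forall fun k => by have := growth_pos hC k; positivity) ?_
  have : Filter.Tendsto (fun k : ℕ => (1 + C * (1 / ((k : ℝ) + 1))) * r) Filter.atTop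
      (nhds ((1 + C * 0) * r)) :=
    ((tendsto_one_div_add_atTop_nhds_zero_nat.const_mul C).const_add 1).mul_const r
  simp only [mul_zero, add_zero, one_mul] at this
  refine this.congr fun k => ?_
  have hk := growth_pos hC k
  have : 0 ≤ C / (k + 1) := by positivity
  rw [Real.norm_of_nonneg (by have := growth_pos hC (k + 1); positivity),
    Real.norm_of_nonneg (by positivity), growth, pow_succ]
  field_simp

/-- In the recurrence the factor of the `k`-th coefficient is `1 + O(1/k)` and that of the
`(k+1)`-st is `O(1/k)`, both uniformly for `λ` in the sector. Hence each step multiplies the larger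
of the two preceding bounds by at most `1 + C/(k+2)`, and the growth is polynomial in `k`,
independently of `λ`. -/
lemma exists_norm_hcCoeff_le (α β : ℝ) : ∃ C : ℝ, 0 ≤ C ∧ ∀ l ∈ sector, ∀ k,
    ‖hcCoeff α β l k‖ ≤ growth C k := by
  set d := |α - β| with hd
  set r := |rho α β| with hr
  set D := |rho α β - 2| with hD
  have hd0 : 0 ≤ d := abs_nonneg _
  have hr0 : 0 ≤ r := abs_nonneg _
  have hD0 : 0 ≤ D := abs_nonneg _
  set C := 8 * d * (2 + r) + (9 * D + 8 * D ^ 2) with hCdef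
  have hC : 0 ≤ C := by positivity
  have nd : ‖((α : ℂ) - β)‖ = d := by
    rw [← Complex.ofReal_sub, Complex.norm_real, Real.norm_eq_abs]
  have nr : ‖(rho α β : ℂ)‖ = r := by rw [Complex.norm_real, Real.norm_eq_abs]
  have nD : ‖(rho α β : ℂ) - 2‖ = D := by
    rw [show (2 : ℂ) = ((2 : ℝ) : ℂ) by norm_num, ← Complex.ofReal_sub, Complex.norm_real,
      Real.norm_eq_abs]
  refine ⟨C, hC, fun l hl k => ?_⟩
  have nl : ‖Complex.I * l‖ = ‖l‖ := by simp
  have hl0 := norm_nonneg l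
  -- The recurrence has three terms, so the induction carries two consecutive bounds.
  have key : ∀ k, ‖hcCoeff α β l k‖ ≤ growth C k ∧ ‖hcCoeff α β l (k + 1)‖ ≤ growth C (k + 1) := by
    intro k
    induction k with
    | zero =>
      refine ⟨by simp [hcCoeff, growth], ?_⟩
      have h := add_norm_le_of_mem_sector hl (k := 1) le_rfl
      rw [Complex.ofReal_one] at h
      have h1 : 0 < ‖1 - Complex.I * l‖ := by linarith
      simp only [hcCoeff, growth, norm_div, norm_neg, norm_mul, nd]
      rw [div_le_iff₀ h1]
      have h2 : ‖Complex.I * l - rho α β‖ ≤ ‖l‖ + r := by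
        rw [← nl, ← nr]; exact norm_sub_le _ _
      calc d * ‖Complex.I * l - rho α β‖ ≤ d * (‖l‖ + r) := by gcongr
        _ ≤ d * ((2 + r) * (1 + ‖l‖)) := mul_le_mul_of_nonneg_left (by nlinarith) hd0
        _ ≤ d * ((2 + r) * (8 * ‖1 - Complex.I * l‖)) := by gcongr
        _ = (8 * d * (2 + r)) * ‖1 - Complex.I * l‖ := by ring
        _ ≤ _ := by
          refine mul_le_mul_of_nonneg_right ?_ h1.le
          norm_num
          rw [hCdef]
          nlinarith [sq_nonneg D]
    | succ k ih =>
      obtain ⟨ih1, ih2⟩ := ih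
      refine ⟨ih2, ?_⟩
      have hk2 : (1 : ℝ) ≤ (k : ℝ) + 2 := by have := k.cast_nonneg (α := ℝ); linarith
      have h := add_norm_le_of_mem_sector hl hk2
      push_cast at h
      set X := ‖(k : ℂ) + 2 - Complex.I * l‖ with hX
      have hXp : 0 < X := by linarith
      have hk0 : (0 : ℝ) ≤ k := k.cast_nonneg
      have nk : ‖(k : ℂ) + 2‖ = k + 2 := by
        rw [show (k : ℂ) + 2 = ((k + 2 : ℝ) : ℂ) by push_cast; ring, Complex.norm_real,
          Real.norm_of_nonneg (by positivity)]
      have hg := growth_pos hC k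
      have hg1 := growth_le_succ hC k
      have a1 : ‖Complex.I * l - rho α β - 2 * (k + 1)‖ ≤ (2 + r) * (8 * X) := by
        have e : ‖(2 : ℂ) * (k + 1)‖ = 2 * (k + 1) := by
          rw [show (2 : ℂ) * (k + 1) = ((2 * (k + 1) : ℝ) : ℂ) by push_cast; ring,
            Complex.norm_real, Real.norm_of_nonneg (by positivity)]
        have := norm_sub_le (Complex.I * l - rho α β) (2 * (k + 1))
        have := norm_sub_le (Complex.I * l) (rho α β)
        nlinarith [mul_nonneg hr0 hXp.le]
      have a2 : ‖(rho α β : ℂ) + k‖ ≤ (k + 2) + D := by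
        rw [show (rho α β : ℂ) + k = (k + 2) + (rho α β - 2) by ring, ← nk, ← nD]
        exact norm_add_le _ _
      have a3 : ‖(rho α β : ℂ) + k - Complex.I * l‖ ≤ X + D := by
        rw [show (rho α β : ℂ) + k - Complex.I * l = (k + 2 - Complex.I * l) + (rho α β - 2) by ring,
          hX, ← nD]
        exact norm_add_le _ _
      rw [show k + 1 + 1 = k + 2 by ring, hcCoeff, growth, norm_div, norm_mul, nk, ← hX,
        div_le_iff₀ (by positivity)]
      push_cast
      -- The cross term `(k+2) D` and the square `D²` are absorbed by `k + 2 ≤ 8X` and `1 ≤ 8X`.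
      have a4 : (k + 2 + D) * (X + D) ≤ (k + 2) * X + (9 * D + 8 * D ^ 2) * X := by
        nlinarith [mul_nonneg hD0 hXp.le, mul_nonneg hD0 hD0]
      calc _ ≤ ‖-(((α : ℂ) - β) * (Complex.I * l - rho α β - 2 * (k + 1))) * hcCoeff α β l (k + 1)‖ +
            ‖((rho α β : ℂ) + k) * (rho α β + k - Complex.I * l) * hcCoeff α β l k‖ :=
            norm_add_le _ _
        _ ≤ d * ((2 + r) * (8 * X)) * growth C (k + 1) +
            ((k + 2) + D) * (X + D) * growth C (k + 1) := by
            simp only [norm_mul, norm_neg, nd]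
            gcongr
            exact ih1.trans hg1
        _ ≤ d * ((2 + r) * (8 * X)) * growth C (k + 1) +
            ((k + 2) * X + (9 * D + 8 * D ^ 2) * X) * growth C (k + 1) := by
            have := growth_pos hC (k + 1)
            gcongr
        _ = _ := by
          rw [show (k : ℝ) + 1 + 1 = k + 2 by ring]
          field_simp
          rw [hCdef]
          ring
  exact (key k).1

lemma discSummable_hcCoeff (α β : ℝ) {l : ℂ} (hl : l ∈ sector) :
    DiscSummable (hcCoeff α β l) := by
  obtain ⟨C, hC, h⟩ := exists_norm_hcCoeff_le α β
  intro r h0 h1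
  refine Summable.of_nonneg_of_le (fun n => by positivity) (fun n => ?_)
    (summable_growth hC h0 h1)
  gcongr
  exact h l hl n

lemma differentiableOn_hcCoeff (α β : ℝ) (k : ℕ) :
    DifferentiableOn ℂ (fun l => hcCoeff α β l k) sector := by
  have hne : ∀ (k : ℕ), ∀ l ∈ sector, ((k : ℂ) + 1) - Complex.I * l ≠ 0 := by
    intro k l hl
    have := ne_zero_of_mem_sector hl (k := k + 1) (by simp)
    exact_mod_cast this
  have key : ∀ k, DifferentiableOn ℂ (fun l => hcCoeff α β l k) sector ∧
      DifferentiableOn ℂ (fun l => hcCoeff α β l (k + 1)) sector := by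
    intro k
    induction k with
    | zero =>
      refine ⟨by simp only [hcCoeff]; fun_prop, ?_⟩
      simp only [hcCoeff]
      refine DifferentiableOn.div (by fun_prop) (by fun_prop) fun l hl => ?_
      simpa using hne 0 l hl
    | succ k ih =>
      refine ⟨ih.2, ?_⟩
      simp only [hcCoeff]
      have h1 := ih.1
      have h2 := ih.2
      refine DifferentiableOn.div (by fun_prop) (by fun_prop) fun l hl => ?_
      have := hne (k + 1) l hl
      push_cast at this
      rw [add_assoc, one_add_one_eq_two] at this
      refine mul_ne_zero ?_ this
      exact_mod_cast (by omega : k + 2 ≠ 0)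
  exact (key k).1

end JacobiAnalysis

/-! ### The Jacobi equation, its second solution and Wronskians -/

namespace JacobiAnalysis

/-- `f`, with derivative `f'`, solves the Jacobi differential equation on `(0, ∞)`. -/
def IsJacobiSolution (α β : ℝ) (l : ℂ) (f f' : ℝ → ℂ) : Prop :=
  ∀ t > 0, HasDerivAt f (f' t) t ∧ HasDerivAt f'
    (-((2 * α + 1) / (Real.tanh t : ℂ) + (2 * β + 1) * (Real.tanh t : ℂ)) * f' t -
      (rho α β - Complex.I * l) * (rho α β + Complex.I * l) * f t) t

/-- The solution of the second kind, `e^{(iλ-ρ)t} (1 + O(e^{-2t}))` at infinity. -/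
noncomputable def jacobiSecond (α β : ℝ) (l : ℂ) (t : ℝ) : ℂ :=
  Complex.exp ((Complex.I * l - rho α β) * t) * pseries (hcCoeff α β l) (Real.exp (-2 * t) : ℝ)

/-- The derivative of `jacobiSecond`. -/
noncomputable def jacobiSecondDeriv (α β : ℝ) (l : ℂ) (t : ℝ) : ℂ :=
  Complex.exp ((Complex.I * l - rho α β) * t) *
    ((Complex.I * l - rho α β) * pseries (hcCoeff α β l) (Real.exp (-2 * t) : ℝ) -
      2 * (Real.exp (-2 * t) : ℝ) * pseries (derivCoeff (hcCoeff α β l)) (Real.exp (-2 * t) : ℝ))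

lemma norm_exp_lt_one {t : ℝ} (ht : 0 < t) : ‖((Real.exp (-2 * t) : ℝ) : ℂ)‖ < 1 := by
  rw [Complex.norm_real, Real.norm_of_nonneg (Real.exp_pos _).le, Real.exp_lt_one_iff]
  linarith

/-- The differential equation satisfied by the power series of the Harish-Chandra coefficients. -/
lemma hcCoeff_ode (α β : ℝ) {l : ℂ} (hl : l ∈ sector) {z : ℂ} (hz : ‖z‖ < 1) :
    z ^ 2 * pseries (derivCoeff (derivCoeff (hcCoeff α β l))) z +
      (1 - Complex.I * l) * (z * pseries (derivCoeff (hcCoeff α β l)) z) =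
    -z * ((α - β) * ((Complex.I * l - rho α β) * pseries (hcCoeff α β l) z -
        2 * (z * pseries (derivCoeff (hcCoeff α β l)) z))) +
      z ^ 2 * (rho α β * (rho α β - Complex.I * l) * pseries (hcCoeff α β l) z +
        (2 * rho α β - Complex.I * l + 1) * (z * pseries (derivCoeff (hcCoeff α β l)) z) +
        z ^ 2 * pseries (derivCoeff (derivCoeff (hcCoeff α β l))) z) := by
  have hu := discSummable_hcCoeff α β hl
  set u := hcCoeff α β l with hudef
  have h0 := hu.hasSum hz
  have h1 := hu.hasSum_mul_deriv hz
  have h2 := hu.hasSum_mul_deriv_deriv hz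
  have hE := h2.add (h1.mul_left (1 - Complex.I * l))
  have hB := (((h0.mul_left (Complex.I * l - rho α β)).sub (h1.mul_left 2)).mul_left
    ((α : ℂ) - β))
  have hD := (((h0.mul_left (rho α β * (rho α β - Complex.I * l))).add
    (h1.mul_left (2 * rho α β - Complex.I * l + 1))).add h2).mul_left (z ^ 2)
  -- The series are shifted so that coefficients of `z^{k+2}` face each other; their equality is the
  -- recurrence. The low terms left out are settled by the values of `u 0` and `u 1`.
  have hE' := (hasSum_nat_add_iff' 2).2 hE
  have hB' := ((hasSum_nat_add_iff' 1).2 hB).mul_left (-z)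
  have := hE'.unique ((hB'.add hD).congr_fun ?_)
  · simp only [Finset.sum_range_succ, Finset.range_zero, Finset.sum_empty] at this
    have u0 : u 0 = 1 := by rw [hudef, hcCoeff]
    have u1 : u 1 * (1 - Complex.I * l) = -((α - β) * (Complex.I * l - rho α β)) := by
      rw [hudef, hcCoeff, div_mul_cancel₀]
      simpa using ne_zero_of_mem_sector hl le_rfl
    push_cast at this
    rw [u0] at this
    linear_combination this + z * u1
  · intro k
    have hne : (k : ℂ) + 2 - Complex.I * l ≠ 0 := by
      have := ne_zero_of_mem_sector hl (k := k + 2) (by linarith [k.cast_nonneg (α := ℝ)])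
      exact_mod_cast this
    have hk : (k : ℂ) + 2 ≠ 0 := by exact_mod_cast (by omega : k + 2 ≠ 0)
    have hrec : ((k : ℂ) + 2) * (k + 2 - Complex.I * l) * u (k + 2) =
        (-((α - β) * (Complex.I * l - rho α β - 2 * (k + 1))) * u (k + 1) +
          (rho α β + k) * (rho α β + k - Complex.I * l) * u k) := by
      rw [hudef, hcCoeff, mul_div_cancel₀ _ (mul_ne_zero hk hne)]
    push_cast
    linear_combination z ^ (k + 2) * hrec

lemma tanh_eq_exp (t : ℝ) :
    Real.tanh t = (1 - Real.exp (-2 * t)) / (1 + Real.exp (-2 * t)) := by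
  rw [Real.tanh_eq_sinh_div_cosh, Real.sinh_eq, Real.cosh_eq,
    show Real.exp (-2 * t) = Real.exp (-t) * Real.exp (-t) by rw [← Real.exp_add]; ring_nf]
  have : Real.exp t * Real.exp (-t) = 1 := by rw [← Real.exp_add]; simp
  have h1 := Real.exp_pos t
  have h2 := Real.exp_pos (-t)
  field_simp
  linear_combination (2 * Real.exp (-t)) * this

/-- In `X = e^{-2t}` one has `coth t = (1+X)/(1-X)` and `tanh t = (1-X)/(1+X)`. Multiplying the
equation by `1 - X²` gives polynomial coefficients, hence a recurrence with only three terms, and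
the claim becomes `hcCoeff_ode`. -/
lemma jacobiSecond_isJacobiSolution (α β : ℝ) {l : ℂ} (hl : l ∈ sector) :
    IsJacobiSolution α β l (jacobiSecond α β l) (jacobiSecondDeriv α β l) := by
  intro t ht
  have hz := norm_exp_lt_one ht
  have hu := discSummable_hcCoeff α β hl
  have hX : HasDerivAt (fun t : ℝ => ((Real.exp (-2 * t) : ℝ) : ℂ))
      (-2 * (Real.exp (-2 * t) : ℝ)) t := by
    have : HasDerivAt (fun t : ℝ => Real.exp (-2 * t)) (Real.exp (-2 * t) * (-2 * 1)) t :=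
      ((hasDerivAt_id t).const_mul (-2)).exp
    convert! this.ofReal_comp using 1
    push_cast
    ring
  have hf := HasDerivAt.scomp (h := fun t : ℝ => ((Real.exp (-2 * t) : ℝ) : ℂ)) t
    (hu.hasDerivAt hz) hX
  have hf1 := HasDerivAt.scomp (h := fun t : ℝ => ((Real.exp (-2 * t) : ℝ) : ℂ)) t
    (hu.derivCoeff.hasDerivAt hz) hX
  have hE : HasDerivAt (fun t : ℝ => Complex.exp ((Complex.I * l - rho α β) * t))
      (Complex.exp ((Complex.I * l - rho α β) * t) * (Complex.I * l - rho α β)) t := by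
    have := ((Complex.ofRealCLM.hasDerivAt (x := t)).const_mul (Complex.I * l - rho α β)).cexp
    simpa using this
  have key := hcCoeff_ode α β hl hz
  simp only [smul_eq_mul] at hf hf1
  refine ⟨(hE.mul hf).congr_deriv ?_,
    (hE.mul ((hf.const_mul (Complex.I * l - rho α β)).sub ((hX.const_mul 2).mul hf1))).congr_deriv
      ?_⟩
  · simp only [jacobiSecondDeriv, Function.comp_apply]
    ring
  · have hX0 : Real.exp (-2 * t) < 1 := Real.exp_lt_one_iff.2 (by linarith)
    have hX1 := Real.exp_pos (-2 * t)
    rw [tanh_eq_exp]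
    clear hf hf1 hE hX
    simp only [jacobiSecondDeriv, jacobiSecond, Function.comp_apply, Pi.mul_apply, Pi.sub_apply]
    generalize pseries (hcCoeff α β l) (Real.exp (-2 * t) : ℝ) = F at *
    generalize pseries (derivCoeff (hcCoeff α β l)) (Real.exp (-2 * t) : ℝ) = F1 at *
    generalize pseries (derivCoeff (derivCoeff (hcCoeff α β l))) (Real.exp (-2 * t) : ℝ) = F2 at *
    generalize Complex.exp ((Complex.I * l - rho α β) * t) = E
    generalize Real.exp (-2 * t) = X at *
    have h1 : (1 : ℂ) - X ≠ 0 := by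
      rw [← Complex.ofReal_one, ← Complex.ofReal_sub, Complex.ofReal_ne_zero]; linarith
    have h2 : (1 : ℂ) + X ≠ 0 := by
      rw [← Complex.ofReal_one, ← Complex.ofReal_add, Complex.ofReal_ne_zero]; linarith
    generalize Complex.I * l = w at *
    simp only [rho] at *
    push_cast at *
    field_simp
    linear_combination 4 * E * key

/-- The density `sinh^{2α+1} t cosh^{2β+1} t`. -/
noncomputable def density (α β t : ℝ) : ℝ :=
  Real.sinh t ^ (2 * α + 1) * Real.cosh t ^ (2 * β + 1)

/-- The Wronskian with respect to `density`. -/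
noncomputable def wronskian (α β : ℝ) (f f' g g' : ℝ → ℂ) (t : ℝ) : ℂ :=
  density α β t * (f t * g' t - f' t * g t)

/-- The logarithmic derivative of `density` is `(2α+1) coth t + (2β+1) tanh t`, so it cancels the
first-order term of the equation. -/
lemma wronskian_const {α β : ℝ} {l : ℂ} {f f' g g' : ℝ → ℂ} (hf : IsJacobiSolution α β l f f')
    (hg : IsJacobiSolution α β l g g') {s t : ℝ} (hs : 0 < s) (ht : 0 < t) :
    wronskian α β f f' g g' s = wronskian α β f f' g g' t := by
  have hd : ∀ t > 0, HasDerivAt (wronskian α β f f' g g') 0 t := by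
    intro t ht
    have hs := Real.sinh_pos_iff.2 ht
    have hc := Real.cosh_pos t
    have h1 : HasDerivAt (density α β) _ t :=
      ((Real.hasDerivAt_sinh t).rpow_const (p := 2 * α + 1) (Or.inl hs.ne')).mul
        ((Real.hasDerivAt_cosh t).rpow_const (p := 2 * β + 1) (Or.inl hc.ne'))
    refine (h1.ofReal_comp.mul (((hf t ht).1.mul (hg t ht).2).sub
      ((hf t ht).2.mul (hg t ht).1))).congr_deriv ?_
    rw [Real.rpow_sub_one hs.ne', Real.rpow_sub_one hc.ne', density, Real.tanh_eq_sinh_div_cosh]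
    push_cast
    have hs' : ((Real.sinh t : ℝ) : ℂ) ≠ 0 := by exact_mod_cast hs.ne'
    have hc' : ((Real.cosh t : ℝ) : ℂ) ≠ 0 := by exact_mod_cast hc.ne'
    simp only [← Complex.ofReal_sinh, ← Complex.ofReal_cosh, Pi.sub_apply, Pi.mul_apply]
    generalize Real.sinh t ^ (2 * α + 1) = S
    generalize Real.cosh t ^ (2 * β + 1) = T
    field_simp
    ring
  refine isOpen_Ioi.is_const_of_deriv_eq_zero isPreconnected_Ioi
    (fun x hx => (hd x hx).differentiableAt.differentiableWithinAt)
    (fun x hx => (hd x hx).deriv) hs ht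

open Filter Topology in
lemma tendsto_density (α β : ℝ) :
    Tendsto (fun t => Real.exp (-2 * rho α β * t) * density α β t) atTop
      (𝓝 ((1 / 2) ^ (2 * rho α β))) := by
  have hX : Tendsto (fun t : ℝ => Real.exp (-2 * t)) atTop (𝓝 0) :=
    Real.tendsto_exp_atBot.comp (tendsto_id.const_mul_atTop_of_neg (by norm_num))
  have h1 : Tendsto (fun t : ℝ => ((1 - Real.exp (-2 * t)) / 2) ^ (2 * α + 1) *
      ((1 + Real.exp (-2 * t)) / 2) ^ (2 * β + 1)) atTop
      (𝓝 (((1 - 0) / 2) ^ (2 * α + 1) * ((1 + 0) / 2) ^ (2 * β + 1))) :=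
    (((hX.const_sub 1).div_const 2).rpow_const (Or.inl (by norm_num))).mul
      (((hX.const_add 1).div_const 2).rpow_const (Or.inl (by norm_num)))
  rw [sub_zero, add_zero, ← Real.rpow_add (by norm_num),
    show 2 * α + 1 + (2 * β + 1) = 2 * rho α β by rw [rho]; ring] at h1
  refine h1.congr' ?_
  filter_upwards [eventually_gt_atTop 0] with t ht
  have hs := Real.sinh_pos_iff.2 ht
  have hc := Real.cosh_pos t
  have e : Real.exp (-2 * t) = Real.exp (-t) * Real.exp (-t) := by
    rw [← Real.exp_add]; ring_nf
  have e1 : Real.exp t * Real.exp (-t) = 1 := by rw [← Real.exp_add]; simp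
  rw [show (1 - Real.exp (-2 * t)) / 2 = Real.exp (-t) * Real.sinh t by
      rw [Real.sinh_eq, e]; linear_combination -e1 / 2,
    show (1 + Real.exp (-2 * t)) / 2 = Real.exp (-t) * Real.cosh t by
      rw [Real.cosh_eq, e]; linear_combination -e1 / 2,
    Real.mul_rpow (Real.exp_pos _).le hs.le, Real.mul_rpow (Real.exp_pos _).le hc.le, density,
    ← Real.exp_mul, ← Real.exp_mul,
    show Real.exp (-2 * rho α β * t) = Real.exp (-t * (2 * α + 1)) * Real.exp (-t * (2 * β + 1)) by
      rw [← Real.exp_add, rho]; ring_nf]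
  ring

open Filter Topology in
lemma tendsto_pseries_exp {u : ℕ → ℂ} (hu : DiscSummable u) :
    Tendsto (fun t : ℝ => pseries u (Real.exp (-2 * t) : ℝ)) atTop (𝓝 (u 0)) := by
  have hX : Tendsto (fun t : ℝ => ((Real.exp (-2 * t) : ℝ) : ℂ)) atTop (𝓝 0) := by
    rw [← Complex.ofReal_zero]
    exact (Complex.continuous_ofReal.tendsto 0).comp
      (Real.tendsto_exp_atBot.comp (tendsto_id.const_mul_atTop_of_neg (by norm_num)))
  have := (hu.hasDerivAt (z := 0) (by simp)).continuousAt.tendsto.comp hX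
  rwa [pseries_zero] at this

open Filter Topology in
lemma tendsto_jacobiSecond (α β : ℝ) {l : ℂ} (hl : l ∈ sector) :
    Tendsto (fun t : ℝ => Complex.exp ((rho α β - Complex.I * l) * t) * jacobiSecond α β l t) atTop
      (𝓝 1) := by
  have := tendsto_pseries_exp (discSummable_hcCoeff α β hl)
  rw [show hcCoeff α β l 0 = 1 from by rw [hcCoeff]] at this
  refine this.congr fun t => ?_
  rw [jacobiSecond, ← mul_assoc, ← Complex.exp_add]
  ring_nf
  simp

open Filter Topology in
/-- The logarithmic derivative of `jacobiSecond` converges at the rate `e^{-2t}`. -/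
lemma tendsto_jacobiSecondDeriv_sub (α β : ℝ) {l : ℂ} (hl : l ∈ sector) :
    Tendsto (fun t : ℝ => Complex.exp ((rho α β + 2 - Complex.I * l) * t) *
      (jacobiSecondDeriv α β l t - (Complex.I * l - rho α β) * jacobiSecond α β l t)) atTop
      (𝓝 (-2 * hcCoeff α β l 1)) := by
  have := (tendsto_pseries_exp (discSummable_hcCoeff α β hl).derivCoeff).const_mul (-2)
  rw [show derivCoeff (hcCoeff α β l) 0 = hcCoeff α β l 1 by simp [derivCoeff]] at this
  refine this.congr fun t => ?_
  have e : Complex.exp ((rho α β + 2 - Complex.I * l) * t) *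
      Complex.exp ((Complex.I * l - rho α β) * t) * Complex.exp (-2 * t) = 1 := by
    rw [← Complex.exp_add, ← Complex.exp_add, ← Complex.exp_zero]
    ring_nf
  rw [jacobiSecondDeriv, jacobiSecond]
  push_cast
  linear_combination (2 * pseries (derivCoeff (hcCoeff α β l)) (Complex.exp (-2 * t))) * e

open Filter Topology in
lemma tendsto_jacobiSecondDeriv (α β : ℝ) {l : ℂ} (hl : l ∈ sector) :
    Tendsto (fun t : ℝ => Complex.exp ((rho α β - Complex.I * l) * t) * jacobiSecondDeriv α β l t)
      atTop (𝓝 (Complex.I * l - rho α β)) := by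
  have hX : Tendsto (fun t : ℝ => ((Real.exp (-2 * t) : ℝ) : ℂ)) atTop (𝓝 0) := by
    rw [← Complex.ofReal_zero]
    exact (Complex.continuous_ofReal.tendsto 0).comp
      (Real.tendsto_exp_atBot.comp (tendsto_id.const_mul_atTop_of_neg (by norm_num)))
  have := (hX.mul (tendsto_jacobiSecondDeriv_sub α β hl)).add
    ((tendsto_jacobiSecond α β hl).const_mul (Complex.I * l - rho α β))
  rw [zero_mul, zero_add, mul_one] at this
  refine this.congr fun t => ?_
  have e : Complex.exp ((rho α β + 2 - Complex.I * l) * t) * Complex.exp (-2 * t) =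
      Complex.exp ((rho α β - Complex.I * l) * t) := by
    rw [← Complex.exp_add]
    ring_nf
  push_cast
  linear_combination (jacobiSecondDeriv α β l t -
    (Complex.I * l - rho α β) * jacobiSecond α β l t) * e

lemma IsJacobiSolution.neg {α β : ℝ} {l : ℂ} {f f' : ℝ → ℂ} (hf : IsJacobiSolution α β (-l) f f') :
    IsJacobiSolution α β l f f' := by
  intro t ht
  refine ⟨(hf t ht).1, (hf t ht).2.congr_deriv ?_⟩
  ring

lemma ofReal_mem_sector (x : ℝ) : (x : ℂ) ∈ sector := by
  change -(x : ℂ).im < 1 / 2 + |(x : ℂ).re|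
  rw [Complex.ofReal_im]
  linarith [abs_nonneg (x : ℂ).re]

-- A Wronskian that is constant in `t` can be read off at infinity, where `density` behaves like
-- `2^{-2ρ} e^{2ρt}` and the solutions like `e^{(±iλ-ρ)t}`.
open Filter Topology in
lemma wronskian_jacobiSecond (α β x : ℝ) {t : ℝ} (ht : 0 < t) :
    wronskian α β (jacobiSecond α β (-x)) (jacobiSecondDeriv α β (-x)) (jacobiSecond α β x)
      (jacobiSecondDeriv α β x) t = (((1 / 2) ^ (2 * rho α β) : ℝ) : ℂ) * (2 * Complex.I * x) := by
  have hx := ofReal_mem_sector x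
  have hx' : -(x : ℂ) ∈ sector := by simpa using ofReal_mem_sector (-x)
  have h1 := ((Complex.continuous_ofReal.tendsto _).comp (tendsto_density α β)).mul
    (((tendsto_jacobiSecond α β hx').mul (tendsto_jacobiSecondDeriv α β hx)).sub
      ((tendsto_jacobiSecondDeriv α β hx').mul (tendsto_jacobiSecond α β hx)))
  have h2 := h1.congr' (f₂ := fun _ => wronskian α β (jacobiSecond α β (-x))
      (jacobiSecondDeriv α β (-x)) (jacobiSecond α β x) (jacobiSecondDeriv α β x) t) ?_
  · rw [tendsto_nhds_unique tendsto_const_nhds h2]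
    ring
  · filter_upwards [eventually_gt_atTop 0] with s hs
    rw [wronskian_const (jacobiSecond_isJacobiSolution α β hx').neg
      (jacobiSecond_isJacobiSolution α β hx) ht hs, wronskian]
    have e : Complex.exp (-2 * rho α β * s) * Complex.exp ((rho α β - Complex.I * x) * s) *
      Complex.exp ((rho α β - Complex.I * -x) * s) = 1 := by
      rw [← Complex.exp_add, ← Complex.exp_add, ← Complex.exp_zero]
      ring_nf
    simp only [Function.comp_apply]
    push_cast
    linear_combination ((density α β s : ℂ) *
      (jacobiSecond α β (-x) s * jacobiSecondDeriv α β x s -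
        jacobiSecondDeriv α β (-x) s * jacobiSecond α β x s)) * e

end JacobiAnalysis

/-! ### The hypergeometric expansion of the Jacobi function and its behaviour at the boundary point
1 -/

namespace JacobiAnalysis

/-- The coefficients of the hypergeometric series. -/
noncomputable def hypCoeff (a b c : ℂ) (n : ℕ) : ℂ :=
  (n.factorial : ℂ)⁻¹ * (ascPochhammer ℂ n).eval a * (ascPochhammer ℂ n).eval b *
    ((ascPochhammer ℂ n).eval c)⁻¹

lemma discSummable_hypCoeff (a b : ℂ) {c : ℂ} (hc : ∀ n : ℕ, c + n ≠ 0) :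
    DiscSummable (hypCoeff a b c) := by
  intro r h0 h1
  have := hypSummable (a := a) (b := b) hc (w := (r : ℂ)) (by simpa [abs_of_nonneg h0] using h1)
  refine this.congr fun n => ?_
  rw [norm_mul, norm_pow, Complex.norm_real, Real.norm_of_nonneg h0]
  rfl

lemma ascPochhammer_eval_ne_zero {c : ℂ} (hc : ∀ n : ℕ, c + n ≠ 0) (n : ℕ) :
    (ascPochhammer ℂ n).eval c ≠ 0 := by
  intro h
  obtain ⟨k, _, hk⟩ := (ascPochhammer_eval_eq_zero_iff n c).1 h
  exact hc k (by rw [hk]; ring)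

lemma hypCoeff_succ (a b : ℂ) {c : ℂ} (hc : ∀ n : ℕ, c + n ≠ 0) (n : ℕ) :
    ((n : ℂ) + 1) * (c + n) * hypCoeff a b c (n + 1) = (a + n) * (b + n) * hypCoeff a b c n := by
  have h1 := ascPochhammer_eval_ne_zero hc n
  have h2 := hc n
  have h3 : (n.factorial : ℂ) ≠ 0 := by exact_mod_cast n.factorial_ne_zero
  have h4 : (n : ℂ) + 1 ≠ 0 := by exact_mod_cast n.succ_ne_zero
  rw [hypCoeff, hypCoeff, ascPochhammer_succ_eval, ascPochhammer_succ_eval,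
    ascPochhammer_succ_eval, Nat.factorial_succ]
  push_cast
  field_simp

/-- The hypergeometric differential equation. -/
lemma hypCoeff_ode (a b : ℂ) {c : ℂ} (hc : ∀ n : ℕ, c + n ≠ 0) {z : ℂ} (hz : ‖z‖ < 1) :
    z * (1 - z) * pseries (derivCoeff (derivCoeff (hypCoeff a b c))) z +
      (c - (a + b + 1) * z) * pseries (derivCoeff (hypCoeff a b c)) z =
      a * b * pseries (hypCoeff a b c) z := by
  have hu := discSummable_hypCoeff a b hc
  have h0 := hu.hasSum hz
  have h1 := hu.hasSum_mul_deriv hz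
  have h2 := hu.hasSum_mul_deriv_deriv hz
  have hL := (hu.derivCoeff.hasSum_mul_deriv hz).add ((hu.derivCoeff.hasSum hz).mul_left c)
  have hR := ((h0.mul_left (a * b)).add (h1.mul_left (a + b + 1))).add h2
  have := hL.unique (hR.congr_fun fun n => ?_)
  · linear_combination this
  · have := hypCoeff_succ a b hc n
    simp only [derivCoeff]
    push_cast
    linear_combination z ^ n * this

/-- The coefficients of the expansion of the Jacobi function in powers of `tanh² t`. -/
noncomputable def jacobiCoeff (α β : ℝ) (l : ℂ) : ℕ → ℂ :=
  hypCoeff ((rho α β - Complex.I * l) / 2) ((α - β + 1 - Complex.I * l) / 2) (α + 1)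

/-- The derivative of the Jacobi function. -/
noncomputable def jacobiDeriv (α β : ℝ) (l : ℂ) (t : ℝ) : ℂ :=
  Complex.exp ((Complex.I * l - rho α β) * (Real.log (Real.cosh t) : ℝ)) *
    ((Complex.I * l - rho α β) * (Real.tanh t : ℝ) *
      pseries (jacobiCoeff α β l) ((Real.tanh t : ℝ) ^ 2) +
      2 * (Real.tanh t : ℝ) * (1 - (Real.tanh t : ℝ) ^ 2) *
        pseries (derivCoeff (jacobiCoeff α β l)) ((Real.tanh t : ℝ) ^ 2))

lemma add_one_add_ne_zero {α : ℝ} (hα : 0 < α) (n : ℕ) : (α : ℂ) + 1 + n ≠ 0 := by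
  rw [← Complex.ofReal_one, ← Complex.ofReal_add, ← Complex.ofReal_natCast, ← Complex.ofReal_add,
    Complex.ofReal_ne_zero]
  positivity

lemma discSummable_jacobiCoeff {α : ℝ} (hα : 0 < α) (β : ℝ) (l : ℂ) :
    DiscSummable (jacobiCoeff α β l) :=
  discSummable_hypCoeff _ _ (add_one_add_ne_zero hα)

/-- For `z = -sinh² t` the variable `z / (z - 1)` in `hyp` is `tanh² t`, and `1 - z = cosh² t`. -/
lemma jacobiFunction_eq (α β : ℝ) (l : ℂ) (t : ℝ) :
    jacobiFunction α β l t =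
      Complex.exp ((Complex.I * l - rho α β) * (Real.log (Real.cosh t) : ℝ)) *
        pseries (jacobiCoeff α β l) ((Real.tanh t : ℝ) ^ 2) := by
  have hc := Real.cosh_pos t
  have e : (1 : ℂ) - -((Real.sinh t : ℝ) : ℂ) ^ 2 = ((Real.cosh t ^ 2 : ℝ) : ℂ) := by
    rw [Real.cosh_sq]; push_cast; ring
  have e' : (-((Real.sinh t : ℝ) : ℂ) ^ 2 - 1) = -((Real.cosh t ^ 2 : ℝ) : ℂ) := by
    rw [← e]; ring
  rw [jacobiFunction, hyp, e, e', Complex.cpow_def_of_ne_zero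
    (by rw [Complex.ofReal_ne_zero]; positivity), ← Complex.ofReal_log (by positivity), Real.log_pow]
  congr 1
  · congr 1
    simp only [rho]
    push_cast
    ring
  · rw [neg_div_neg_eq, ordinaryHypergeometric_eq_tsum, pseries, Real.tanh_eq_sinh_div_cosh]
    refine tsum_congr fun n => ?_
    rw [jacobiCoeff, hypCoeff, smul_eq_mul]
    simp only [rho]
    push_cast
    rw [div_pow (Complex.sinh t) (Complex.cosh t) 2, show (α : ℂ) + 1 - (α + β + 1 + Complex.I * l) / 2 =
      (α - β + 1 - Complex.I * l) / 2 by ring]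

lemma norm_tanh_sq_lt_one (t : ℝ) : ‖((Real.tanh t : ℝ) : ℂ) ^ 2‖ < 1 := by
  rw [← Complex.ofReal_pow, Complex.norm_real, Real.norm_of_nonneg (sq_nonneg _)]
  exact Real.tanh_sq_lt_one t

lemma hasDerivAt_tanh (t : ℝ) : HasDerivAt Real.tanh (1 - Real.tanh t ^ 2) t := by
  have hc := Real.cosh_pos t
  have h := (Real.hasDerivAt_sinh t).div (Real.hasDerivAt_cosh t) hc.ne'
  refine (h.congr_deriv ?_).congr_of_eventuallyEq (Filter.Eventually.of_forall fun s => by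
    simp [Real.tanh_eq_sinh_div_cosh])
  rw [Real.tanh_eq_sinh_div_cosh]
  field_simp

lemma jacobiFunction_isJacobiSolution {α : ℝ} (hα : 0 < α) (β : ℝ) (l : ℂ) :
    IsJacobiSolution α β l (jacobiFunction α β l) (jacobiDeriv α β l) := by
  intro t ht
  have hz := norm_tanh_sq_lt_one t
  have hu := discSummable_jacobiCoeff hα β l
  have hT := (hasDerivAt_tanh t).ofReal_comp
  have hT2 := hT.pow 2
  have hf := HasDerivAt.scomp (h := fun t : ℝ => ((Real.tanh t : ℝ) : ℂ) ^ 2) t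
    (hu.hasDerivAt hz) hT2
  have hf1 := HasDerivAt.scomp (h := fun t : ℝ => ((Real.tanh t : ℝ) : ℂ) ^ 2) t
    (hu.derivCoeff.hasDerivAt hz) hT2
  have hE : HasDerivAt (fun t : ℝ =>
      Complex.exp ((Complex.I * l - rho α β) * (Real.log (Real.cosh t) : ℝ)))
      (Complex.exp ((Complex.I * l - rho α β) * (Real.log (Real.cosh t) : ℝ)) *
        ((Complex.I * l - rho α β) * (Real.tanh t : ℝ))) t := by
    have h := ((Real.hasDerivAt_cosh t).log (Real.cosh_pos t).ne').ofReal_comp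
    rw [Real.tanh_eq_sinh_div_cosh]
    exact (h.const_mul (Complex.I * l - rho α β)).cexp
  have key := hypCoeff_ode ((rho α β - Complex.I * l) / 2) ((α - β + 1 - Complex.I * l) / 2)
    (add_one_add_ne_zero hα) hz
  rw [← jacobiCoeff] at key
  simp only [smul_eq_mul] at hf hf1
  have hT0 : ((Real.tanh t : ℝ) : ℂ) ≠ 0 := by
    rw [Complex.ofReal_ne_zero, Real.tanh_eq_sinh_div_cosh]
    exact (div_pos (Real.sinh_pos_iff.2 ht) (Real.cosh_pos t)).ne'
  refine ⟨((hE.mul hf).congr_deriv ?_).congr_of_eventuallyEq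
      (Filter.Eventually.of_forall (jacobiFunction_eq α β l)),
    (hE.mul (((hT.const_mul (Complex.I * l - rho α β)).mul hf).add
      (((hT.const_mul 2).mul (hT2.const_sub 1)).mul hf1))).congr_deriv ?_⟩
  · simp only [jacobiDeriv, Function.comp_apply]
    push_cast
    ring
  · rw [jacobiFunction_eq]
    clear hf hf1 hE hT2 hT
    simp only [jacobiDeriv, Function.comp_apply, Pi.mul_apply, Pi.add_apply, Pi.pow_apply]
    generalize pseries (jacobiCoeff α β l) ((Real.tanh t : ℝ) ^ 2) = F at *
    generalize pseries (derivCoeff (jacobiCoeff α β l)) ((Real.tanh t : ℝ) ^ 2) = F1 at *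
    generalize pseries (derivCoeff (derivCoeff (jacobiCoeff α β l))) ((Real.tanh t : ℝ) ^ 2) =
      F2 at *
    generalize Complex.exp ((Complex.I * l - rho α β) * (Real.log (Real.cosh t) : ℝ)) = E
    simp only [rho] at *
    push_cast at *
    simp only [← Complex.ofReal_tanh] at *
    generalize ((Real.tanh t : ℝ) : ℂ) = T at *
    generalize Complex.I * l = w at *
    field_simp
    linear_combination 4 * E * (1 - T ^ 2) * key

open Filter Topology in
/-- An Abelian theorem: a power series with coefficients tending to `0` is `o(1 / (1 - r))`. -/
lemma tendsto_one_sub_mul_pseries {u : ℕ → ℂ} (hu : DiscSummable u)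
    (h : Tendsto u atTop (𝓝 0)) :
    Tendsto (fun r : ℝ => (1 - (r : ℂ)) * pseries u r) (𝓝[<] 1) (𝓝 0) := by
  -- Summation by parts: `v` is the sequence of differences of `u`, its partial sums are `u n → 0`,
  -- and `(1 - r) ∑ uₙ rⁿ = ∑ vₙ rⁿ` tends to `0` by Abel's limit theorem.
  let v : ℕ → ℂ := fun n => Nat.casesOn n (u 0) fun k => u (k + 1) - u k
  have hv : ∀ n, ∑ i ∈ Finset.range (n + 1), v i = u n := by
    intro n
    induction n with
    | zero => simp [v]
    | succ n ih => rw [Finset.sum_range_succ, ih]; simp [v]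
  have h1 := Complex.tendsto_tsum_powerSeries_nhdsWithin_lt (f := v) (l := 0)
    ((tendsto_add_atTop_iff_nat 1).1 (by simpa only [hv] using h))
  rw [tendsto_map'_iff] at h1
  refine h1.congr' ?_
  filter_upwards [Ioo_mem_nhdsLT (zero_lt_one (α := ℝ))] with r hr
  have hr' : ‖(r : ℂ)‖ < 1 := by
    rw [Complex.norm_real, Real.norm_of_nonneg hr.1.le]; exact hr.2
  have h2 := hu.hasSum hr'
  refine HasSum.tsum_eq ?_
  have h3 := ((hasSum_nat_add_iff' 1).2 h2).sub (h2.mul_left (r : ℂ))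
  rw [← hasSum_nat_add_iff' 1]
  convert! h3 using 1
  · ext n
    simp only [v]
    ring
  · simp [v]
    ring

lemma ascPochhammer_eval_eq_prod (s : ℂ) (n : ℕ) :
    (ascPochhammer ℂ n).eval s = ∏ j ∈ Finset.range n, (s + j) := by
  induction n with
  | zero => simp
  | succ n ih => rw [ascPochhammer_succ_eval, ih, Finset.prod_range_succ]

/-- Euler's limit formula for `Γ` is used as the asymptotics of Pochhammer symbols. -/
lemma ascPochhammer_mul_GammaSeq {s : ℂ} (hs : ∀ n : ℕ, s + n ≠ 0) (n : ℕ) :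
    (ascPochhammer ℂ (n + 1)).eval s * Complex.GammaSeq s n = (n : ℂ) ^ s * n.factorial := by
  rw [Complex.GammaSeq, ← ascPochhammer_eval_eq_prod,
    mul_div_cancel₀ _ (ascPochhammer_eval_ne_zero hs _)]

lemma GammaSeq_ne_zero {s : ℂ} (hs : ∀ n : ℕ, s + n ≠ 0) {n : ℕ} (hn : n ≠ 0) :
    Complex.GammaSeq s n ≠ 0 := by
  have h := ascPochhammer_mul_GammaSeq hs n
  have h1 : (n : ℂ) ^ s * n.factorial ≠ 0 := by
    refine mul_ne_zero ?_ (by exact_mod_cast n.factorial_ne_zero)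
    rw [Complex.cpow_def_of_ne_zero (by exact_mod_cast hn)]
    exact Complex.exp_ne_zero _
  rw [← h] at h1
  exact right_ne_zero_of_mul h1

lemma add_natCast_ne_zero_of_re_pos {s : ℂ} (hs : 0 < s.re) (n : ℕ) : s + n ≠ 0 := by
  intro h
  have := congrArg Complex.re h
  simp at this
  linarith [n.cast_nonneg (α := ℝ)]

/-- The coefficients of the binomial series of `(1 - z)^{-s}`. -/
noncomputable def binomCoeff (s : ℂ) (n : ℕ) : ℂ := (ascPochhammer ℂ n).eval s / n.factorial

/-- The derivative is used rather than the series itself: for imaginary `w = c - a - b` the function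
behaves near `1` like `A + B (1-z)^w`, two terms of equal size, while differentiation isolates the
second. -/
lemma derivCoeff_hypCoeff_eq {a b c w : ℂ} (ha : 0 < a.re) (hb : 0 < b.re) (hc : 0 < c.re)
    (hw : a + b - c = -w) {n : ℕ} (hn : n ≠ 0) : derivCoeff (hypCoeff a b c) n =
      (n : ℂ) ^ (-w) * (Complex.GammaSeq c n / (Complex.GammaSeq a n * Complex.GammaSeq b n)) := by
  have ha' := add_natCast_ne_zero_of_re_pos ha
  have hb' := add_natCast_ne_zero_of_re_pos hb
  have hc' := add_natCast_ne_zero_of_re_pos hc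
  have hn0 : (n : ℂ) ≠ 0 := by exact_mod_cast hn
  have ea := ascPochhammer_mul_GammaSeq ha' n
  have eb := ascPochhammer_mul_GammaSeq hb' n
  have ec := ascPochhammer_mul_GammaSeq hc' n
  have ga := GammaSeq_ne_zero ha' hn
  have gb := GammaSeq_ne_zero hb' hn
  have gc := GammaSeq_ne_zero hc' hn
  have pc := ascPochhammer_eval_ne_zero hc' (n + 1)
  have hf : (n.factorial : ℂ) ≠ 0 := by exact_mod_cast n.factorial_ne_zero
  have hn1 : (n : ℂ) + 1 ≠ 0 := by exact_mod_cast n.succ_ne_zero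
  have e1 : (n : ℂ) ^ a * (n : ℂ) ^ b = (n : ℂ) ^ c * (n : ℂ) ^ (-w) := by
    rw [← Complex.cpow_add _ _ hn0, ← Complex.cpow_add _ _ hn0, ← hw]; ring_nf
  rw [derivCoeff, hypCoeff, Nat.factorial_succ]
  push_cast
  rw [mul_div_assoc', eq_div_iff (mul_ne_zero ga gb)]
  field_simp
  have : (n : ℂ) ^ c ≠ 0 := by
    rw [Complex.cpow_def_of_ne_zero hn0]; exact Complex.exp_ne_zero _
  refine mul_left_cancel₀ this ?_
  linear_combination (n : ℂ) ^ c * (ascPochhammer ℂ (n + 1)).eval b * Complex.GammaSeq b n * ea +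
    (n : ℂ) ^ c * (n : ℂ) ^ a * n.factorial * eb + (n : ℂ) ^ c * n.factorial ^ 2 * e1 -
    (n : ℂ) ^ c * (n : ℂ) ^ (-w) * n.factorial * ec


-- Since `|n^{-w}| = 1` for imaginary `w`, the coefficients of the derivative are bounded, and those
-- of the series are `O(1/n)`.
open Filter Topology in
lemma tendsto_hypCoeff {a b c w : ℂ} (ha : 0 < a.re) (hb : 0 < b.re) (hc : 0 < c.re)
    (hw : a + b - c = -w) (hwre : w.re = 0) : Tendsto (hypCoeff a b c) atTop (𝓝 0) := by
  have Ga := Complex.Gamma_ne_zero_of_re_pos ha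
  have Gb := Complex.Gamma_ne_zero_of_re_pos hb
  rw [← tendsto_add_atTop_iff_nat 1, tendsto_zero_iff_norm_tendsto_zero]
  have h1 := (((Complex.GammaSeq_tendsto_Gamma c).div ((Complex.GammaSeq_tendsto_Gamma a).mul
    (Complex.GammaSeq_tendsto_Gamma b)) (mul_ne_zero Ga Gb)).norm).mul
      (tendsto_one_div_add_atTop_nhds_zero_nat (𝕜 := ℝ))
  rw [mul_zero] at h1
  refine h1.congr' ?_
  filter_upwards [eventually_ne_atTop 0] with n hn
  have hcp : ‖(n : ℂ) ^ (-w)‖ = 1 := by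
    rw [Complex.norm_natCast_cpow_of_pos (Nat.pos_of_ne_zero hn), Complex.neg_re, hwre, neg_zero,
      Real.rpow_zero]
  have h2 := congrArg norm (derivCoeff_hypCoeff_eq ha hb hc hw hn)
  rw [norm_mul, hcp, one_mul, derivCoeff, norm_mul, Complex.norm_natCast] at h2
  simp only [Pi.div_apply]
  rw [← h2]
  push_cast
  field_simp

open Filter Topology in
/-- The coefficients of the derivative of a hypergeometric series are asymptotic to those of a
binomial series. -/
lemma tendsto_derivCoeff_hypCoeff_sub {a b c w : ℂ} (ha : 0 < a.re) (hb : 0 < b.re) (hc : 0 < c.re)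
    (hw : a + b - c = -w) (hwre : w.re = 0) :
    Tendsto (fun n => derivCoeff (hypCoeff a b c) n -
      Complex.Gamma c * Complex.Gamma (1 - w) / (Complex.Gamma a * Complex.Gamma b) *
        binomCoeff (1 - w) n) atTop (𝓝 0) := by
  have h1w : 0 < (1 - w).re := by simp [hwre]
  have hw' := add_natCast_ne_zero_of_re_pos h1w
  have Ga := Complex.Gamma_ne_zero_of_re_pos ha
  have Gb := Complex.Gamma_ne_zero_of_re_pos hb
  have Gw := Complex.Gamma_ne_zero_of_re_pos h1w
  have hfrac : Tendsto (fun n : ℕ => (n : ℂ) / (n + (1 - w))) atTop (𝓝 1) :=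
    tendsto_natCast_div_add_atTop (1 - w)
  -- The coefficients of `(1-z)^{-(1-w)}` are asymptotic to `n^{-w} / Γ(1-w)`; `L` is the factor
  -- that matches them to those of the derivative.
  set L := Complex.Gamma c * Complex.Gamma (1 - w) / (Complex.Gamma a * Complex.Gamma b) with hL
  have hlim : Tendsto (fun n : ℕ => Complex.GammaSeq c n / (Complex.GammaSeq a n *
      Complex.GammaSeq b n) - L * ((n : ℂ) / (n + (1 - w))) / Complex.GammaSeq (1 - w) n) atTop
      (𝓝 (Complex.Gamma c / (Complex.Gamma a * Complex.Gamma b) - L * 1 / Complex.Gamma (1 - w))) :=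
    ((Complex.GammaSeq_tendsto_Gamma c).div ((Complex.GammaSeq_tendsto_Gamma a).mul
      (Complex.GammaSeq_tendsto_Gamma b)) (mul_ne_zero Ga Gb)).sub
      ((hfrac.const_mul L).div (Complex.GammaSeq_tendsto_Gamma (1 - w)) Gw)
  rw [show Complex.Gamma c / (Complex.Gamma a * Complex.Gamma b) - L * 1 / Complex.Gamma (1 - w) = 0
    by rw [hL]; field_simp; simp] at hlim
  rw [tendsto_zero_iff_norm_tendsto_zero] at hlim ⊢
  refine hlim.congr' ?_
  filter_upwards [eventually_ne_atTop 0] with n hn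
  have hn0 : (n : ℂ) ≠ 0 := by exact_mod_cast hn
  have hcp : ‖(n : ℂ) ^ (-w)‖ = 1 := by
    rw [Complex.norm_natCast_cpow_of_pos (Nat.pos_of_ne_zero hn), Complex.neg_re, hwre, neg_zero,
      Real.rpow_zero]
  rw [← one_mul ‖_ - _‖, ← hcp, ← norm_mul]
  congr 1
  have ew := ascPochhammer_mul_GammaSeq hw' n
  have gw := GammaSeq_ne_zero hw' hn
  have hf : (n.factorial : ℂ) ≠ 0 := by exact_mod_cast n.factorial_ne_zero
  have hnw : (n : ℂ) + (1 - w) ≠ 0 := by rw [add_comm]; exact hw' n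
  have e2 : (n : ℂ) ^ (1 - w) = n * (n : ℂ) ^ (-w) := by
    rw [sub_eq_add_neg, Complex.cpow_add _ _ hn0, Complex.cpow_one]
  have B : binomCoeff (1 - w) n = (n : ℂ) ^ (-w) *
      ((n : ℂ) / (n + (1 - w)) / Complex.GammaSeq (1 - w) n) := by
    rw [binomCoeff]
    rw [ascPochhammer_succ_eval, e2] at ew
    field_simp
    linear_combination ew
  rw [derivCoeff_hypCoeff_eq ha hb hc hw hn, B]
  ring

end JacobiAnalysis

/-! ### Asymptotics of the Jacobi function at infinity and the connection formula -/

namespace JacobiAnalysis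

open Filter Topology in
lemma tendsto_sub_log_cosh :
    Tendsto (fun t : ℝ => t - Real.log (Real.cosh t)) atTop (𝓝 (Real.log 2)) := by
  have hX : Tendsto (fun t : ℝ => Real.exp (-2 * t)) atTop (𝓝 0) :=
    Real.tendsto_exp_atBot.comp (tendsto_id.const_mul_atTop_of_neg (by norm_num))
  have h := (((hX.const_add 1).div_const 2).log (by norm_num)).neg
  rw [show -Real.log ((1 + 0) / 2) = Real.log 2 by rw [add_zero, one_div, Real.log_inv, neg_neg]]
    at h
  refine h.congr fun t => ?_
  have e : Real.exp (-2 * t) = Real.exp (-t) * Real.exp (-t) := by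
    rw [← Real.exp_add]; ring_nf
  have e1 : Real.exp t * Real.exp (-t) = 1 := by rw [← Real.exp_add]; simp
  rw [show (1 + Real.exp (-2 * t)) / 2 = Real.exp (-t) * Real.cosh t by
      rw [Real.cosh_eq, e]; linear_combination -e1 / 2,
    Real.log_mul (Real.exp_pos _).ne' (Real.cosh_pos _).ne', Real.log_exp]
  ring

open Filter Topology in
lemma tendsto_tanh : Tendsto Real.tanh atTop (𝓝 1) := by
  have hX : Tendsto (fun t : ℝ => Real.exp (-2 * t)) atTop (𝓝 0) :=
    Real.tendsto_exp_atBot.comp (tendsto_id.const_mul_atTop_of_neg (by norm_num))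
  have h := (hX.const_sub 1).div (hX.const_add 1) (by norm_num)
  rw [show ((1 : ℝ) - 0) / (1 + 0) = 1 by norm_num] at h
  exact h.congr fun t => (tanh_eq_exp t).symm

open Filter Topology in
lemma tendsto_tanh_sq : Tendsto (fun t => Real.tanh t ^ 2) atTop (𝓝[<] 1) := by
  refine tendsto_nhdsWithin_of_tendsto_nhds_of_eventually_within _ ?_
    (Eventually.of_forall Real.tanh_sq_lt_one)
  simpa using tendsto_tanh.pow 2

lemma one_sub_tanh_sq (t : ℝ) :
    (1 : ℂ) - (Real.tanh t : ℝ) ^ 2 = Complex.exp (-2 * (Real.log (Real.cosh t) : ℝ)) := by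
  have hc := Real.cosh_pos t
  have : Real.exp (-2 * Real.log (Real.cosh t)) = 1 - Real.tanh t ^ 2 := by
    rw [neg_mul, Real.exp_neg, two_mul, Real.exp_add, Real.exp_log hc,
      Real.tanh_eq_sinh_div_cosh]
    have := Real.cosh_sq t
    field_simp
    linarith
  have h2 := congrArg (fun x : ℝ => (x : ℂ)) this
  push_cast at h2 ⊢
  exact h2.symm

open Filter Topology in
lemma tendsto_exp_I_mul {g f : ℝ → ℂ} (hf : Tendsto f atTop (𝓝 0)) (hg : ∀ t, ‖g t‖ = 1) :
    Tendsto (fun t => g t * f t) atTop (𝓝 0) := by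
  rw [tendsto_zero_iff_norm_tendsto_zero] at hf ⊢
  refine hf.congr fun t => ?_
  rw [norm_mul, hg, one_mul]

lemma norm_exp_I_mul (x s : ℝ) : ‖Complex.exp (2 * (Complex.I * x) * s)‖ = 1 := by
  rw [show 2 * (Complex.I * x) * s = ((2 * x * s : ℝ) : ℂ) * Complex.I by push_cast; ring,
    Complex.norm_exp_ofReal_mul_I]

/-- The limit of `(1 - z)^{1 - iλ} F'(z)` as `z → 1`, for the expansion `F` of the Jacobi function
in powers of `z = tanh² t`. -/
noncomputable def jacobiLimit (α β : ℝ) (l : ℂ) : ℂ :=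
  Complex.Gamma (α + 1) * Complex.Gamma (1 - Complex.I * l) /
    (Complex.Gamma ((rho α β - Complex.I * l) / 2) *
      Complex.Gamma ((α - β + 1 - Complex.I * l) / 2))

lemma re_sub_I_mul (r x : ℝ) : (((r : ℂ) - Complex.I * x) / 2).re = r / 2 := by
  rw [show ((r : ℂ) - Complex.I * x) / 2 = ((r / 2 : ℝ) : ℂ) + ((-x / 2 : ℝ) : ℂ) * Complex.I by
    push_cast; ring]
  simp

section Asymptotics

open Filter Topology

variable {α β : ℝ}

lemma tendsto_derivCoeff_jacobiCoeff (hα : 0 < α) (hρ : 0 < rho α β) (hβ : β < α + 1) (x : ℝ) :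
    Tendsto (fun n => derivCoeff (jacobiCoeff α β x) n -
      jacobiLimit α β x * binomCoeff (1 - Complex.I * x) n) atTop (𝓝 0) := by
  refine tendsto_derivCoeff_hypCoeff_sub ?_ ?_ ?_ ?_ ?_
  · rw [re_sub_I_mul]; linarith
  · have := re_sub_I_mul (α - β + 1) x
    push_cast at this
    rw [this]; linarith
  · simp; linarith
  · simp only [rho]; push_cast; ring
  · simp

lemma discSummable_binomCoeff (s : ℂ) : DiscSummable (binomCoeff s) := by
  intro r h0 h1
  have := (binom (z := (r : ℂ)) (by rwa [Complex.norm_real, Real.norm_of_nonneg h0]) s).summable.norm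
  refine this.congr fun n => ?_
  rw [norm_mul, norm_pow, Complex.norm_real, Real.norm_of_nonneg h0]
  rfl

lemma DiscSummable.sub {u v : ℕ → ℂ} (hu : DiscSummable u) (hv : DiscSummable v) :
    DiscSummable (fun n => u n - v n) := by
  intro r h0 h1
  refine Summable.of_nonneg_of_le (fun n => by positivity) (fun n => ?_)
    ((hu r h0 h1).add (hv r h0 h1))
  rw [← add_mul]
  gcongr
  exact norm_sub_le _ _

lemma DiscSummable.const_mul {u : ℕ → ℂ} (hu : DiscSummable u) (a : ℂ) :
    DiscSummable (fun n => a * u n) := by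
  intro r h0 h1
  refine ((hu r h0 h1).mul_left ‖a‖).congr fun n => ?_
  rw [norm_mul]; ring

lemma jacobi_params (hρ : 0 < rho α β) (hβ : β < α + 1) (x : ℝ) :
    0 < ((rho α β - Complex.I * x) / 2).re ∧ 0 < (((α : ℂ) - β + 1 - Complex.I * x) / 2).re := by
  constructor
  · rw [re_sub_I_mul]; linarith
  · have := re_sub_I_mul (α - β + 1) x
    push_cast at this
    rw [this]; linarith

lemma tendsto_one_sub_mul_pseries_jacobiCoeff (hα : 0 < α) (hρ : 0 < rho α β) (hβ : β < α + 1)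
    (x : ℝ) : Tendsto (fun t : ℝ => (1 - (Real.tanh t : ℂ) ^ 2) *
      pseries (jacobiCoeff α β x) ((Real.tanh t : ℂ) ^ 2)) atTop (𝓝 0) := by
  have h : Tendsto (jacobiCoeff α β x) atTop (𝓝 0) := by
    refine tendsto_hypCoeff (w := Complex.I * x) (jacobi_params hρ hβ x).1 (jacobi_params hρ hβ x).2
      ?_ ?_ ?_
    · simp; linarith
    · simp only [rho]; push_cast; ring
    · simp
  refine ((tendsto_one_sub_mul_pseries (discSummable_jacobiCoeff hα β x) h).comp
    tendsto_tanh_sq).congr fun t => ?_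
  simp only [Function.comp_apply, Complex.ofReal_pow]

/-- The limit of `F'(z)(1 - z)^{1 - iλ}` at `z = tanh² t → 1`. -/
lemma tendsto_pseries_derivCoeff_jacobiCoeff (hα : 0 < α) (hρ : 0 < rho α β) (hβ : β < α + 1)
    (x : ℝ) : Tendsto (fun t : ℝ =>
      Complex.exp (2 * (Complex.I * x) * (Real.log (Real.cosh t) : ℝ)) *
      ((1 - (Real.tanh t : ℂ) ^ 2) *
      pseries (derivCoeff (jacobiCoeff α β x)) ((Real.tanh t : ℂ) ^ 2))) atTop
        (𝓝 (jacobiLimit α β x)) := by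
  have hF := (discSummable_jacobiCoeff hα β x).derivCoeff
  have hB := (discSummable_binomCoeff (1 - Complex.I * x)).const_mul (jacobiLimit α β x)
  -- Once the matching multiple of `(1-z)^{-(1-iλ)}` is subtracted, the coefficients tend to `0` and
  -- the Abelian theorem applies; the exponential prefactor is unimodular.
  have h := tendsto_exp_I_mul (g := fun t : ℝ =>
      Complex.exp (2 * (Complex.I * x) * (Real.log (Real.cosh t) : ℝ)))
    ((tendsto_one_sub_mul_pseries (hF.sub hB)
      (tendsto_derivCoeff_jacobiCoeff hα hρ hβ x)).comp tendsto_tanh_sq)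
    (fun t => norm_exp_I_mul x _)
  have h' := h.add_const (jacobiLimit α β x)
  rw [zero_add] at h'
  refine h'.congr fun t => ?_
  have hz := norm_tanh_sq_lt_one t
  have hc := Real.cosh_pos t
  simp only [Function.comp_apply, Complex.ofReal_pow]
  have e := ((hF.sub hB).hasSum hz).unique ((hF.hasSum hz).sub
    (((binom hz (1 - Complex.I * x)).mul_left (jacobiLimit α β x))) |>.congr_fun fun n => by
      simp only [binomCoeff]; ring)
  have e2 : (1 - ((Real.tanh t : ℝ) : ℂ) ^ 2) ^ (-(1 - Complex.I * x)) =
      Complex.exp (2 * (Real.log (Real.cosh t) : ℝ) * (1 - Complex.I * x)) := by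
    have : (1 : ℂ) - (Real.tanh t : ℝ) ^ 2 = (((Real.cosh t)⁻¹ ^ 2 : ℝ) : ℂ) := by
      rw [inv_pow, ← Complex.ofReal_pow, ← Complex.ofReal_one, ← Complex.ofReal_sub,
        Real.tanh_eq_sinh_div_cosh]
      congr 1
      have := Real.cosh_sq t
      field_simp
      linarith
    rw [this, Complex.cpow_def_of_ne_zero (by rw [Complex.ofReal_ne_zero]; positivity),
      ← Complex.ofReal_log (by positivity), Real.log_pow, Real.log_inv]
    push_cast
    ring_nf
  have e3 : Complex.exp (2 * (Complex.I * x) * (Real.log (Real.cosh t) : ℝ)) *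
      Complex.exp (-2 * (Real.log (Real.cosh t) : ℝ)) *
      Complex.exp (2 * (Real.log (Real.cosh t) : ℝ) * (1 - Complex.I * x)) = 1 := by
    rw [← Complex.exp_add, ← Complex.exp_add]
    exact Complex.exp_eq_one_iff.2 ⟨0, by push_cast; ring⟩
  rw [e, e2, one_sub_tanh_sq]
  linear_combination -jacobiLimit α β x * e3

lemma tendsto_exp_sub_log_cosh (w : ℂ) :
    Tendsto (fun t : ℝ => Complex.exp (w * ((t - Real.log (Real.cosh t) : ℝ) : ℂ))) atTop
      (𝓝 (2 ^ w)) := by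
  rw [Complex.cpow_def_of_ne_zero two_ne_zero, mul_comm (Complex.log 2),
    show Complex.log 2 = ((Real.log 2 : ℝ) : ℂ) by rw [Complex.ofReal_log (by norm_num)]; norm_num]
  exact (Complex.continuous_exp.tendsto _).comp
    (((Complex.continuous_ofReal.tendsto _).comp tendsto_sub_log_cosh).const_mul w)

/-- This crude bound loses a factor `e^{2t}` against the size `e^{-ρt}`. It suffices, since in the
Wronskian it meets `tendsto_jacobiSecondDeriv_sub`, which gains `e^{-2t}`. -/
lemma tendsto_jacobiFunction (hα : 0 < α) (hρ : 0 < rho α β) (hβ : β < α + 1) (x : ℝ) :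
    Tendsto (fun t : ℝ => Complex.exp ((rho α β - 2 + Complex.I * x) * t) *
      jacobiFunction α β x t) atTop (𝓝 0) := by
  have h := (tendsto_exp_sub_log_cosh (rho α β - 2 + Complex.I * x)).mul
    (tendsto_exp_I_mul (tendsto_one_sub_mul_pseries_jacobiCoeff hα hρ hβ x)
      (fun t => norm_exp_I_mul x (Real.log (Real.cosh t))))
  rw [mul_zero] at h
  refine h.congr fun t => ?_
  have e : Complex.exp ((rho α β - 2 + Complex.I * x) * ((t - Real.log (Real.cosh t) : ℝ) : ℂ)) *
      Complex.exp (2 * (Complex.I * x) * (Real.log (Real.cosh t) : ℝ)) *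
      Complex.exp (-2 * (Real.log (Real.cosh t) : ℝ)) =
      Complex.exp ((rho α β - 2 + Complex.I * x) * t) *
      Complex.exp ((Complex.I * x - rho α β) * (Real.log (Real.cosh t) : ℝ)) := by
    rw [← Complex.exp_add, ← Complex.exp_add, ← Complex.exp_add]
    push_cast
    ring_nf
  rw [one_sub_tanh_sq, jacobiFunction_eq]
  linear_combination pseries (jacobiCoeff α β x) ((Real.tanh t : ℝ) ^ 2) * e

/-- Subtracting `(iλ-ρ) φ_λ` cancels the `e^{(iλ-ρ)t}` component of the derivative and leaves the
`e^{-(iλ+ρ)t}` component, which is governed by the derivative of the power series. -/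
lemma tendsto_jacobiDeriv_sub (hα : 0 < α) (hρ : 0 < rho α β) (hβ : β < α + 1) (x : ℝ) :
    Tendsto (fun t : ℝ => Complex.exp ((rho α β + Complex.I * x) * t) *
      (jacobiDeriv α β x t - (Complex.I * x - rho α β) * jacobiFunction α β x t)) atTop
      (𝓝 (2 ^ (rho α β + Complex.I * x) * (2 * jacobiLimit α β x))) := by
  have hT : Tendsto (fun t : ℝ => ((Real.tanh t : ℝ) : ℂ)) atTop (𝓝 1) := by
    rw [← Complex.ofReal_one]
    exact (Complex.continuous_ofReal.tendsto _).comp tendsto_tanh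
  have hA := ((tendsto_one_sub_mul_pseries_jacobiCoeff hα hρ hβ x).div (hT.const_add 1)
    (by norm_num)).const_mul (-(Complex.I * x - rho α β))
  rw [zero_div, mul_zero] at hA
  have hA' := tendsto_exp_I_mul hA (fun t => norm_exp_I_mul x (Real.log (Real.cosh t)))
  have h := (tendsto_exp_sub_log_cosh (rho α β + Complex.I * x)).mul
    (hA'.add ((hT.const_mul 2).mul (tendsto_pseries_derivCoeff_jacobiCoeff hα hρ hβ x)))
  rw [zero_add, mul_one] at h
  refine h.congr' ?_
  filter_upwards [eventually_gt_atTop 0] with t ht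
  have e : Complex.exp ((rho α β + Complex.I * x) * ((t - Real.log (Real.cosh t) : ℝ) : ℂ)) *
      Complex.exp (2 * (Complex.I * x) * (Real.log (Real.cosh t) : ℝ)) =
      Complex.exp ((rho α β + Complex.I * x) * t) *
      Complex.exp ((Complex.I * x - rho α β) * (Real.log (Real.cosh t) : ℝ)) := by
    rw [← Complex.exp_add, ← Complex.exp_add]
    push_cast
    ring_nf
  have hT1 : (1 : ℂ) + (Real.tanh t : ℝ) ≠ 0 := by
    rw [← Complex.ofReal_one, ← Complex.ofReal_add, Complex.ofReal_ne_zero]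
    linarith [Real.neg_one_lt_tanh t]
  rw [jacobiFunction_eq, jacobiDeriv]
  simp only [Pi.div_apply]
  generalize pseries (jacobiCoeff α β x) ((Real.tanh t : ℝ) ^ 2) = F at *
  generalize pseries (derivCoeff (jacobiCoeff α β x)) ((Real.tanh t : ℝ) ^ 2) = F1 at *
  generalize ((Real.tanh t : ℝ) : ℂ) = T at *
  have e2 : (1 - T ^ 2) * F / (1 + T) = (1 - T) * F := by
    field_simp
    ring
  rw [e2]
  linear_combination ((Complex.I * x - rho α β) * (T - 1) * F + 2 * T * (1 - T ^ 2) * F1) * e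

/-- With `μ = iλ - ρ`, `f g' - f' g = f (g' - μ g) - (f' - μ f) g`. Against the density the first
product tends to `0`, so only the second contributes at infinity. -/
lemma wronskian_jacobiFunction (hα : 0 < α) (hρ : 0 < rho α β) (hβ : β < α + 1) (x : ℝ) {t : ℝ}
    (ht : 0 < t) : wronskian α β (jacobiFunction α β x) (jacobiDeriv α β x) (jacobiSecond α β x)
      (jacobiSecondDeriv α β x) t = -((((1 / 2) ^ (2 * rho α β) : ℝ) : ℂ) *
        (2 ^ (rho α β + Complex.I * x) * (2 * jacobiLimit α β x))) := by
  have hx := ofReal_mem_sector x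
  have h1 := ((Complex.continuous_ofReal.tendsto _).comp (tendsto_density α β)).mul
    (((tendsto_jacobiFunction hα hρ hβ x).mul (tendsto_jacobiSecondDeriv_sub α β hx)).sub
      ((tendsto_jacobiDeriv_sub hα hρ hβ x).mul (tendsto_jacobiSecond α β hx)))
  have h2 := h1.congr' (f₂ := fun _ => wronskian α β (jacobiFunction α β x) (jacobiDeriv α β x)
      (jacobiSecond α β x) (jacobiSecondDeriv α β x) t) ?_
  · rw [tendsto_nhds_unique tendsto_const_nhds h2]
    ring
  · filter_upwards [eventually_gt_atTop 0] with s hs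
    rw [wronskian_const (jacobiFunction_isJacobiSolution hα β x)
      (jacobiSecond_isJacobiSolution α β hx) ht hs, wronskian]
    have e : Complex.exp (-2 * rho α β * s) * Complex.exp ((rho α β - 2 + Complex.I * x) * s) *
      Complex.exp ((rho α β + 2 - Complex.I * x) * s) = 1 := by
      rw [← Complex.exp_add, ← Complex.exp_add, ← Complex.exp_zero]
      ring_nf
    have e' : Complex.exp (-2 * rho α β * s) * Complex.exp ((rho α β + Complex.I * x) * s) *
      Complex.exp ((rho α β - Complex.I * x) * s) = 1 := by
      rw [← Complex.exp_add, ← Complex.exp_add, ← Complex.exp_zero]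
      ring_nf
    simp only [Function.comp_apply]
    push_cast
    linear_combination ((density α β s : ℂ) * jacobiFunction α β x s *
      (jacobiSecondDeriv α β x s - (Complex.I * x - rho α β) * jacobiSecond α β x s)) * e -
      ((density α β s : ℂ) * (jacobiDeriv α β x s - (Complex.I * x - rho α β) *
        jacobiFunction α β x s) * jacobiSecond α β x s) * e'

end Asymptotics

/-- The normalizing constant in the connection formula. -/
noncomputable def connectionConst (α : ℝ) : ℂ := Complex.Gamma (α + 1) / (2 * (Real.sqrt Real.pi : ℝ))

/-- Legendre's duplication formula merges the two Gamma factors in the numerator of `c(-λ)` into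
`Γ(-iλ)`, and `Γ(1-iλ) = -iλ Γ(-iλ)`. -/
lemma connectionConst_mul_cFunction (α β : ℝ) {x : ℝ} (hx : x ≠ 0) :
    connectionConst α * cFunction α β (-x) * (Complex.I * x) =
      -(2 ^ (rho α β + Complex.I * x) * jacobiLimit α β x) := by
  have hI : Complex.I * x ≠ 0 := mul_ne_zero Complex.I_ne_zero (by exact_mod_cast hx)
  have h1 := Complex.Gamma_mul_Gamma_add_half (-(Complex.I * x) / 2)
  have h2 := Complex.Gamma_add_one (-(Complex.I * x)) (neg_ne_zero.2 hI)
  rw [show 2 * (-(Complex.I * x) / 2) = -(Complex.I * x) by ring] at h1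
  rw [connectionConst, cFunction, jacobiLimit, sub_eq_neg_add 1 (Complex.I * x), h2,
    show Complex.I * -(x : ℂ) / 2 = -(Complex.I * x) / 2 by ring,
    show (1 + Complex.I * -(x : ℂ)) / 2 = -(Complex.I * x) / 2 + 1 / 2 by ring,
    show (rho α β + Complex.I * -(x : ℂ)) / 2 = (rho α β - Complex.I * x) / 2 by ring,
    show (rho α β - Complex.I * x) / 2 - β = (α - β + 1 - Complex.I * x) / 2 by
      simp only [rho]; push_cast; ring,
    mul_assoc ((2 : ℂ) ^ (rho α β : ℂ)), h1, Complex.cpow_add _ _ two_ne_zero,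
    show (1 : ℂ) - -(Complex.I * x) = 1 + Complex.I * x by ring,
    Complex.cpow_add 1 _ two_ne_zero, Complex.cpow_one]
  have hpi : ((Real.sqrt Real.pi : ℝ) : ℂ) ≠ 0 := by
    rw [Complex.ofReal_ne_zero]; positivity
  field_simp

/-- Changing the sign of `λ` swaps the two upper parameters, and near `t = 0` the function is the
symmetric series by `hyp_eq_series`. One point is enough, because the Wronskian is constant. -/
lemma jacobiFunction_neg_eventually {α : ℝ} (hα : 0 < α) (β : ℝ) (l : ℂ) :
    ∃ t₀ > 0, jacobiFunction α β (-l) t₀ = jacobiFunction α β l t₀ ∧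
      jacobiDeriv α β (-l) t₀ = jacobiDeriv α β l t₀ := by
  have hc : ∀ᶠ t : ℝ in nhds 0, ‖-((Real.sinh t : ℝ) : ℂ) ^ 2‖ < 1 / 2 := by
    have : ContinuousAt (fun t : ℝ => ‖-((Real.sinh t : ℝ) : ℂ) ^ 2‖) 0 := by fun_prop
    refine this.eventually_lt continuousAt_const ?_
    simp
  obtain ⟨δ, hδ, h⟩ := Metric.eventually_nhds_iff.1 hc
  have heq : ∀ t : ℝ, |t| < δ → jacobiFunction α β (-l) t = jacobiFunction α β l t := by
    intro t ht
    have ht' := h (y := t) (by simpa using ht)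
    rw [jacobiFunction, jacobiFunction, hyp_eq_series _ _ (add_one_add_ne_zero hα) ht',
      hyp_eq_series _ _ (add_one_add_ne_zero hα) ht', ordinaryHypergeometric,
      ordinaryHypergeometric, ordinaryHypergeometricSeries_symm]
    congr 2 <;> ring
  refine ⟨δ / 2, by positivity, heq _ (by rw [abs_of_pos (by positivity)]; linarith), ?_⟩
  have h1 := (jacobiFunction_isJacobiSolution hα β (-l) (δ / 2) (by positivity)).1
  have h2 := (jacobiFunction_isJacobiSolution hα β l (δ / 2) (by positivity)).1
  refine h1.unique (h2.congr_of_eventuallyEq ?_)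
  filter_upwards [Metric.ball_mem_nhds (δ / 2) (half_pos hδ)] with s hs
  refine heq s ?_
  rw [Metric.mem_ball, Real.dist_eq, abs_lt] at hs
  rw [abs_lt]
  constructor <;> linarith

/-- The connection formula for the Jacobi function. -/
theorem jacobiFunction_eq_jacobiSecond {α β : ℝ} (hα : 0 < α) (hρ : 0 < rho α β) (hβ : β < α + 1)
    {x : ℝ} (hx : x ≠ 0) {t : ℝ} (ht : 0 < t) : jacobiFunction α β x t =
      connectionConst α * (cFunction α β x * jacobiSecond α β x t +
        cFunction α β (-x) * jacobiSecond α β (-x) t) := by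
  have hxs := ofReal_mem_sector x
  have hxs' : -(x : ℂ) ∈ sector := by simpa using ofReal_mem_sector (-x)
  obtain ⟨t₀, ht₀, e1, e2⟩ := jacobiFunction_neg_eventually hα β x
  have hP : (((1 / 2) ^ (2 * rho α β) : ℝ) : ℂ) ≠ 0 := by
    rw [Complex.ofReal_ne_zero]; positivity
  have hI : Complex.I * x ≠ 0 := mul_ne_zero Complex.I_ne_zero (by exact_mod_cast hx)
  have w1 := wronskian_jacobiFunction hα hρ hβ x ht
  have w2 := wronskian_jacobiFunction hα hρ hβ (-x) ht₀
  have w0 := wronskian_jacobiSecond α β x ht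
  have c1 := connectionConst_mul_cFunction α β hx
  have c2 := connectionConst_mul_cFunction α β (neg_ne_zero.2 hx)
  push_cast at w2 c2
  rw [neg_neg] at c2
  -- The asymptotics give the Wronskian of `φ_{-λ}` with `Φ_{-λ}`; constancy lets `φ_λ` replace
  -- `φ_{-λ}` at the point `t₀` where the two agree with their derivatives.
  have w3 : wronskian α β (jacobiFunction α β x) (jacobiDeriv α β x) (jacobiSecond α β (-x))
      (jacobiSecondDeriv α β (-x)) t = wronskian α β (jacobiFunction α β (-x))
      (jacobiDeriv α β (-x)) (jacobiSecond α β (-x)) (jacobiSecondDeriv α β (-x)) t₀ := by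
    rw [wronskian_const (jacobiFunction_isJacobiSolution hα β x)
      (jacobiSecond_isJacobiSolution α β hxs').neg ht ht₀, wronskian, wronskian, e1, e2]
  rw [w2] at w3
  simp only [wronskian] at w0 w1 w3
  -- For any three functions `f W(g,h) - g W(f,h) + h W(f,g) = 0`. Taking `g = Φ_{-λ}` and `h =
  -- Φ_λ`, one may divide by `W(g,h)`, which is nonzero as `x ≠ 0`.
  refine mul_left_cancel₀ (mul_ne_zero hP (mul_ne_zero two_ne_zero hI)) ?_
  linear_combination -jacobiFunction α β x t * w0 + jacobiSecond α β (-x) t * w1 -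
    jacobiSecond α β x t * w3 -
    2 * (((1 / 2) ^ (2 * rho α β) : ℝ) : ℂ) * jacobiSecond α β (-x) t * c1 +
    2 * (((1 / 2) ^ (2 * rho α β) : ℝ) : ℂ) * jacobiSecond α β x t * c2

end JacobiAnalysis

/-! ### Polynomial growth of `1 / c(-λ)` in the sector -/

namespace JacobiAnalysis

lemma norm_one_add_le_exp (w : ℂ) : ‖1 + w‖ ≤ Real.exp (w.re + ‖w‖ ^ 2 / 2) := by
  have h1 : ‖1 + w‖ ^ 2 ≤ Real.exp (w.re + ‖w‖ ^ 2 / 2) ^ 2 := by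
    rw [← Real.exp_nat_mul, ← Complex.normSq_eq_norm_sq, ← Complex.normSq_eq_norm_sq,
      Complex.normSq_add]
    have := Real.add_one_le_exp (((2 : ℕ) : ℝ) * (w.re + Complex.normSq w / 2))
    push_cast at this
    simp
    linarith
  exact le_of_sq_le_sq h1 (Real.exp_pos _).le

lemma abs_log_add_one_sub_log_sub_inv_le {y : ℝ} (hy : 1 ≤ y) :
    |Real.log (y + 1) - Real.log y - 1 / y| ≤ 1 / y ^ 2 := by
  have hy0 : 0 < y := by linarith
  have e : Real.log (y + 1) - Real.log y = Real.log (1 + 1 / y) := by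
    rw [← Real.log_div (by linarith) hy0.ne']
    congr 1
    field_simp
  have h1 := Real.log_le_sub_one_of_pos (x := 1 + 1 / y) (by positivity)
  have h2 := Real.one_sub_inv_le_log_of_pos (x := 1 + 1 / y) (by positivity)
  have h3 : 1 / y - 1 / y ^ 2 ≤ 1 - (1 + 1 / y)⁻¹ := by
    rw [← sub_nonneg]
    have : 1 - (1 + 1 / y)⁻¹ - (1 / y - 1 / y ^ 2) = 1 / (y ^ 2 * (y + 1)) := by
      field_simp
      ring
    rw [this]
    positivity
  have h4 : 0 ≤ 1 / y ^ 2 := by positivity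
  rw [e, abs_le]
  constructor <;> linarith

lemma sum_one_div_sq_le {x : ℝ} (hx : 1 ≤ x) (n : ℕ) :
    ∑ j ∈ Finset.range n, 1 / (x + j) ^ 2 ≤ 2 / x := by
  have key : ∑ j ∈ Finset.range n, 1 / (x + j) ^ 2 ≤ 2 / x - 2 / (x + n) := by
    induction n with
    | zero => simp
    | succ n ih =>
      rw [Finset.sum_range_succ]
      have hp : 1 ≤ x + n := by linarith [n.cast_nonneg (α := ℝ)]
      have : 1 / (x + n) ^ 2 ≤ 2 / (x + n) - 2 / (x + (n + 1 : ℕ)) := by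
        push_cast
        rw [div_sub_div _ _ (by positivity) (by positivity), div_le_div_iff₀ (by positivity)
          (by positivity)]
        nlinarith
      linarith
  have : 0 ≤ 2 / (x + n) := by positivity
  linarith

/-- The ratio is `1 + (b-a)/(s+a+j)` with `s = -iλ/2`. Replacing `1/(s+a+j)` by `1/Y`, `Y = 1 +
|λ|/2 + j`, costs `O((1+|λ|)/Y²)`, and so does replacing `1/Y` by `log(Y+1) - log Y`. In a product
over `j` the logarithms telescope and the errors sum to a bound independent of `λ`. -/
lemma norm_ratio_le {a b : ℝ} (ha : 1 / 2 ≤ a) {l : ℂ} (hl : l ∈ sector) (j : ℕ) :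
    ‖(-(Complex.I * l) / 2 + b + j) / (-(Complex.I * l) / 2 + a + j)‖ ≤
      Real.exp ((b - a) * (Real.log (1 + ‖l‖ / 2 + j + 1) - Real.log (1 + ‖l‖ / 2 + j)) +
        (|b - a| * (16 * (2 + a)) + 128 * (b - a) ^ 2 + |b - a|) * (1 + ‖l‖ / 2) *
          (1 / (1 + ‖l‖ / 2 + j) ^ 2)) := by
  set r := ‖l‖ / 2 with hr
  set s := -(Complex.I * l) / 2 with hs
  set Y := 1 + r + j with hY
  have hr0 : 0 ≤ r := by positivity
  have hj0 : (0 : ℝ) ≤ j := j.cast_nonneg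
  have hY1 : 1 ≤ Y := by linarith
  have hY0 : 0 < Y := by linarith
  have hsn : ‖s‖ = r := by rw [hs, hr]; simp
  have h1 : Y ≤ 16 * ‖s + a + j‖ := by
    have := add_norm_le_of_mem_sector hl (k := 2 * a + 2 * j) (by linarith)
    rw [show (((2 * a + 2 * j : ℝ) : ℂ) - Complex.I * l) = 2 * (s + a + j) by
      rw [hs]; push_cast; ring, norm_mul, Complex.norm_ofNat] at this
    linarith
  have hp : 0 < ‖s + a + j‖ := by linarith
  have hne : s + a + j ≠ 0 := norm_pos_iff.1 hp
  have hYc : (Y : ℂ) ≠ 0 := by exact_mod_cast hY0.ne'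
  have hinv : ‖s + a + j‖⁻¹ ≤ 16 / Y := by
    rw [inv_le_comm₀ hp (by positivity), inv_div]
    linarith
  set w := ((b - a : ℝ) : ℂ) / (s + a + j) with hw
  have e : (s + b + j) / (s + a + j) = 1 + w := by
    rw [hw]
    field_simp
    push_cast
    ring
  have hwn : ‖w‖ ^ 2 / 2 ≤ 128 * (b - a) ^ 2 * (1 + r) * (1 / Y ^ 2) := by
    have : ‖w‖ ≤ |b - a| * (16 / Y) := by
      rw [hw, norm_div, Complex.norm_real, Real.norm_eq_abs, div_eq_mul_inv]
      gcongr
    calc ‖w‖ ^ 2 / 2 ≤ (|b - a| * (16 / Y)) ^ 2 / 2 := by gcongr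
      _ = 128 * (b - a) ^ 2 * 1 * (1 / Y ^ 2) := by
        rw [mul_pow, sq_abs, div_pow]; ring
      _ ≤ _ := by gcongr; linarith
  have hwre : w.re ≤ (b - a) * (1 / Y) + |b - a| * (16 * (2 + a)) * (1 + r) * (1 / Y ^ 2) := by
    have e1 : w = ((b - a) * (1 / Y) : ℝ) +
        ((b - a : ℝ) : ℂ) * ((Y - (s + a + j)) / ((s + a + j) * Y)) := by
      rw [hw]
      push_cast
      field_simp
      ring
    have e2 : ‖(Y : ℂ) - (s + a + j)‖ ≤ (2 + a) * (1 + r) := by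
      have : (Y : ℂ) - (s + a + j) = ((1 + r - a : ℝ) : ℂ) - s := by rw [hY]; push_cast; ring
      rw [this]
      refine (norm_sub_le _ _).trans ?_
      rw [Complex.norm_real, Real.norm_eq_abs, hsn]
      have : |1 + r - a| ≤ 1 + r + a := by rw [abs_le]; constructor <;> linarith
      nlinarith
    have e3 : ‖((Y : ℂ) - (s + a + j)) / ((s + a + j) * Y)‖ ≤
        (2 + a) * (1 + r) * ((16 / Y) * (1 / Y)) := by
      rw [norm_div, norm_mul, Complex.norm_real, Real.norm_of_nonneg hY0.le, div_eq_mul_inv,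
        mul_inv, ← one_div Y]
      gcongr
    calc w.re ≤ (b - a) * (1 / Y) +
        ‖((b - a : ℝ) : ℂ) * ((Y - (s + a + j)) / ((s + a + j) * Y))‖ := by
          rw [e1, Complex.add_re, Complex.ofReal_re]
          gcongr
          exact Complex.re_le_norm _
      _ ≤ (b - a) * (1 / Y) + |b - a| * ((2 + a) * (1 + r) * ((16 / Y) * (1 / Y))) := by
          rw [norm_mul, Complex.norm_real, Real.norm_eq_abs]
          gcongr
      _ = _ := by ring_nf
  have hlog : (b - a) * (1 / Y) ≤ (b - a) * (Real.log (Y + 1) - Real.log Y) +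
      |b - a| * (1 + r) * (1 / Y ^ 2) := by
    have h := abs_log_add_one_sub_log_sub_inv_le hY1
    have h' : |(b - a) * (Real.log (Y + 1) - Real.log Y - 1 / Y)| ≤ |b - a| * (1 / Y ^ 2) := by
      rw [abs_mul]; gcongr
    have h2 := (abs_le.1 h').1
    have h3 : |b - a| * (1 / Y ^ 2) ≤ |b - a| * (1 + r) * (1 / Y ^ 2) := by
      have := mul_nonneg (mul_nonneg (abs_nonneg (b - a)) hr0) (by positivity : 0 ≤ 1 / Y ^ 2)
      nlinarith
    linarith
  rw [e]
  refine (norm_one_add_le_exp w).trans (Real.exp_le_exp.2 ?_)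
  linarith

open Filter Topology in
/-- Ratios of Gamma functions have polynomial growth in the sector. -/
lemma exists_norm_Gamma_ratio_le {a : ℝ} (b : ℝ) (ha : 1 / 2 ≤ a) : ∃ C : ℝ, 0 < C ∧
    ∀ l ∈ sector, ‖Complex.Gamma (-(Complex.I * l) / 2 + a) *
      (Complex.Gamma (-(Complex.I * l) / 2 + b))⁻¹‖ ≤ C * (1 + ‖l‖ / 2) ^ (a - b) := by
  set D := |b - a| * (16 * (2 + a)) + 128 * (b - a) ^ 2 + |b - a| with hD
  have hD0 : 0 ≤ D := by positivity
  refine ⟨Real.exp (2 * D), Real.exp_pos _, fun l hl => ?_⟩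
  have key := fun j => norm_ratio_le (b := b) ha hl j
  set r := ‖l‖ / 2 with hr
  set s := -(Complex.I * l) / 2 with hs
  have hr0 : 0 ≤ r := by positivity
  -- This occurs at the poles, where `Complex.Gamma` takes the value `0`; its inverse `0` is then
  -- the true value of `1/Γ`.
  by_cases hG : Complex.Gamma (s + b) = 0
  · rw [hG, inv_zero, mul_zero, norm_zero]
    positivity
  have hlim := ((Complex.GammaSeq_tendsto_Gamma (s + a)).mul
    ((Complex.GammaSeq_tendsto_Gamma (s + b)).inv₀ hG)).norm
  have hlog : Tendsto (fun n : ℕ => Real.exp ((a - b) * Real.log ((n : ℝ) / (n + (2 + r))) +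
      (a - b) * Real.log (1 + r) + 2 * D)) atTop
      (𝓝 (Real.exp ((a - b) * Real.log 1 + (a - b) * Real.log (1 + r) + 2 * D))) := by
    have := (tendsto_natCast_div_add_atTop (2 + r)).log one_ne_zero
    exact (Real.continuous_exp.tendsto _).comp
      (((this.const_mul (a - b)).add_const _).add_const _)
  have hfin : Real.exp ((a - b) * Real.log 1 + (a - b) * Real.log (1 + r) + 2 * D) =
      Real.exp (2 * D) * (1 + r) ^ (a - b) := by
    rw [Real.log_one, mul_zero, zero_add, Real.exp_add, Real.rpow_def_of_pos (by linarith)]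
    ring_nf
  rw [hfin] at hlog
  refine le_of_tendsto_of_tendsto hlim hlog ?_
  filter_upwards [eventually_gt_atTop 0] with n hn
  have hn' : (0 : ℝ) < n := by exact_mod_cast hn
  have e : Complex.GammaSeq (s + a) n * (Complex.GammaSeq (s + b) n)⁻¹ =
      (n : ℂ) ^ ((a - b : ℝ) : ℂ) * ∏ j ∈ Finset.range (n + 1), ((s + b + j) / (s + a + j)) := by
    have hn0 : (n : ℂ) ≠ 0 := by exact_mod_cast hn.ne'
    have hf : (n.factorial : ℂ) ≠ 0 := by exact_mod_cast n.factorial_ne_zero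
    have hcp : (n : ℂ) ^ (s + b) ≠ 0 := by
      rw [Complex.cpow_def_of_ne_zero hn0]; exact Complex.exp_ne_zero _
    rw [Complex.GammaSeq, Complex.GammaSeq, Finset.prod_div_distrib,
      show (n : ℂ) ^ (s + a) = (n : ℂ) ^ (s + b) * (n : ℂ) ^ ((a - b : ℝ) : ℂ) by
        rw [← Complex.cpow_add _ _ hn0]; push_cast; ring_nf]
    field_simp
  rw [e, norm_mul, Complex.norm_natCast_cpow_of_pos hn, Complex.ofReal_re, norm_prod]
  calc _ ≤ (n : ℝ) ^ (a - b) * ∏ j ∈ Finset.range (n + 1),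
        Real.exp ((b - a) * (Real.log (1 + r + j + 1) - Real.log (1 + r + j)) +
          D * (1 + r) * (1 / (1 + r + j) ^ 2)) := by
        gcongr with j _
        exact key j
    -- The sum of logarithms collapses to `log(n+2+r) - log(1+r)`; as `n → ∞` its first term cancels
    -- the factor `n^{a-b}`, leaving `(1+r)^{a-b}`.
    _ = Real.exp ((a - b) * Real.log n + ((b - a) * (Real.log (1 + r + (n + 1 : ℕ)) -
          Real.log (1 + r + (0 : ℕ))) +
          D * (1 + r) * ∑ j ∈ Finset.range (n + 1), 1 / (1 + r + j) ^ 2)) := by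
        have h := Finset.sum_range_sub (fun j : ℕ => Real.log (1 + r + j)) (n + 1)
        rw [← Real.exp_sum, Finset.sum_add_distrib, ← Finset.mul_sum, ← Finset.mul_sum,
          Real.exp_add ((a - b) * Real.log n), Real.rpow_def_of_pos hn', mul_comm (Real.log _), ← h]
        push_cast
        simp only [add_assoc]
    _ ≤ _ := by
        rw [Real.exp_le_exp, Real.log_div hn'.ne' (by positivity)]
        have hsum := mul_le_mul_of_nonneg_left (sum_one_div_sq_le (x := 1 + r) (by linarith) (n + 1))
          (mul_nonneg hD0 (by linarith : 0 ≤ 1 + r))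
        have : D * (1 + r) * (2 / (1 + r)) = 2 * D := by field_simp
        rw [this] at hsum
        rw [show 1 + r + ((n + 1 : ℕ) : ℝ) = n + (2 + r) by push_cast; ring, Nat.cast_zero,
          add_zero]
        linarith

/-- The function `1 / c(-λ)`. -/
noncomputable def invC (α β : ℝ) (l : ℂ) : ℂ := (cFunction α β (-l))⁻¹

/-- The Gamma factors are paired so that the real shifts differ by `ρ/2` and `(α-β)/2`; these add up
to the growth exponent `α + 1/2`. -/
lemma invC_eq (α β : ℝ) (l : ℂ) : invC α β l = ((2 : ℂ) ^ (rho α β : ℂ))⁻¹ *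
    (Complex.Gamma (-(Complex.I * l) / 2 + (rho α β / 2 : ℝ)) *
      (Complex.Gamma (-(Complex.I * l) / 2 + (0 : ℝ)))⁻¹) *
    (Complex.Gamma (-(Complex.I * l) / 2 + ((α - β + 1) / 2 : ℝ)) *
      (Complex.Gamma (-(Complex.I * l) / 2 + (1 / 2 : ℝ)))⁻¹) := by
  rw [invC, cFunction, show Complex.I * -l / 2 = -(Complex.I * l) / 2 + (0 : ℝ) by push_cast; ring,
    show (1 + Complex.I * -l) / 2 = -(Complex.I * l) / 2 + (1 / 2 : ℝ) by push_cast; ring,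
    show (rho α β + Complex.I * -l) / 2 = -(Complex.I * l) / 2 + (rho α β / 2 : ℝ) by
      push_cast; ring,
    show -(Complex.I * l) / 2 + ((rho α β / 2 : ℝ) : ℂ) - β =
      -(Complex.I * l) / 2 + ((α - β + 1) / 2 : ℝ) by simp only [rho]; push_cast; ring,
    inv_div, div_eq_mul_inv, mul_inv, mul_inv]
  ring

/-- The poles come from the numerators only, at `-i(ρ+2j)` and `-i(α-β+1+2j)`, all on the imaginary
axis at or below `-i` and so outside the sector. The inverse Gamma factors are entire. -/
lemma differentiableOn_invC {α β : ℝ} (hρ : 1 ≤ rho α β) (hβ : β ≤ α) :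
    DifferentiableOn ℂ (invC α β) sector := by
  have hG : ∀ a : ℝ, 1 / 2 ≤ a → DifferentiableOn ℂ
      (fun l => Complex.Gamma (-(Complex.I * l) / 2 + a)) sector := by
    intro a ha l hl
    refine DifferentiableAt.differentiableWithinAt ?_
    refine DifferentiableAt.comp (g := Complex.Gamma) l
      (Complex.differentiableAt_Gamma _ fun m hm => ?_) (by fun_prop)
    have := ne_zero_of_mem_sector hl (k := 2 * a + 2 * m) (by linarith [m.cast_nonneg (α := ℝ)])
    apply this
    push_cast
    linear_combination 2 * hm
  have hI : ∀ b : ℝ, DifferentiableOn ℂ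
      (fun l => (Complex.Gamma (-(Complex.I * l) / 2 + b))⁻¹) sector := fun b =>
    (Complex.differentiable_one_div_Gamma.comp
      (f := fun l : ℂ => -(Complex.I * l) / 2 + b) (by fun_prop)).differentiableOn
  rw [show invC α β = _ from funext (invC_eq α β)]
  exact (((hG _ (by linarith)).mul (hI _)).const_mul _).mul ((hG _ (by linarith)).mul (hI _))

lemma exists_norm_invC_le {α β : ℝ} (hρ : 1 ≤ rho α β) (hβ : β ≤ α) : ∃ C : ℝ, 0 < C ∧
    ∀ l ∈ sector, ‖invC α β l‖ ≤ C * (1 + ‖l‖) ^ (α + 1 / 2) := by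
  obtain ⟨C1, h1, H1⟩ := exists_norm_Gamma_ratio_le 0 (a := rho α β / 2) (by linarith)
  obtain ⟨C2, h2, H2⟩ := exists_norm_Gamma_ratio_le (1 / 2) (a := (α - β + 1) / 2) (by linarith)
  refine ⟨‖((2 : ℂ) ^ (rho α β : ℂ))⁻¹‖ * C1 * C2, ?_, fun l hl => ?_⟩
  · have : (2 : ℂ) ^ (rho α β : ℂ) ≠ 0 := by
      rw [Complex.cpow_def_of_ne_zero two_ne_zero]; exact Complex.exp_ne_zero _
    have := norm_pos_iff.2 (inv_ne_zero this)
    positivity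
  · rw [invC_eq, norm_mul, norm_mul]
    have hl0 := norm_nonneg l
    calc _ ≤ ‖((2 : ℂ) ^ (rho α β : ℂ))⁻¹‖ * (C1 * (1 + ‖l‖ / 2) ^ (rho α β / 2 - 0)) *
          (C2 * (1 + ‖l‖ / 2) ^ ((α - β + 1) / 2 - 1 / 2)) := by
          gcongr
          · exact H1 l hl
          · exact H2 l hl
      _ = ‖((2 : ℂ) ^ (rho α β : ℂ))⁻¹‖ * C1 * C2 * (1 + ‖l‖ / 2) ^ (α + 1 / 2) := by
          rw [show α + 1 / 2 = (rho α β / 2 - 0) + ((α - β + 1) / 2 - 1 / 2) by rw [rho]; ring,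
            Real.rpow_add (by positivity)]
          ring
      _ ≤ _ := by
          have : 0 ≤ α + 1 / 2 := by rw [rho] at hρ; linarith
          gcongr
          linarith

end JacobiAnalysis

/-! ### Cauchy estimates on horizontal lines, Schwartz functions and Plancherel's formula -/

namespace JacobiAnalysis

lemma exists_pow_mul_exp_neg_sq_le {δ : ℝ} (hδ : 0 < δ) (J : ℕ) :
    ∃ C : ℝ, 0 < C ∧ ∀ x : ℝ, (1 + |x|) ^ J * Real.exp (-δ * x ^ 2) ≤ C := by
  refine ⟨J.factorial * Real.exp (1 + 1 / (4 * δ)), by positivity, fun x => ?_⟩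
  have h1 := Real.pow_div_factorial_le_exp (1 + |x|) (by positivity) J
  rw [div_le_iff₀ (by positivity)] at h1
  calc (1 + |x|) ^ J * Real.exp (-δ * x ^ 2)
      ≤ (Real.exp (1 + |x|) * J.factorial) * Real.exp (-δ * x ^ 2) := by gcongr
    _ = J.factorial * Real.exp (1 + |x| + -δ * x ^ 2) := by rw [Real.exp_add (1 + |x|)]; ring
    _ ≤ _ := by
      refine mul_le_mul_of_nonneg_left (Real.exp_le_exp.2 ?_) (by positivity)
      have : |x| + -δ * x ^ 2 ≤ 1 / (4 * δ) := by
        rw [le_div_iff₀ (by positivity), ← sq_abs x]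
        nlinarith [sq_nonneg (2 * δ * |x| - 1)]
      linarith

/-- Derivatives along a horizontal line of a holomorphic function. -/
lemma iteratedDeriv_horizontal {f : ℂ → ℂ} {S : Set ℂ} (hS : IsOpen S)
    (hf : DifferentiableOn ℂ f S) {y : ℝ} (hy : ∀ x : ℝ, (x : ℂ) + y * Complex.I ∈ S) (n : ℕ) :
    iteratedDeriv n (fun x : ℝ => f (x + y * Complex.I)) =
      fun x : ℝ => iteratedDeriv n f (x + y * Complex.I) := by
  induction n with
  | zero => simp
  | succ n ih =>
    rw [iteratedDeriv_succ, ih]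
    ext x
    have hA := (hf.analyticOnNhd hS _ (hy x)).iterated_deriv n
    rw [← iteratedDeriv_eq_iterate] at hA
    have h1 : HasDerivAt (fun x : ℝ => (x : ℂ) + y * Complex.I) 1 x :=
      Complex.ofRealCLM.hasDerivAt.add_const _
    have h2 := HasDerivAt.scomp (h := fun x : ℝ => (x : ℂ) + y * Complex.I) x
      hA.differentiableAt.hasDerivAt h1
    rw [one_smul] at h2
    rw [iteratedDeriv_succ]
    exact h2.deriv

lemma contDiff_horizontal {f : ℂ → ℂ} {S : Set ℂ} (hS : IsOpen S)
    (hf : DifferentiableOn ℂ f S) {y : ℝ} (hy : ∀ x : ℝ, (x : ℂ) + y * Complex.I ∈ S) :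
    ContDiff ℝ (⊤ : ℕ∞) (fun x : ℝ => f (x + y * Complex.I)) := by
  refine contDiff_iff_contDiffAt.2 fun x => ?_
  have h1 : ContDiffAt ℝ (⊤ : ℕ∞) f ((x : ℂ) + y * Complex.I) :=
    (((hf.analyticOnNhd hS) _ (hy x)).contDiffAt (n := (⊤ : ℕ∞))).restrict_scalars ℝ
  have h2 : ContDiffAt ℝ (⊤ : ℕ∞) (fun x : ℝ => (x : ℂ) + y * Complex.I) x :=
    (Complex.ofRealCLM.contDiff.add contDiff_const).contDiffAt
  exact ContDiffAt.comp (f := fun x : ℝ => (x : ℂ) + y * Complex.I) x h1 h2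

/-- Cauchy's estimate on a horizontal line. -/
lemma norm_iteratedDeriv_horizontal_le {f : ℂ → ℂ} {S : Set ℂ} (hS : IsOpen S)
    (hf : DifferentiableOn ℂ f S) {y : ℝ} (hy : ∀ x : ℝ, (x : ℂ) + y * Complex.I ∈ S) {x r C : ℝ}
    (hr : 0 < r) (hball : Metric.closedBall ((x : ℂ) + y * Complex.I) r ⊆ S)
    (hC : ∀ w ∈ Metric.closedBall ((x : ℂ) + y * Complex.I) r, ‖f w‖ ≤ C) (n : ℕ) :
    ‖iteratedDeriv n (fun x : ℝ => f (x + y * Complex.I)) x‖ ≤ n.factorial * C / r ^ n := by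
  rw [iteratedDeriv_horizontal hS hf hy]
  exact Complex.norm_iteratedDeriv_le_of_forall_mem_sphere_norm_le n hr
    (hf.diffContOnCl_ball hball) fun z hz => hC z (Metric.sphere_subset_closedBall hz)

/-- Cauchy's estimate on discs of one fixed radius transfers the Gaussian decay to all derivatives.
-/
lemma exists_schwartzMap {f : ℂ → ℂ} {S : Set ℂ} (hS : IsOpen S) (hf : DifferentiableOn ℂ f S)
    {y r C δ : ℝ} {J : ℕ} (hr : 0 < r) (hδ : 0 < δ)
    (hball : ∀ x : ℝ, Metric.closedBall ((x : ℂ) + y * Complex.I) r ⊆ S)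
    (hC : ∀ x : ℝ, ∀ w ∈ Metric.closedBall ((x : ℂ) + y * Complex.I) r,
      ‖f w‖ ≤ C * ((1 + |x|) ^ J * Real.exp (-δ * x ^ 2))) :
    ∃ F : SchwartzMap ℝ ℂ, ∀ x : ℝ, F x = f (x + y * Complex.I) := by
  have hy : ∀ x : ℝ, (x : ℂ) + y * Complex.I ∈ S := fun x =>
    hball x (Metric.mem_closedBall_self hr.le)
  refine ⟨⟨fun x => f (x + y * Complex.I), contDiff_horizontal hS hf hy, fun k n => ?_⟩,
    fun x => rfl⟩
  obtain ⟨M, hM, hM'⟩ := exists_pow_mul_exp_neg_sq_le hδ (k + J)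
  refine ⟨|C| * n.factorial / r ^ n * M, fun x => ?_⟩
  rw [norm_iteratedFDeriv_eq_norm_iteratedDeriv, Real.norm_eq_abs]
  have h1 := norm_iteratedDeriv_horizontal_le hS hf hy hr (hball x) (hC x) n
  calc |x| ^ k * _ ≤ (1 + |x|) ^ k *
        (n.factorial * (|C| * ((1 + |x|) ^ J * Real.exp (-δ * x ^ 2))) / r ^ n) := by
        gcongr
        · linarith
        · refine h1.trans ?_
          gcongr
          exact le_abs_self C
    _ = |C| * n.factorial / r ^ n * ((1 + |x|) ^ (k + J) * Real.exp (-δ * x ^ 2)) := by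
        rw [pow_add]; ring
    _ ≤ _ := by
        gcongr
        exact hM' x

open FourierTransform in
/-- Plancherel's formula for derivatives of Schwartz functions. -/
lemma lintegral_fourier_sq_le (F : SchwartzMap ℝ ℂ) (N : ℕ) :
    ∫⁻ ξ : ℝ, ENNReal.ofReal ((2 * Real.pi * |ξ|) ^ (2 * N) * ‖𝓕 (F : ℝ → ℂ) ξ‖ ^ 2) =
      ENNReal.ofReal (∫ x : ℝ, ‖iteratedDeriv N F x‖ ^ 2) := by
  obtain ⟨G, hG⟩ : ∃ G : SchwartzMap ℝ ℂ, (G : ℝ → ℂ) = iteratedDeriv N F := by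
    induction N with
    | zero => exact ⟨F, by simp⟩
    | succ n ih =>
      obtain ⟨G, hG⟩ := ih
      exact ⟨SchwartzMap.derivCLM ℂ ℂ G, by
        rw [iteratedDeriv_succ, ← hG]; ext x; simp⟩
  have hint : ∀ n : ℕ, Integrable (iteratedDeriv n F) := by
    intro n
    obtain ⟨H, hH⟩ : ∃ H : SchwartzMap ℝ ℂ, (H : ℝ → ℂ) = iteratedDeriv n F := by
      induction n with
      | zero => exact ⟨F, by simp⟩
      | succ n ih =>
        obtain ⟨G, hG⟩ := ih
        exact ⟨SchwartzMap.derivCLM ℂ ℂ G, by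
          rw [iteratedDeriv_succ, ← hG]; ext x; simp⟩
    rw [← hH]
    exact H.integrable
  have h1 := Real.fourier_iteratedDeriv (N := ⊤) (n := N) (F.smooth ⊤) (fun n _ => hint n) le_top
  rw [← hG] at h1 ⊢
  rw [← SchwartzMap.integral_norm_sq_fourier G,
    ofReal_integral_eq_lintegral_ofReal _ (Filter.Eventually.of_forall fun x => by positivity)]
  · refine lintegral_congr fun ξ => ?_
    rw [SchwartzMap.fourier_coe, h1]
    congr 1
    have e : ‖2 * (Real.pi : ℂ) * Complex.I * ξ‖ = 2 * Real.pi * |ξ| := by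
      simp [abs_of_pos Real.pi_pos]
    rw [norm_smul, norm_pow, e]
    ring
  · exact ((𝓕 G).memLp 2).integrable_norm_pow (by norm_num)

end JacobiAnalysis

/-! ### Symbol and `L²` estimates on the line `Im λ = h` -/

namespace JacobiAnalysis

/-- In a disc of radius `(1+|x|)/4` the real part still dominates the imaginary part for large
`|x|`. So the disc stays in the sector, and `Re w²` stays comparable to `x²` from below, which
preserves the Gaussian decay. -/
lemma mem_disc_bounds {h : ℝ} (hh : 0 < h) {x : ℝ} {w : ℂ}
    (hw : w ∈ Metric.closedBall ((x : ℂ) + h * Complex.I) ((1 + |x|) / 4)) :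
    w ∈ sector ∧ 1 + ‖w‖ ≤ (3 + h) * (1 + |x|) ∧ x ^ 2 / 4 - 2 * (h + 2) ^ 2 ≤ (w ^ 2).re := by
  rw [Metric.mem_closedBall, Complex.dist_eq] at hw
  have h1 := (Complex.abs_re_le_norm _).trans hw
  have h2 := (Complex.abs_im_le_norm _).trans hw
  simp only [Complex.sub_re, Complex.sub_im, Complex.add_re, Complex.add_im, Complex.ofReal_re,
    Complex.ofReal_im, Complex.mul_re, Complex.mul_im, Complex.I_re, Complex.I_im, mul_zero,
    mul_one, sub_zero, add_zero, zero_add] at h1 h2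
  have h3 : |w.im| ≤ h + (1 + |x|) / 4 := by
    have := abs_add_le (w.im - h) h
    rw [sub_add_cancel, abs_of_pos hh] at this
    linarith
  have h4 : |x| - (1 + |x|) / 4 ≤ |w.re| := by
    have := abs_sub_abs_le_abs_sub x w.re
    rw [abs_sub_comm] at this
    linarith
  have hx := abs_nonneg x
  refine ⟨?_, ?_, ?_⟩
  · change -w.im < 1 / 2 + |w.re|
    have := (abs_le.1 h2).1
    linarith
  · have e : ‖w‖ ≤ ‖(x : ℂ) + h * Complex.I‖ + (1 + |x|) / 4 := by
      have := norm_add_le ((x : ℂ) + h * Complex.I) (w - (x + h * Complex.I))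
      rw [add_sub_cancel] at this
      linarith
    have e2 : ‖(x : ℂ) + h * Complex.I‖ ≤ |x| + h := by
      refine (norm_add_le _ _).trans ?_
      simp [abs_of_pos hh]
    nlinarith
  · have e : (w ^ 2).re = |w.re| ^ 2 - |w.im| ^ 2 := by
      rw [sq_abs, sq_abs, sq, Complex.mul_re]; ring
    have e1 : |w.im| ^ 2 ≤ (h + (1 + |x|) / 4) ^ 2 := by gcongr
    have e2 : (|x| - (1 + |x|) / 4) ^ 2 - 1 / 16 ≤ |w.re| ^ 2 := by
      rcases le_total 0 (|x| - (1 + |x|) / 4) with hp | hp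
      · have : (|x| - (1 + |x|) / 4) ^ 2 ≤ |w.re| ^ 2 := by gcongr
        linarith
      · nlinarith [sq_nonneg w.re, sq_nonneg |w.re|]
    rw [e, ← sq_abs x]
    nlinarith [sq_nonneg (|x| - (1 + h))]

/-- The `k`-th amplitude `Γ_k(λ) / c(-λ)`, regularized by a Gaussian factor. -/
noncomputable def amplitude (α β : ℝ) (k : ℕ) (η : ℝ) (l : ℂ) : ℂ :=
  invC α β l * hcCoeff α β l k * Complex.exp (-η * l ^ 2)

lemma differentiableOn_amplitude {α β : ℝ} (hρ : 1 ≤ rho α β) (hβ : β ≤ α) (k : ℕ) (η : ℝ) :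
    DifferentiableOn ℂ (amplitude α β k η) sector :=
  ((differentiableOn_invC hρ hβ).mul (differentiableOn_hcCoeff α β k)).mul (by fun_prop)

/-- The constants do not depend on `η`: as `η ≤ 1`, the loss `-2(h+2)²` in the lower bound for `Re
w²` costs at most `exp(2(h+2)²)`. The dependence on `k` is only through `growth`. -/
lemma exists_norm_amplitude_le {α β : ℝ} (hα : -1 / 2 ≤ α) (hρ : 1 ≤ rho α β) (hβ : β ≤ α) {h : ℝ}
    (hh : 0 < h) : ∃ C > 0, ∃ D, 0 ≤ D ∧ ∀ (k : ℕ), ∀ η ∈ Ioc (0 : ℝ) 1, ∀ x : ℝ,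
      ∀ w ∈ Metric.closedBall ((x : ℂ) + h * Complex.I) ((1 + |x|) / 4), ‖amplitude α β k η w‖ ≤
        C * growth D k * ((1 + |x|) ^ (α + 1 / 2) * Real.exp (-(η / 4) * x ^ 2)) := by
  obtain ⟨C, hC, HC⟩ := exists_norm_invC_le hρ hβ
  obtain ⟨D, hD, HD⟩ := exists_norm_hcCoeff_le α β
  refine ⟨C * (3 + h) ^ (α + 1 / 2) * Real.exp (2 * (h + 2) ^ 2), by positivity, D, hD,
    fun k η hη x w hw => ?_⟩
  obtain ⟨h1, h2, h3⟩ := mem_disc_bounds hh hw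
  have hg := growth_pos hD k
  have hexp : ‖Complex.exp (-η * w ^ 2)‖ ≤
      Real.exp (2 * (h + 2) ^ 2) * Real.exp (-(η / 4) * x ^ 2) := by
    rw [Complex.norm_exp, ← Real.exp_add, Real.exp_le_exp, ← Complex.ofReal_neg,
      Complex.re_ofReal_mul]
    have := mul_le_mul_of_nonneg_left h3 hη.1.le
    nlinarith [mul_le_mul_of_nonneg_right hη.2 (by positivity : 0 ≤ 2 * (h + 2) ^ 2)]
  have hinv : ‖invC α β w‖ ≤ C * ((3 + h) ^ (α + 1 / 2) * (1 + |x|) ^ (α + 1 / 2)) := by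
    refine (HC w h1).trans ?_
    rw [← Real.mul_rpow (by positivity) (by positivity)]
    gcongr
    linarith
  rw [amplitude, norm_mul, norm_mul]
  calc _ ≤ C * ((3 + h) ^ (α + 1 / 2) * (1 + |x|) ^ (α + 1 / 2)) * growth D k *
        (Real.exp (2 * (h + 2) ^ 2) * Real.exp (-(η / 4) * x ^ 2)) := by
        gcongr
        exact HD w h1 k
    _ = _ := by ring

lemma line_mem_sector {h : ℝ} (hh : 0 < h) (x : ℝ) : (x : ℂ) + h * Complex.I ∈ sector :=
  (mem_disc_bounds hh (Metric.mem_closedBall_self (by positivity))).1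

lemma line_mem_strip {α β h : ℝ} (hh : 0 < h) (hρ : h < rho α β) (x : ℝ) :
    (x : ℂ) + h * Complex.I ∈ strip α β := by
  simp [strip, abs_of_pos hh, hρ]

lemma isOpen_strip (α β : ℝ) : IsOpen (strip α β) :=
  isOpen_lt (by fun_prop) (by fun_prop)

lemma le_derivOrder (α : ℝ) : α + 3 / 2 ≤ derivOrder α := Nat.le_ceil _

/-- The symbol estimate for the regularized multiplier on the line `Im λ = h`. -/
lemma exists_norm_iteratedDeriv_mul_amplitude_le {α β : ℝ} (hα : -1 / 2 ≤ α) (hρ : 1 ≤ rho α β)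
    (hβ : β ≤ α) {h : ℝ} (hh : 0 < h) (hhρ : h < rho α β) (c : ℕ → ℝ → ℝ) :
    ∃ A ≥ 0, ∃ D, 0 ≤ D ∧ ∀ m, IsHormanderMultiplier α β c m → ∀ (k : ℕ), ∀ η ∈ Ioc (0 : ℝ) 1,
      ∀ x : ℝ, ‖iteratedDeriv (derivOrder α) (fun s : ℝ => m (s + h * Complex.I) *
        amplitude α β k η (s + h * Complex.I)) x‖ ≤ A * growth D k * (1 + |x|)⁻¹ := by
  obtain ⟨C, hC, D, hD, H⟩ := exists_norm_amplitude_le hα hρ hβ hh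
  set N := derivOrder α with hN
  refine ⟨∑ i ∈ Finset.range (N + 1), (N.choose i : ℝ) * |c i h| *
    ((N - i).factorial * 4 ^ (N - i) * C), Finset.sum_nonneg fun i _ => by positivity, D, hD,
    fun m hm k η hη x => ?_⟩
  have hg := growth_pos hD k
  have hM := contDiff_horizontal (isOpen_strip α β) hm.holomorphic (line_mem_strip hh hhρ)
  have hA := contDiff_horizontal isOpen_sector (differentiableOn_amplitude hρ hβ k η)
    (line_mem_sector hh)
  have hx : 0 < 1 + |x| := by positivity
  have htop : ((N : ℕ) : WithTop ℕ∞) ≤ ((⊤ : ℕ∞) : WithTop ℕ∞) := by exact_mod_cast le_top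
  rw [iteratedDeriv_fun_mul (hM.contDiffAt.of_le htop) (hA.contDiffAt.of_le htop), Finset.sum_mul,
    Finset.sum_mul]
  refine (norm_sum_le _ _).trans (Finset.sum_le_sum fun i hi => ?_)
  have hi' : i ≤ N := by simpa [Nat.lt_succ_iff] using hi
  have h1 := hm.deriv_le i hi' x h (by rwa [abs_of_pos hh])
  -- Cauchy's estimate at radius `(1+|x|)/4` gains `4/(1+|x|)` per derivative, whence the powers of
  -- `4` in the constant. The disc may leave the strip, but `m` is not involved: its derivatives are
  -- bounded by hypothesis.
  have h2 := norm_iteratedDeriv_horizontal_le isOpen_sector (differentiableOn_amplitude hρ hβ k η)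
    (line_mem_sector hh) (x := x) (r := (1 + |x|) / 4) (by positivity)
    (fun w hw => (mem_disc_bounds hh hw).1) (H k η hη x) (N - i)
  have hexp : Real.exp (-(η / 4) * x ^ 2) ≤ 1 := by
    rw [Real.exp_le_one_iff]
    have := mul_nonneg hη.1.le (sq_nonneg x)
    nlinarith
  -- This is where `N ≥ α + 3/2` is needed.
  have hpow : (1 + |x|) ^ (α + 1 / 2) ≤ (1 + |x|) ^ N * (1 + |x|)⁻¹ := by
    rw [← Real.rpow_natCast, ← Real.rpow_neg_one, ← Real.rpow_add hx]
    refine Real.rpow_le_rpow_of_exponent_le (by linarith [abs_nonneg x]) ?_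
    have := le_derivOrder α
    linarith
  rw [norm_mul, norm_mul, Complex.norm_natCast]
  calc _ ≤ (N.choose i : ℝ) * (|c i h| * ((1 + |x|) ^ i)⁻¹) *
        ((N - i).factorial * (C * growth D k * ((1 + |x|) ^ N * (1 + |x|)⁻¹ * 1)) /
          ((1 + |x|) / 4) ^ (N - i)) := by
        gcongr
        · refine h1.trans ?_
          gcongr
          exact le_abs_self _
        · refine h2.trans ?_
          gcongr
    _ = _ := by
        rw [div_pow, show (1 + |x|) ^ N = (1 + |x|) ^ i * (1 + |x|) ^ (N - i) by
          rw [← pow_add]; congr 1; omega]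
        field_simp

/-- The `L²` estimate for the Fourier transform of the regularized multiplier. -/
lemma exists_lintegral_fourier_amplitude_le {α β : ℝ} (hα : -1 / 2 ≤ α) (hρ : 1 ≤ rho α β)
    (hβ : β ≤ α) {h : ℝ} (hh : 0 < h) (hhρ : h < rho α β) (c : ℕ → ℝ → ℝ) :
    ∃ B ≥ 0, ∃ D, 0 ≤ D ∧ ∀ m, IsHormanderMultiplier α β c m → ∀ (k : ℕ), ∀ η ∈ Ioc (0 : ℝ) 1,
      Continuous (fun t : ℝ => ∫ x : ℝ, m (x + h * Complex.I) *
        amplitude α β k η (x + h * Complex.I) * Complex.exp (Complex.I * x * t)) ∧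
      ∫⁻ t in Ioi (1 : ℝ), ENNReal.ofReal (‖∫ x : ℝ, m (x + h * Complex.I) *
        amplitude α β k η (x + h * Complex.I) * Complex.exp (Complex.I * x * t)‖ ^ 2) ≤
          ENNReal.ofReal (B * growth D k ^ 2) := by
  obtain ⟨A, hA, D, hD, H⟩ :=
    exists_norm_iteratedDeriv_mul_amplitude_le hα hρ hβ hh hhρ c
  obtain ⟨C', hC', D', hD', H'⟩ := exists_norm_amplitude_le hα hρ hβ hh
  -- The factor `2π` comes from rescaling the Fourier variable, the other `π` from `∫ (1+x²)⁻¹`.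
  refine ⟨2 * Real.pi * (A ^ 2 * Real.pi), by positivity, D, hD, fun m hm k η hη => ?_⟩
  set N := derivOrder α with hN
  set r := min (1 / 4) ((rho α β - h) / 2) with hr
  -- Here the function contains `m`, so the radius must keep the discs inside the strip. The
  -- resulting bound only shows that the function is Schwartz and does not enter the constants.
  have hr0 : 0 < r := lt_min (by norm_num) (by linarith)
  obtain ⟨M, hM⟩ := hm.bounded ((rho α β + h) / 2) (by linarith)
  have hball : ∀ x : ℝ, ∀ w ∈ Metric.closedBall ((x : ℂ) + h * Complex.I) r,
      w ∈ Metric.closedBall ((x : ℂ) + h * Complex.I) ((1 + |x|) / 4) ∧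
        |w.im| ≤ (rho α β + h) / 2 := by
    intro x w hw
    refine ⟨Metric.closedBall_subset_closedBall ?_ hw, ?_⟩
    · have := min_le_left (1 / 4) ((rho α β - h) / 2)
      linarith [abs_nonneg x]
    · rw [Metric.mem_closedBall, Complex.dist_eq] at hw
      have h2 := (Complex.abs_im_le_norm _).trans hw
      simp only [Complex.sub_im, Complex.add_im, Complex.ofReal_im, Complex.mul_im,
        Complex.ofReal_re, Complex.I_re, Complex.I_im, mul_zero, mul_one, add_zero,
        zero_add] at h2
      have := abs_add_le (w.im - h) h
      rw [sub_add_cancel, abs_of_pos hh] at this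
      linarith [min_le_right (1 / 4) ((rho α β - h) / 2)]
  obtain ⟨F, hF⟩ := exists_schwartzMap (S := sector ∩ strip α β) (y := h) (r := r)
    (C := |M| * (C' * growth D' k)) (δ := η / 4) (J := ⌈α + 1 / 2⌉₊)
    (f := fun l => m l * amplitude α β k η l)
    (isOpen_sector.inter (isOpen_strip α β))
    ((hm.holomorphic.mono inter_subset_right).mul
      ((differentiableOn_amplitude hρ hβ k η).mono inter_subset_left)) hr0
    (by have := hη.1; positivity)
    (fun x w hw => ⟨(mem_disc_bounds hh (hball x w hw).1).1, lt_of_le_of_lt (hball x w hw).2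
      (by linarith)⟩)
    (fun x w hw => by
      have hg := growth_pos hD' k
      rw [norm_mul, mul_assoc]
      refine mul_le_mul ((hM w (hball x w hw).2).trans (le_abs_self M)) ?_ (norm_nonneg _)
        (abs_nonneg _)
      refine (H' k η hη x w (hball x w hw).1).trans ?_
      gcongr
      rw [← Real.rpow_natCast]
      exact Real.rpow_le_rpow_of_exponent_le (by linarith [abs_nonneg x]) (Nat.le_ceil _))
  have hFeq : (fun s : ℝ => m (s + h * Complex.I) * amplitude α β k η (s + h * Complex.I)) = F :=
    funext fun x => (hF x).symm
  have hfour : ∀ t : ℝ, ∫ x : ℝ, m (x + h * Complex.I) *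
      amplitude α β k η (x + h * Complex.I) * Complex.exp (Complex.I * x * t) =
      FourierTransform.fourier (F : ℝ → ℂ) (-(2 * Real.pi)⁻¹ * t) := by
    intro t
    rw [Real.fourier_eq']
    refine integral_congr_ae (Filter.Eventually.of_forall fun x => ?_)
    simp only [hF, smul_eq_mul]
    rw [mul_comm]
    congr 2
    simp only [RCLike.inner_apply, conj_trivial]
    push_cast
    field_simp
  have hcont : Continuous (FourierTransform.fourier (F : ℝ → ℂ)) :=
    (FourierTransform.fourier F).continuous
  simp_rw [hfour]
  refine ⟨hcont.comp (by fun_prop), ?_⟩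
  have hP := lintegral_fourier_sq_le F N
  have hint : ∫ x : ℝ, ‖iteratedDeriv N F x‖ ^ 2 ≤ A ^ 2 * growth D k ^ 2 * Real.pi := by
    rw [← integral_univ_inv_one_add_sq, ← integral_const_mul]
    refine integral_mono_of_nonneg (Filter.Eventually.of_forall fun x => by positivity)
      (integrable_inv_one_add_sq.const_mul _) (Filter.Eventually.of_forall fun x => ?_)
    have hb := H m hm k η hη x
    rw [hFeq] at hb
    calc ‖iteratedDeriv N F x‖ ^ 2 ≤ (A * growth D k * (1 + |x|)⁻¹) ^ 2 := by gcongr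
      _ = A ^ 2 * growth D k ^ 2 * ((1 + |x|) ^ 2)⁻¹ := by rw [mul_pow, mul_pow, inv_pow]
      _ ≤ A ^ 2 * growth D k ^ 2 * (1 + x ^ 2)⁻¹ := by
        gcongr
        rw [← sq_abs x]
        nlinarith [abs_nonneg x]
  set Q : ℝ → ENNReal := fun ξ => ENNReal.ofReal ((2 * Real.pi * |ξ|) ^ (2 * N) *
    ‖FourierTransform.fourier (F : ℝ → ℂ) ξ‖ ^ 2) with hQ
  have hQm : Measurable Q := by
    refine ENNReal.measurable_ofReal.comp (Continuous.measurable ?_)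
    fun_prop
  have hpi := Real.pi_pos
  -- At `ξ = -t/(2π)` the Plancherel weight `(2π|ξ|)^{2N}` is `t^{2N}`, which is at least `1` for `t
  -- > 1` and can be inserted for free.
  calc _ ≤ ∫⁻ t in Ioi (1 : ℝ), Q (-(2 * Real.pi)⁻¹ * t) := by
        refine setLIntegral_mono (by fun_prop) fun t ht => ENNReal.ofReal_le_ofReal ?_
        have ht1 : 1 < t := ht
        have : 2 * Real.pi * |-(2 * Real.pi)⁻¹ * t| = t := by
          rw [abs_mul, abs_neg, abs_of_pos (by positivity), abs_of_pos (by linarith)]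
          field_simp
        rw [this]
        exact le_mul_of_one_le_left (by positivity) (one_le_pow₀ ht1.le)
    _ ≤ ∫⁻ t, Q (-(2 * Real.pi)⁻¹ * t) := setLIntegral_le_lintegral _ _
    _ = ENNReal.ofReal (2 * Real.pi) * ∫⁻ ξ, Q ξ := by
        rw [← lintegral_map hQm (measurable_const_mul _),
          Real.map_volume_mul_left (by simp [hpi.ne']), lintegral_smul_measure, smul_eq_mul]
        congr 2
        rw [inv_neg, inv_inv, abs_neg, abs_of_pos (by positivity)]
    _ ≤ ENNReal.ofReal (2 * Real.pi) * ENNReal.ofReal (A ^ 2 * growth D k ^ 2 * Real.pi) := by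
        rw [hP]
        gcongr
    _ = _ := by
        rw [← ENNReal.ofReal_mul (by positivity)]
        congr 1
        ring

end JacobiAnalysis

/-! ### Contour shift and unfolding of the inversion integral -/

namespace JacobiAnalysis

open Filter Topology

/-- Shifting the line of integration of a holomorphic function which is `O((1 + x²)⁻¹)` on a
horizontal strip. -/
lemma integral_horizontal_shift {f : ℂ → ℂ} {h C : ℝ} (hh : 0 ≤ h)
    (hf : ∀ x y : ℝ, y ∈ Icc 0 h → DifferentiableAt ℂ f (x + y * Complex.I))
    (hb : ∀ x y : ℝ, y ∈ Icc 0 h → ‖f (x + y * Complex.I)‖ ≤ C * (1 + x ^ 2)⁻¹) :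
    Integrable (fun x : ℝ => f x) ∧ ∫ x : ℝ, f x = ∫ x : ℝ, f (x + h * Complex.I) := by
  have hint : ∀ y ∈ Icc 0 h, Integrable (fun x : ℝ => f (x + y * Complex.I)) := by
    intro y hy
    refine (integrable_inv_one_add_sq.const_mul C).mono' (Continuous.aestronglyMeasurable ?_)
      (Eventually.of_forall fun x => hb x y hy)
    refine continuous_iff_continuousAt.2 fun x => ?_
    exact ContinuousAt.comp (f := fun x : ℝ => (x : ℂ) + y * Complex.I)
      (hf x y hy).continuousAt (by fun_prop)
  have h0 := hint 0 (left_mem_Icc.2 hh)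
  simp only [Complex.ofReal_zero, zero_mul, add_zero] at h0
  have h1 := hint h (right_mem_Icc.2 hh)
  refine ⟨h0, ?_⟩
  have hside : ∀ T : ℝ, ‖Complex.I • ∫ y : ℝ in (0 : ℝ)..h, f (T + y * Complex.I)‖ ≤
      C * (1 + T ^ 2)⁻¹ * h := by
    intro T
    rw [norm_smul, Complex.norm_I, one_mul]
    have := intervalIntegral.norm_integral_le_of_norm_le_const (a := 0) (b := h)
      (f := fun y : ℝ => f (T + y * Complex.I)) (C := C * (1 + T ^ 2)⁻¹) fun y hy => by
        rw [uIoc_of_le hh] at hy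
        exact hb T y (Ioc_subset_Icc_self hy)
    rwa [sub_zero, abs_of_nonneg hh] at this
  have hdecay : Tendsto (fun T : ℝ => C * (1 + T ^ 2)⁻¹ * h) atTop (𝓝 0) := by
    have : Tendsto (fun T : ℝ => (1 + T ^ 2)⁻¹) atTop (𝓝 0) :=
      (tendsto_atTop_add_const_left _ 1 (tendsto_pow_atTop two_ne_zero)).inv_tendsto_atTop
    simpa using (this.const_mul C).mul_const h
  have hR : Tendsto (fun T : ℝ => Complex.I • ∫ y : ℝ in (0 : ℝ)..h, f (T + y * Complex.I)) atTop
      (𝓝 0) := squeeze_zero_norm hside hdecay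
  have hL : Tendsto (fun T : ℝ => Complex.I • ∫ y : ℝ in (0 : ℝ)..h,
      f (((-T : ℝ) : ℂ) + y * Complex.I)) atTop (𝓝 0) :=
    squeeze_zero_norm (fun T => by simpa using hside (-T)) hdecay
  have e : ∀ T : ℝ, (∫ x : ℝ in -T..T, f x) - (∫ x : ℝ in -T..T, f (x + h * Complex.I)) +
      (Complex.I • ∫ y : ℝ in (0 : ℝ)..h, f (T + y * Complex.I)) -
      (Complex.I • ∫ y : ℝ in (0 : ℝ)..h, f (((-T : ℝ) : ℂ) + y * Complex.I)) = 0 := by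
    intro T
    have := Complex.integral_boundary_rect_eq_zero_of_differentiableOn f ((-T : ℝ) : ℂ)
      (T + h * Complex.I) (fun z hz => by
        have hz2 := hz.2
        simp only [mem_preimage, Complex.ofReal_im, Complex.add_im, Complex.mul_im,
          Complex.ofReal_re, Complex.I_re, Complex.I_im, mul_zero, mul_one, add_zero, zero_add,
          uIcc_of_le hh] at hz2
        have := hf z.re z.im hz2
        rw [Complex.re_add_im] at this
        exact this.differentiableWithinAt)
    simpa using this
  have t0 := intervalIntegral_tendsto_integral h0 tendsto_neg_atTop_atBot tendsto_id
  have t1 := intervalIntegral_tendsto_integral h1 tendsto_neg_atTop_atBot tendsto_id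
  have := ((t0.sub t1).add hR).sub hL
  simp only [id, e, add_zero, sub_zero] at this
  exact sub_eq_zero.1 (tendsto_nhds_unique this tendsto_const_nhds)

/-- In the upper half plane `|e^{iλt}| ≤ 1`, and the series is bounded uniformly in `λ` by the
`growth` series. -/
lemma exists_norm_jacobiSecond_le (α β : ℝ) {t : ℝ} (ht : 0 < t) : ∃ S : ℝ, 0 ≤ S ∧
    ∀ l ∈ sector, 0 ≤ l.im → ‖jacobiSecond α β l t‖ ≤ S := by
  obtain ⟨D, hD, H⟩ := exists_norm_hcCoeff_le α β
  have hr := norm_exp_lt_one ht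
  have hs := summable_growth hD (norm_nonneg _) hr
  refine ⟨Real.exp (-rho α β * t) * ∑' k, growth D k * ‖((Real.exp (-2 * t) : ℝ) : ℂ)‖ ^ k,
    mul_nonneg (Real.exp_pos _).le (tsum_nonneg fun k => ?_), fun l hl hl0 => ?_⟩
  · have := growth_pos hD k
    positivity
  · rw [jacobiSecond, norm_mul, Complex.norm_exp]
    refine mul_le_mul ?_ ?_ (norm_nonneg _) (Real.exp_pos _).le
    · rw [Real.exp_le_exp]
      simp only [Complex.mul_re, Complex.sub_re, Complex.I_re, Complex.I_im, Complex.ofReal_re,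
        Complex.ofReal_im, mul_zero, sub_zero, zero_mul, one_mul, zero_sub]
      nlinarith
    · refine tsum_of_norm_bounded hs.hasSum fun k => ?_
      rw [norm_mul, norm_pow]
      gcongr
      exact H l hl k

lemma differentiableOn_jacobiSecond (α β : ℝ) {t : ℝ} (ht : 0 < t) :
    DifferentiableOn ℂ (fun l => jacobiSecond α β l t) sector := by
  obtain ⟨D, hD, H⟩ := exists_norm_hcCoeff_le α β
  have hs := summable_growth hD (norm_nonneg _) (norm_exp_lt_one ht)
  simp only [jacobiSecond, pseries]
  refine DifferentiableOn.mul (by fun_prop) ?_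
  refine Complex.differentiableOn_tsum_of_summable_norm hs
    (fun k => (differentiableOn_hcCoeff α β k).mul_const _) isOpen_sector fun k l hl => ?_
  rw [norm_mul, norm_pow]
  gcongr
  exact H l hl k

lemma mem_sector_of_nonneg_im {l : ℂ} (hl : 0 ≤ l.im) : l ∈ sector := by
  change -l.im < 1 / 2 + |l.re|
  linarith [abs_nonneg l.re]

lemma cFunction_ne_zero {α β : ℝ} (hρ : 0 < rho α β) (hβ : β < α + 1) {x : ℝ} (hx : x ≠ 0) :
    cFunction α β x ≠ 0 := by
  have hre : ∀ r : ℝ, ((r : ℂ) + Complex.I * x).re = r := fun r => by simp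
  rw [cFunction]
  refine div_ne_zero (mul_ne_zero (mul_ne_zero ?_ ?_) ?_) (mul_ne_zero ?_ ?_)
  · simp [Complex.cpow_eq_zero_iff]
  · refine Complex.Gamma_ne_zero fun n hn => hx ?_
    have := congrArg Complex.im hn
    simpa using this
  · refine Complex.Gamma_ne_zero_of_re_pos ?_
    simp
  · refine Complex.Gamma_ne_zero_of_re_pos ?_
    simpa using hρ
  · refine Complex.Gamma_ne_zero_of_re_pos ?_
    have : 0 < rho α β / 2 - β := by rw [rho]; linarith
    simpa using this

/-- The integrand on the real line obtained by unfolding the inversion integral. -/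
noncomputable def unfolded (α β : ℝ) (m : ℂ → ℂ) (t : ℝ) (l : ℂ) : ℂ :=
  m l * invC α β l * jacobiSecond α β l t

/-- The two terms of the connection formula, divided by `c(λ) c(-λ)`, are reflections of each other
because `m` is even. Hence the half-line integral becomes an integral over `ℝ`. -/
lemma inversionIntegrand_eq {α β : ℝ} (hα : 0 < α) (hρ : 0 < rho α β) (hβ : β < α + 1)
    {m : ℂ → ℂ} (hm : ∀ x : ℝ, m (-x) = m x) {t : ℝ} (ht : 0 < t) {x : ℝ} (hx : x ≠ 0) :
    inversionIntegrand α β m t x =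
      connectionConst α * (unfolded α β m t x + unfolded α β m t ((-x : ℝ) : ℂ)) := by
  have h1 := cFunction_ne_zero hρ hβ hx
  have h2 := cFunction_ne_zero hρ hβ (neg_ne_zero.2 hx)
  rw [inversionIntegrand, jacobiFunction_eq_jacobiSecond hα hρ hβ hx ht, unfolded, unfolded, invC,
    invC]
  push_cast at h2 ⊢
  rw [hm, neg_neg]
  field_simp

lemma inversionIntegrand_integrableOn {α β : ℝ} (hα : 0 < α) (hρ : 0 < rho α β) (hβ : β < α + 1)
    {m : ℂ → ℂ} (hm : ∀ x : ℝ, m (-x) = m x) {t : ℝ} (ht : 0 < t)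
    (hi : Integrable fun x : ℝ => unfolded α β m t x) :
    IntegrableOn (inversionIntegrand α β m t) (Ioi 0) ∧
      kernel α β m t = connectionConst α * ∫ x : ℝ, unfolded α β m t x := by
  have hi' : Integrable fun x : ℝ => unfolded α β m t ((-x : ℝ) : ℂ) := hi.comp_neg
  have e : EqOn (inversionIntegrand α β m t) (fun x : ℝ => connectionConst α *
      (unfolded α β m t x + unfolded α β m t ((-x : ℝ) : ℂ))) (Ioi 0) := fun x hx =>
    inversionIntegrand_eq hα hρ hβ hm ht (ne_of_gt hx)
  refine ⟨((hi.add hi').const_mul _).integrableOn.congr_fun e.symm measurableSet_Ioi, ?_⟩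
  rw [kernel, setIntegral_congr_fun measurableSet_Ioi e, integral_const_mul,
    integral_add hi.integrableOn hi'.integrableOn,
    integral_comp_neg_Ioi 0 (fun x : ℝ => unfolded α β m t x), neg_zero, add_comm,
    intervalIntegral.integral_Iic_add_Ioi hi.integrableOn hi.integrableOn]

end JacobiAnalysis

/-! ### Gaussian regularization and expansion of the shifted integral -/

namespace JacobiAnalysis

open Filter Topology

lemma exists_norm_invC_mul_jacobiSecond_le {α β : ℝ} (hρ : 1 ≤ rho α β)
    (hβ : β ≤ α) {h t : ℝ} (hh : 0 ≤ h) (ht : 0 < t) : ∃ (C : ℝ) (J : ℕ), 0 ≤ C ∧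
      ∀ x : ℝ, ∀ y ∈ Icc 0 h, ‖invC α β (x + y * Complex.I) *
        jacobiSecond α β (x + y * Complex.I) t‖ ≤ C * (1 + |x|) ^ J := by
  obtain ⟨C, hC, HC⟩ := exists_norm_invC_le hρ hβ
  obtain ⟨S, hS, HS⟩ := exists_norm_jacobiSecond_le α β ht
  refine ⟨C * (1 + h) ^ ⌈α + 1 / 2⌉₊ * S, ⌈α + 1 / 2⌉₊, by positivity, fun x y hy => ?_⟩
  have him : 0 ≤ ((x : ℂ) + y * Complex.I).im := by simpa using hy.1
  have hl := mem_sector_of_nonneg_im him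
  have hn : 1 + ‖(x : ℂ) + y * Complex.I‖ ≤ (1 + h) * (1 + |x|) := by
    have : ‖(x : ℂ) + y * Complex.I‖ ≤ |x| + y := by
      refine (norm_add_le _ _).trans ?_
      simp [abs_of_nonneg hy.1]
    nlinarith [hy.2, abs_nonneg x]
  have h1 : ‖invC α β (x + y * Complex.I)‖ ≤
      C * ((1 + h) ^ ⌈α + 1 / 2⌉₊ * (1 + |x|) ^ ⌈α + 1 / 2⌉₊) := by
    refine (HC _ hl).trans ?_
    rw [← mul_pow]
    gcongr
    calc _ ≤ (1 + ‖(x : ℂ) + y * Complex.I‖) ^ ((⌈α + 1 / 2⌉₊ : ℕ) : ℝ) :=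
          Real.rpow_le_rpow_of_exponent_le (by linarith [norm_nonneg ((x : ℂ) + y * Complex.I)])
            (Nat.le_ceil _)
      _ = (1 + ‖(x : ℂ) + y * Complex.I‖) ^ ⌈α + 1 / 2⌉₊ := Real.rpow_natCast _ _
      _ ≤ _ := by gcongr
  rw [norm_mul]
  calc _ ≤ C * ((1 + h) ^ ⌈α + 1 / 2⌉₊ * (1 + |x|) ^ ⌈α + 1 / 2⌉₊) * S :=
        mul_le_mul h1 (HS _ hl him) (norm_nonneg _) (by positivity)
    _ = _ := by ring

lemma inv_one_add_abs_sq_le (x : ℝ) : ((1 + |x|) ^ 2)⁻¹ ≤ (1 + x ^ 2)⁻¹ := by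
  gcongr
  rw [← sq_abs x]
  nlinarith [abs_nonneg x]

/-- The multiplier `m`, regularized by a Gaussian factor. -/
noncomputable def regularized (m : ℂ → ℂ) (η : ℝ) (l : ℂ) : ℂ := m l * Complex.exp (-η * l ^ 2)

lemma norm_exp_neg_mul_sq (η x y : ℝ) : ‖Complex.exp (-η * ((x : ℂ) + y * Complex.I) ^ 2)‖ =
    Real.exp (-η * x ^ 2) * Real.exp (η * y ^ 2) := by
  rw [GaussianFourier.norm_cexp_neg_mul_sq_add_mul_I, ← Real.exp_add]
  simp
  ring

lemma exists_norm_unfolded_regularized_le {α β : ℝ} (hρ : 1 ≤ rho α β)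
    (hβ : β ≤ α) {h t η M : ℝ} (hh : 0 ≤ h) (ht : 0 < t) (hη : 0 < η) {m : ℂ → ℂ}
    (hM : ∀ l : ℂ, |l.im| ≤ h → ‖m l‖ ≤ M) :
    ∃ C : ℝ, ∀ x y : ℝ, y ∈ Icc 0 h →
      ‖unfolded α β (regularized m η) t (x + y * Complex.I)‖ ≤ C * (1 + x ^ 2)⁻¹ := by
  obtain ⟨C, J, hC, HC⟩ := exists_norm_invC_mul_jacobiSecond_le hρ hβ hh ht
  -- The two extra powers leave the decay `(1+|x|)^{-2}` required by the contour shift.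
  obtain ⟨E, hE, HE⟩ := exists_pow_mul_exp_neg_sq_le hη (J + 2)
  have hM0 : 0 ≤ M := (norm_nonneg _).trans (hM 0 (by simpa using hh))
  refine ⟨M * Real.exp (η * h ^ 2) * C * E, fun x y hy => ?_⟩
  have hx : 0 < 1 + |x| := by positivity
  have h1 : ‖regularized m η (x + y * Complex.I)‖ ≤
      M * (Real.exp (-η * x ^ 2) * Real.exp (η * h ^ 2)) := by
    rw [regularized, norm_mul, norm_exp_neg_mul_sq]
    have hy0 := hy.1
    gcongr
    · exact hM _ (by simpa [abs_of_nonneg hy0] using hy.2)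
    · exact hy.2
  have h2 : (1 + |x|) ^ J * Real.exp (-η * x ^ 2) ≤ E * (1 + x ^ 2)⁻¹ := by
    calc _ = (1 + |x|) ^ (J + 2) * Real.exp (-η * x ^ 2) * ((1 + |x|) ^ 2)⁻¹ := by
          rw [pow_add]; field_simp
      _ ≤ E * (1 + x ^ 2)⁻¹ := mul_le_mul (HE x) (inv_one_add_abs_sq_le x) (by positivity) hE.le
  rw [unfolded, mul_assoc, norm_mul]
  calc _ ≤ M * (Real.exp (-η * x ^ 2) * Real.exp (η * h ^ 2)) * (C * (1 + |x|) ^ J) :=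
        mul_le_mul h1 (HC x y hy) (norm_nonneg _) (by positivity)
    _ = M * Real.exp (η * h ^ 2) * C * ((1 + |x|) ^ J * Real.exp (-η * x ^ 2)) := by ring
    _ ≤ M * Real.exp (η * h ^ 2) * C * (E * (1 + x ^ 2)⁻¹) := by gcongr
    _ = _ := by ring

lemma IsHormanderMultiplier.even_real {α β : ℝ} (hρ : 0 < rho α β) {c : ℕ → ℝ → ℝ} {m : ℂ → ℂ}
    (hm : IsHormanderMultiplier α β c m) (x : ℝ) : m (-x) = m x :=
  hm.even x (by simpa [strip] using hρ)

lemma differentiableOn_regularized {α β : ℝ} {c : ℕ → ℝ → ℝ} {m : ℂ → ℂ}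
    (hm : IsHormanderMultiplier α β c m) (η : ℝ) :
    DifferentiableOn ℂ (regularized m η) (strip α β) :=
  hm.holomorphic.mul (by fun_prop)

/-- No pole is crossed: for `0 ≤ Im λ ≤ h < ρ` the point lies in the strip, where `m` is
holomorphic, and in the sector, where `1/c(-λ)` and `Φ_λ` are. -/
lemma kernel_regularized_eq {α β : ℝ} (hα : 0 < α) (hρ : 1 ≤ rho α β) (hβ : β ≤ α)
    {c : ℕ → ℝ → ℝ} {m : ℂ → ℂ} (hm : IsHormanderMultiplier α β c m) {h t η : ℝ} (hh : 0 ≤ h)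
    (hhρ : h < rho α β) (ht : 0 < t) (hη : 0 < η) :
    kernel α β (regularized m η) t = connectionConst α *
      ∫ x : ℝ, unfolded α β (regularized m η) t (x + h * Complex.I) := by
  obtain ⟨M, hM⟩ := hm.bounded h hhρ
  obtain ⟨C, hC⟩ := exists_norm_unfolded_regularized_le hρ hβ hh ht hη hM
  have hs := integral_horizontal_shift hh (fun x y hy => by
    have him : 0 ≤ ((x : ℂ) + y * Complex.I).im := by simpa using hy.1
    have hl := mem_sector_of_nonneg_im him
    have hst : (x : ℂ) + y * Complex.I ∈ strip α β := by
      simpa [strip, abs_of_nonneg hy.1] using lt_of_le_of_lt hy.2 hhρ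
    exact (((differentiableOn_regularized hm η).differentiableAt
      ((isOpen_strip α β).mem_nhds hst)).mul ((differentiableOn_invC hρ hβ).differentiableAt
        (isOpen_sector.mem_nhds hl))).mul ((differentiableOn_jacobiSecond α β ht).differentiableAt
          (isOpen_sector.mem_nhds hl))) hC
  have hev : ∀ x : ℝ, regularized m η (-x) = regularized m η x := fun x => by
    rw [regularized, regularized, hm.even_real (by linarith), neg_sq]
  rw [(inversionIntegrand_integrableOn hα (by linarith) (by linarith) hev ht hs.1).2]
  exact congrArg _ hs.2

/-- Expansion of the shifted integral in powers of `exp (-2t)`. -/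
lemma hasSum_integral_unfolded {α β : ℝ} (hα : -1 / 2 ≤ α) (hρ : 1 ≤ rho α β) (hβ : β ≤ α)
    {c : ℕ → ℝ → ℝ} {m : ℂ → ℂ} (hm : IsHormanderMultiplier α β c m) {h t η : ℝ} (hh : 0 < h)
    (hhρ : h < rho α β) (ht : 0 < t) (hη : η ∈ Ioc (0 : ℝ) 1) :
    HasSum (fun k : ℕ => Complex.exp (-(rho α β + h) * t) *
      ((Real.exp (-2 * t) : ℝ) : ℂ) ^ k * ∫ x : ℝ, m (x + h * Complex.I) *
        amplitude α β k η (x + h * Complex.I) * Complex.exp (Complex.I * x * t))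
      (∫ x : ℝ, unfolded α β (regularized m η) t (x + h * Complex.I)) := by
  obtain ⟨C, hC, D, hD, HC⟩ := exists_norm_amplitude_le hα hρ hβ hh
  obtain ⟨M, hM⟩ := hm.bounded h hhρ
  have hM0 : 0 ≤ M := (norm_nonneg _).trans (hM 0 (by simpa using hh.le))
  obtain ⟨E, hE, HE⟩ := exists_pow_mul_exp_neg_sq_le (δ := η / 4) (by linarith [hη.1])
    (⌈α + 1 / 2⌉₊ + 2)
  set z : ℂ := ((Real.exp (-2 * t) : ℝ) : ℂ) with hz
  set e : ℂ := Complex.exp (-(rho α β + h) * t) with he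
  set F : ℕ → ℝ → ℂ := fun k x => e * z ^ k * (m (x + h * Complex.I) *
        amplitude α β k η (x + h * Complex.I) * Complex.exp (Complex.I * x * t)) with hF
  have hcont : ∀ k, Continuous (F k) := by
    intro k
    have h1 : Continuous fun x : ℝ => m (x + h * Complex.I) :=
      hm.holomorphic.continuousOn.comp_continuous (by fun_prop) (line_mem_strip hh hhρ)
    have h2 : Continuous fun x : ℝ => amplitude α β k η (x + h * Complex.I) :=
      (differentiableOn_amplitude hρ hβ k η).continuousOn.comp_continuous (by fun_prop)
        (line_mem_sector hh)
    exact ((h1.mul h2).mul (by fun_prop)).const_mul _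
  have hbound : ∀ k x, ‖F k x‖ ≤
      ‖e‖ * M * C * E * (growth D k * ‖z‖ ^ k) * (1 + x ^ 2)⁻¹ := by
    intro k x
    have hg := growth_pos hD k
    have hx : 0 < 1 + |x| := by positivity
    have h1 : ‖Complex.exp (Complex.I * x * t)‖ = 1 := by
      rw [show Complex.I * (x : ℂ) * t = ((x * t : ℝ) : ℂ) * Complex.I by push_cast; ring,
        Complex.norm_exp_ofReal_mul_I]
    have h2 := HC k η hη x _ (Metric.mem_closedBall_self (by positivity))
    have h3 : (1 + |x|) ^ (α + 1 / 2) * Real.exp (-(η / 4) * x ^ 2) ≤ E * (1 + x ^ 2)⁻¹ := by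
      calc _ ≤ (1 + |x|) ^ ⌈α + 1 / 2⌉₊ * Real.exp (-(η / 4) * x ^ 2) := by
            gcongr
            rw [← Real.rpow_natCast]
            exact Real.rpow_le_rpow_of_exponent_le (by linarith [abs_nonneg x]) (Nat.le_ceil _)
        _ = (1 + |x|) ^ (⌈α + 1 / 2⌉₊ + 2) * Real.exp (-(η / 4) * x ^ 2) *
              ((1 + |x|) ^ 2)⁻¹ := by
            rw [pow_add]; field_simp
        _ ≤ E * (1 + x ^ 2)⁻¹ := mul_le_mul (HE x) (inv_one_add_abs_sq_le x) (by positivity) hE.le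
    have h4 : ‖m (x + h * Complex.I)‖ ≤ M := hM _ (by simp [abs_of_pos hh])
    simp only [hF, norm_mul, norm_pow, h1, mul_one]
    calc _ ≤ ‖e‖ * ‖z‖ ^ k * (M * (C * growth D k * (E * (1 + x ^ 2)⁻¹))) := by
          gcongr
          exact h2.trans (by gcongr)
      _ = _ := by ring
  have hint : ∀ k, Integrable (F k) := fun k =>
    (integrable_inv_one_add_sq.const_mul _).mono' (hcont k).aestronglyMeasurable
      (Eventually.of_forall (hbound k))
  have hsum : Summable fun k => ∫ x, ‖F k x‖ := by
    have hs := summable_growth hD (norm_nonneg _) (norm_exp_lt_one ht)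
    refine Summable.of_nonneg_of_le (fun k => integral_nonneg fun x => norm_nonneg _)
      (fun k => ?_) ((hs.mul_left (‖e‖ * M * C * E)).mul_right Real.pi)
    rw [← integral_univ_inv_one_add_sq, ← integral_const_mul]
    exact integral_mono (hint k).norm (integrable_inv_one_add_sq.const_mul _) (hbound k)
  -- Sum and integral may be exchanged because the `L¹` norms are bounded by `growth D k *
  -- e^{-2kt}`, which is summable for `t > 0`.
  have hfin := hasSum_integral_of_summable_integral_norm hint hsum
  convert! hfin using 1
  · ext k
    rw [← integral_const_mul]
  · refine integral_congr_ae (Eventually.of_forall fun x => ?_)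
    have hps := (discSummable_hcCoeff α β (line_mem_sector hh x)).hasSum (norm_exp_lt_one ht)
    change unfolded α β (regularized m η) t (x + h * Complex.I) = ∑' k, F k x
    rw [unfolded, jacobiSecond, ← hps.tsum_eq, ← tsum_mul_left, ← tsum_mul_left]
    refine tsum_congr fun k => ?_
    -- Since `i(x + ih) = ix - h`, the shift contributes the extra decay `e^{-ht}`.
    have hexp : Complex.exp ((Complex.I * (x + h * Complex.I) - rho α β) * t) =
        e * Complex.exp (Complex.I * x * t) := by
      rw [he, ← Complex.exp_add]
      congr 1
      linear_combination (h : ℂ) * t * Complex.I_mul_I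
    simp only [hF, amplitude, regularized, hexp]
    ring

end JacobiAnalysis

/-! ### `L²` majorants, removal of the regularization, and convergence for rapidly decreasing
multipliers -/

namespace JacobiAnalysis

open Filter Topology

/-- The Cauchy–Schwarz inequality for a weighted series. -/
lemma ofReal_sq_norm_le {a : ℕ → ℂ} {s : ℂ} {w v : ℕ → ℝ} (hs : HasSum a s)
    (hw : ∀ k, 0 ≤ w k) (hW : Summable w) (ha : ∀ k, ‖a k‖ ≤ w k * v k) :
    ENNReal.ofReal (‖s‖ ^ 2) ≤
      ENNReal.ofReal (∑' k, w k) * ∑' k, ENNReal.ofReal (w k * v k ^ 2) := by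
  have ht : Tendsto (fun n => ENNReal.ofReal (‖∑ k ∈ Finset.range n, a k‖ ^ 2)) atTop
      (𝓝 (ENNReal.ofReal (‖s‖ ^ 2))) :=
    ENNReal.tendsto_ofReal ((hs.tendsto_sum_nat.norm).pow 2)
  refine le_of_tendsto' ht fun n => ?_
  have h1 : ‖∑ k ∈ Finset.range n, a k‖ ≤ ∑ k ∈ Finset.range n, √(w k) * (√(w k) * v k) := by
    refine norm_sum_le_of_le _ fun k _ => (ha k).trans_eq ?_
    rw [← mul_assoc, Real.mul_self_sqrt (hw k)]
  have h2 := Finset.sum_mul_sq_le_sq_mul_sq (Finset.range n) (fun k => √(w k))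
    fun k => √(w k) * v k
  simp only [mul_pow, Real.sq_sqrt (hw _)] at h2
  have h3 : 0 ≤ ∑ k ∈ Finset.range n, w k * v k ^ 2 :=
    Finset.sum_nonneg fun k _ => mul_nonneg (hw k) (sq_nonneg _)
  calc _ ≤ ENNReal.ofReal ((∑' k, w k) * ∑ k ∈ Finset.range n, w k * v k ^ 2) := by
        refine ENNReal.ofReal_le_ofReal ((pow_le_pow_left₀ (norm_nonneg _) h1 2).trans
          (h2.trans ?_))
        gcongr
        exact hW.sum_le_tsum _ fun k _ => hw k
    _ = ENNReal.ofReal (∑' k, w k) * ∑ k ∈ Finset.range n, ENNReal.ofReal (w k * v k ^ 2) := by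
        rw [ENNReal.ofReal_mul (tsum_nonneg hw),
          ENNReal.ofReal_sum_of_nonneg fun k _ => mul_nonneg (hw k) (sq_nonneg _)]
    _ ≤ _ := by
        gcongr
        exact ENNReal.sum_le_tsum _

/-- Uniform `L²` majorants for the kernels of the regularized multipliers. -/
lemma exists_majorant_regularized {α β : ℝ} (hα : 0 < α) (hρ : 1 ≤ rho α β) (hβ : β ≤ α)
    (c : ℕ → ℝ → ℝ) {h : ℝ} (hh : 0 < h) (hhρ : h < rho α β) :
    ∃ B : ℝ, ∀ m, IsHormanderMultiplier α β c m → ∀ η ∈ Ioc (0 : ℝ) 1, ∃ J : ℝ → ENNReal,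
      Measurable J ∧ ∫⁻ t in Ioi (1 : ℝ), J t ≤ ENNReal.ofReal B ∧ ∀ t, 1 < t →
        ENNReal.ofReal ((Real.exp ((rho α β + h) * t) *
          ‖kernel α β (regularized m η) t‖) ^ 2) ≤ J t := by
  obtain ⟨B, hB, D, hD, H⟩ := exists_lintegral_fourier_amplitude_le (by linarith) hρ hβ hh hhρ c
  set κ := connectionConst α with hκ
  -- The weight combines the polynomial growth of the `k`-th term with `e^{-2k}`, which bounds
  -- `e^{-2kt}` for `t > 1`. Dividing by `growth D k` in `v` makes the `L²` norms uniform in `k`.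
  set w : ℕ → ℝ := fun k => growth D k * Real.exp (-2) ^ k with hw
  have hw0 : ∀ k, 0 < w k := fun k => mul_pos (growth_pos hD k) (by positivity)
  have hW : Summable w := summable_growth hD (Real.exp_pos _).le
    (by rw [Real.exp_lt_one_iff]; norm_num)
  set W := ∑' k, w k with hWdef
  -- One factor `W` comes from the Cauchy–Schwarz inequality, the other from summing the weighted
  -- `L²` bounds.
  refine ⟨W * (W * (‖κ‖ ^ 2 * B)), fun m hm η hη => ?_⟩
  set F : ℕ → ℝ → ℂ := fun k t => ∫ x : ℝ, m (x + h * Complex.I) *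
        amplitude α β k η (x + h * Complex.I) * Complex.exp (Complex.I * x * t) with hF
  have hFc : ∀ k, Continuous (F k) := fun k => (H m hm k η hη).1
  set v : ℕ → ℝ → ℝ := fun k t => ‖κ‖ * ‖F k t‖ / growth D k with hv
  have hvc : ∀ k, Continuous fun t => w k * v k t ^ 2 := fun k => by
    have := hFc k
    simp only [hv]
    fun_prop
  have hterm : ∀ k, ∫⁻ t in Ioi (1 : ℝ), ENNReal.ofReal (w k * v k t ^ 2) ≤
      ENNReal.ofReal (w k * (‖κ‖ ^ 2 * B)) := by
    intro k
    have hg := growth_pos hD k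
    have e : ∀ t, ENNReal.ofReal (w k * v k t ^ 2) =
        ENNReal.ofReal (w k * ‖κ‖ ^ 2 / growth D k ^ 2) * ENNReal.ofReal (‖F k t‖ ^ 2) := by
      intro t
      have := hw0 k
      rw [← ENNReal.ofReal_mul (by positivity)]
      congr 1
      simp only [hv]
      ring
    simp_rw [e]
    rw [lintegral_const_mul' _ _ ENNReal.ofReal_ne_top]
    calc _ ≤ ENNReal.ofReal (w k * ‖κ‖ ^ 2 / growth D k ^ 2) *
          ENNReal.ofReal (B * growth D k ^ 2) := by
          gcongr
          exact (H m hm k η hη).2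
      _ = _ := by
          have := hw0 k
          rw [← ENNReal.ofReal_mul (by positivity)]
          congr 1
          field_simp
  have hmeas : ∀ k, Measurable fun t => ENNReal.ofReal (w k * v k t ^ 2) := fun k =>
    ENNReal.measurable_ofReal.comp (hvc k).measurable
  refine ⟨fun t => ENNReal.ofReal W * ∑' k, ENNReal.ofReal (w k * v k t ^ 2),
    (Measurable.tsum hmeas).const_mul _, ?_, fun t ht => ?_⟩
  · have hW0 : 0 ≤ W := tsum_nonneg fun k => (hw0 k).le
    rw [lintegral_const_mul' _ _ ENNReal.ofReal_ne_top,
      lintegral_tsum fun k => (hmeas k).aemeasurable, ENNReal.ofReal_mul hW0]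
    gcongr
    calc _ ≤ ∑' k, ENNReal.ofReal (w k * (‖κ‖ ^ 2 * B)) := ENNReal.tsum_le_tsum hterm
      _ = _ := by
        rw [← ENNReal.ofReal_tsum_of_nonneg
          (fun k => mul_nonneg (hw0 k).le (by positivity)) (hW.mul_right _), tsum_mul_right]
  · have ht0 : 0 < t := by linarith
    have hsum := (hasSum_integral_unfolded (by linarith) hρ hβ hm hh hhρ ht0 hη).mul_left
      (((Real.exp ((rho α β + h) * t) : ℝ) : ℂ) * κ)
    have hk := kernel_regularized_eq hα hρ hβ hm hh.le hhρ ht0 hη.1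
    rw [← hκ] at hk
    rw [mul_assoc, ← hk] at hsum
    have := ofReal_sq_norm_le (w := w) (v := fun k => v k t) hsum (fun k => (hw0 k).le) hW
      fun k => by
        have hg := growth_pos hD k
        have e : Real.exp ((rho α β + h) * t) * ‖Complex.exp (-(rho α β + h) * t)‖ = 1 := by
          rw [Complex.norm_exp, ← Real.exp_add, Real.exp_eq_one_iff]
          have : (-((rho α β : ℂ) + h) * t) = ((-(rho α β + h) * t : ℝ) : ℂ) := by
            push_cast; ring
          rw [this, Complex.ofReal_re]
          ring
        have e2 : Real.exp (-2 * t) ^ k ≤ Real.exp (-2) ^ k := by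
          gcongr
          linarith
        calc _ = Real.exp ((rho α β + h) * t) * ‖Complex.exp (-(rho α β + h) * t)‖ *
              (‖κ‖ * ‖F k t‖ * Real.exp (-2 * t) ^ k) := by
              simp only [norm_mul, norm_pow, Complex.norm_real, Real.norm_eq_abs, Real.abs_exp, hF]
              ring
          _ ≤ ‖κ‖ * ‖F k t‖ * Real.exp (-2) ^ k := by
              rw [e, one_mul]
              gcongr
          _ = w k * v k t := by
              simp only [hw, hv]
              field_simp
    rwa [norm_mul, Complex.norm_real, Real.norm_eq_abs, Real.abs_exp] at this

lemma inversionIntegrand_regularized (α β : ℝ) (m : ℂ → ℂ) (η t x : ℝ) :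
    inversionIntegrand α β (regularized m η) t x =
      ((Real.exp (-η * x ^ 2) : ℝ) : ℂ) * inversionIntegrand α β m t x := by
  rw [inversionIntegrand, inversionIntegrand, regularized]
  push_cast
  ring

/-- Since `0 < e^{-ηx²} ≤ 1`, the unregularized integrand dominates; this is where absolute
convergence of the inversion integral is required. -/
lemma tendsto_kernel_regularized {α β : ℝ} {m : ℂ → ℂ} {t : ℝ}
    (hi : IntegrableOn (inversionIntegrand α β m t) (Ioi 0)) :
    Tendsto (fun n : ℕ => kernel α β (regularized m (1 / ((n : ℝ) + 1))) t) atTop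
      (𝓝 (kernel α β m t)) := by
  simp only [kernel, inversionIntegrand_regularized]
  refine tendsto_integral_of_dominated_convergence (fun x => ‖inversionIntegrand α β m t x‖)
    (fun n => ?_) hi.norm (fun n => Eventually.of_forall fun x => ?_)
    (Eventually.of_forall fun x => ?_)
  · exact (Continuous.aestronglyMeasurable (by fun_prop)).mul hi.aestronglyMeasurable
  · rw [norm_mul, Complex.norm_real, Real.norm_eq_abs, Real.abs_exp]
    refine mul_le_of_le_one_left (norm_nonneg _) (Real.exp_le_one_iff.2 ?_)
    have : 0 ≤ 1 / ((n : ℝ) + 1) * x ^ 2 := by positivity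
    linarith
  · have h0 : Tendsto (fun n : ℕ => -(1 / ((n : ℝ) + 1)) * x ^ 2) atTop (𝓝 0) := by
      simpa using (tendsto_one_div_add_atTop_nhds_zero_nat (𝕜 := ℝ)).neg.mul_const (x ^ 2)
    have h1 := (Complex.continuous_ofReal.tendsto _).comp
      ((Real.continuous_exp.tendsto 0).comp h0)
    simpa using h1.mul_const (inversionIntegrand α β m t x)

/-- An `L²` majorant for the kernel, by Fatou's lemma. -/
lemma exists_majorant {α β : ℝ} (hα : 0 < α) (hρ : 1 ≤ rho α β) (hβ : β ≤ α)
    (c : ℕ → ℝ → ℝ) {h : ℝ} (hh : 0 < h) (hhρ : h < rho α β) :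
    ∃ B : ℝ, ∀ m, IsHormanderMultiplier α β c m → ∃ J : ℝ → ENNReal,
      Measurable J ∧ ∫⁻ t in Ioi (1 : ℝ), J t ≤ ENNReal.ofReal B ∧ ∀ t, 1 < t →
        IntegrableOn (inversionIntegrand α β m t) (Ioi 0) →
        ENNReal.ofReal ((Real.exp ((rho α β + h) * t) * ‖kernel α β m t‖) ^ 2) ≤ J t := by
  obtain ⟨B, H⟩ := exists_majorant_regularized hα hρ hβ c hh hhρ
  refine ⟨B, fun m hm => ?_⟩
  have hη : ∀ n : ℕ, 1 / ((n : ℝ) + 1) ∈ Ioc (0 : ℝ) 1 := fun n =>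
    ⟨by positivity, by rw [div_le_one (by positivity)]; linarith [n.cast_nonneg (α := ℝ)]⟩
  choose J hJ1 hJ2 hJ3 using fun n : ℕ => H m hm _ (hη n)
  -- The lower limit is defined at every `t`, converging integral or not, and the bound `B` passes
  -- to it as it does not depend on `η`.
  refine ⟨fun t => liminf (fun n => J n t) atTop, Measurable.liminf hJ1, ?_, fun t ht hi => ?_⟩
  · exact (lintegral_liminf_le hJ1).trans
      (liminf_le_of_le (h := fun b hb => by
        obtain ⟨n, hn⟩ := hb.exists
        exact hn.trans (hJ2 n)))
  · have := ENNReal.tendsto_ofReal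
      ((((tendsto_kernel_regularized hi).norm).const_mul (Real.exp ((rho α β + h) * t))).pow 2)
    rw [← this.liminf_eq]
    exact liminf_le_liminf (Eventually.of_forall fun n => hJ3 n t ht)

/-- The majorant `J` may be infinite on a null set, whereas `K` has to be real-valued and to
dominate at every admissible `t`, not just almost every one. On that null set `K` is taken equal to
`G`, which changes no norm. -/
lemma exists_memLp_of_majorant {J : ℝ → ENNReal} (hJ : Measurable J) {B : ℝ}
    (hB : ∫⁻ t in Ioi (1 : ℝ), J t ≤ ENNReal.ofReal B) {G : ℝ → ℝ} (hG : ∀ t, 0 ≤ G t)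
    {P : ℝ → Prop} (hP : ∀ t, 1 < t → P t → ENNReal.ofReal (G t ^ 2) ≤ J t) :
    ∃ K : ℝ → ℝ, (∀ t, 0 ≤ K t) ∧ MemLp K 2 (volume.restrict (Ioi (0 : ℝ))) ∧
      eLpNorm K 2 (volume.restrict (Ioi (0 : ℝ))) ≤ ENNReal.ofReal √B ∧
      ∀ t, 1 < t → P t → G t ≤ K t := by
  classical
  set K₀ : ℝ → ℝ := (Ioi (1 : ℝ)).indicator fun t => √(J t).toReal with hK₀
  have hK₀m : Measurable K₀ := (hJ.ennreal_toReal.sqrt).indicator measurableSet_Ioi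
  have hK₀n : ∀ t, 0 ≤ K₀ t := fun t => indicator_nonneg (fun _ _ => Real.sqrt_nonneg _) t
  set K : ℝ → ℝ := fun t => if 1 < t ∧ J t = ⊤ then G t else K₀ t with hK
  have hfin : ∀ᵐ t ∂volume.restrict (Ioi (1 : ℝ)), J t < ⊤ :=
    ae_lt_top hJ (hB.trans_lt ENNReal.ofReal_lt_top).ne
  have hae : K =ᵐ[volume.restrict (Ioi (0 : ℝ))] K₀ := by
    refine ae_restrict_of_ae ?_
    filter_upwards [(ae_restrict_iff' measurableSet_Ioi).1 hfin] with t ht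
    exact if_neg fun h => (ht h.1).ne h.2
  have hL : eLpNorm K 2 (volume.restrict (Ioi (0 : ℝ))) ≤ ENNReal.ofReal √B := by
    rw [eLpNorm_congr_ae hae, eLpNorm_eq_lintegral_rpow_enorm_toReal two_ne_zero
      ENNReal.ofNat_ne_top, Real.sqrt_eq_rpow]
    simp only [ENNReal.toReal_ofNat]
    have hle : ∫⁻ t in Ioi (0 : ℝ), ‖K₀ t‖ₑ ^ (2 : ℝ) ≤ ENNReal.ofReal B := by
      refine (setLIntegral_le_lintegral _ _).trans (le_trans ?_ hB)
      rw [← lintegral_indicator measurableSet_Ioi]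
      refine lintegral_mono fun t => ?_
      by_cases ht : t ∈ Ioi (1 : ℝ)
      · rw [hK₀, indicator_of_mem ht, indicator_of_mem ht,
          Real.enorm_of_nonneg (Real.sqrt_nonneg _),
          ENNReal.ofReal_rpow_of_nonneg (Real.sqrt_nonneg _) (by norm_num), Real.rpow_two,
          Real.sq_sqrt ENNReal.toReal_nonneg]
        exact ENNReal.ofReal_toReal_le
      · rw [hK₀, indicator_of_notMem ht]
        simp
    rcases le_total 0 B with h0 | h0
    · rw [← ENNReal.ofReal_rpow_of_nonneg h0 (by norm_num)]
      gcongr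
    · rw [ENNReal.ofReal_of_nonpos h0] at hle
      rw [nonpos_iff_eq_zero.1 hle, ENNReal.zero_rpow_of_pos (by norm_num)]
      exact zero_le
  refine ⟨K, fun t => ?_, ⟨hK₀m.aestronglyMeasurable.congr hae.symm,
    hL.trans_lt ENNReal.ofReal_lt_top⟩, hL, fun t ht hPt => ?_⟩
  · simp only [hK]
    split_ifs
    exacts [hG t, hK₀n t]
  · simp only [hK]
    split_ifs with hc
    · exact le_rfl
    · have htop : J t ≠ ⊤ := fun h => hc ⟨ht, h⟩
      rw [hK₀, indicator_of_mem (show t ∈ Ioi (1 : ℝ) from ht)]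
      exact Real.le_sqrt_of_sq_le ((ENNReal.ofReal_le_iff_le_toReal htop).1 (hP t ht hPt))

lemma jacobiFunction_zero (α β : ℝ) (l : ℂ) : jacobiFunction α β l 0 = 1 := by
  simp [jacobiFunction, hyp, ordinaryHypergeometric_zero]

lemma RapidlyDecreasing.exists_le {m : ℂ → ℂ} (hm : RapidlyDecreasing m) (J : ℕ) :
    ∃ C : ℝ, ∀ x : ℝ, (1 + |x|) ^ J * ‖m x‖ ≤ C * (1 + x ^ 2)⁻¹ := by
  obtain ⟨C, hC⟩ := hm (J + 2)
  have hC0 : 0 ≤ C := le_trans (by positivity) (hC 0)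
  refine ⟨C, fun x => ?_⟩
  calc _ = (1 + |x|) ^ (J + 2) * ‖m x‖ * ((1 + |x|) ^ 2)⁻¹ := by
        have : 0 < 1 + |x| := by positivity
        rw [pow_add]; field_simp
    _ ≤ _ := mul_le_mul (hC x) (inv_one_add_abs_sq_le x) (by positivity) hC0

/-- Convergence of the inversion integral for rapidly decreasing multipliers. -/
lemma integrableOn_of_rapidlyDecreasing {α β : ℝ} (hα : 0 < α) (hρ : 1 ≤ rho α β) (hβ : β ≤ α)
    {c : ℕ → ℝ → ℝ} {m : ℂ → ℂ} (hm : IsHormanderMultiplier α β c m) (hr : RapidlyDecreasing m)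
    {t : ℝ} (ht : 0 ≤ t) : IntegrableOn (inversionIntegrand α β m t) (Ioi 0) := by
  have hmc : Continuous fun x : ℝ => m x :=
    hm.holomorphic.continuousOn.comp_continuous Complex.continuous_ofReal
      fun x => by simpa [strip] using (by linarith : 0 < rho α β)
  have hic : Continuous fun x : ℝ => invC α β x :=
    (differentiableOn_invC hρ hβ).continuousOn.comp_continuous Complex.continuous_ofReal
      ofReal_mem_sector
  -- The connection formula needs `t > 0`. At `t = 0` one has `φ_λ = 1`, and the polynomial growth
  -- of `1/(c(λ) c(-λ))` suffices.
  rcases ht.eq_or_lt with rfl | ht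
  · obtain ⟨C, hC, HC⟩ := exists_norm_invC_le hρ hβ
    obtain ⟨A, hA⟩ := hr.exists_le (⌈α + 1 / 2⌉₊ * 2)
    have hb : ∀ x : ℝ, ‖invC α β x‖ ≤ C * (1 + |x|) ^ ⌈α + 1 / 2⌉₊ := by
      intro x
      refine (HC x (ofReal_mem_sector x)).trans ?_
      rw [Complex.norm_real, Real.norm_eq_abs, ← Real.rpow_natCast]
      gcongr
      · linarith [abs_nonneg x]
      · exact Nat.le_ceil _
    have e : inversionIntegrand α β m 0 =
        fun x : ℝ => m x * (invC α β x * invC α β ((-x : ℝ) : ℂ)) := by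
      funext x
      rw [inversionIntegrand, jacobiFunction_zero, invC, invC]
      push_cast
      rw [neg_neg, mul_one, div_eq_mul_inv, mul_inv_rev]
    rw [e]
    refine Integrable.integrableOn ((integrable_inv_one_add_sq.const_mul (C * C * A)).mono'
      (hmc.mul (hic.mul (hic.comp continuous_neg))).aestronglyMeasurable
      (Eventually.of_forall fun x => ?_))
    have h1 := hb x
    have h2 := hb (-x)
    rw [abs_neg] at h2
    rw [norm_mul, norm_mul]
    calc _ ≤ ‖m x‖ * (C * (1 + |x|) ^ ⌈α + 1 / 2⌉₊ * (C * (1 + |x|) ^ ⌈α + 1 / 2⌉₊)) := by gcongr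
      _ = C * C * ((1 + |x|) ^ (⌈α + 1 / 2⌉₊ * 2) * ‖m x‖) := by rw [pow_mul]; ring
      _ ≤ C * C * (A * (1 + x ^ 2)⁻¹) := mul_le_mul_of_nonneg_left (hA x) (by positivity)
      _ = _ := by ring
  · obtain ⟨C, J, hC, HC⟩ := exists_norm_invC_mul_jacobiSecond_le hρ hβ le_rfl ht
    obtain ⟨A, hA⟩ := hr.exists_le J
    have hjc : Continuous fun x : ℝ => jacobiSecond α β x t :=
      (differentiableOn_jacobiSecond α β ht).continuousOn.comp_continuous
        Complex.continuous_ofReal ofReal_mem_sector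
    refine (inversionIntegrand_integrableOn hα (by linarith) (by linarith)
      (hm.even_real (by linarith)) ht ?_).1
    refine (integrable_inv_one_add_sq.const_mul (C * A)).mono'
      ((hmc.mul hic).mul hjc).aestronglyMeasurable (Eventually.of_forall fun x => ?_)
    have h1 := HC x 0 (left_mem_Icc.2 le_rfl)
    simp only [Complex.ofReal_zero, zero_mul, add_zero] at h1
    rw [unfolded, mul_assoc, norm_mul]
    calc _ ≤ ‖m x‖ * (C * (1 + |x|) ^ J) := by gcongr
      _ = C * ((1 + |x|) ^ J * ‖m x‖) := by ring
      _ ≤ C * (A * (1 + x ^ 2)⁻¹) := mul_le_mul_of_nonneg_left (hA x) hC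
      _ = _ := by ring

end JacobiAnalysis

/-! ### The kernel estimate -/

theorem mainTheorem6 (α β : ℝ) (hα : 1 / 2 < α) (hβα : β < α) (hβ : -1 / 2 < β)
    (R₀ : ℝ) (hR₀ : 1 < R₀) (ψ : ℝ → ℝ) (hψ : JacobiAnalysis.IsCutoff R₀ ψ)
    (c : ℕ → ℝ → ℝ) (ε : ℝ) (hε : ε ∈ Set.Ioo (0 : ℝ) 1) :
    ∃ cε B : ℝ, ∀ m : ℂ → ℂ, JacobiAnalysis.IsHormanderMultiplier α β c m →
      (∃ K : ℝ → ℝ, (∀ t, 0 ≤ K t) ∧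
        MeasureTheory.MemLp K 2 (MeasureTheory.volume.restrict (Set.Ioi (0 : ℝ))) ∧
        MeasureTheory.eLpNorm K 2 (MeasureTheory.volume.restrict (Set.Ioi (0 : ℝ))) ≤
          ENNReal.ofReal B ∧
        ∀ t : ℝ, 0 ≤ t →
          MeasureTheory.IntegrableOn (JacobiAnalysis.inversionIntegrand α β m t)
            (Set.Ioi (0 : ℝ)) →
          ‖((1 - ψ t : ℝ) : ℂ) * JacobiAnalysis.kernel α β m t‖ ≤
            cε * Real.exp (-(1 + ε) * JacobiAnalysis.rho α β * t) * (1 + K t)) ∧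
      (JacobiAnalysis.RapidlyDecreasing m → ∀ t : ℝ, 0 ≤ t →
        MeasureTheory.IntegrableOn (JacobiAnalysis.inversionIntegrand α β m t)
          (Set.Ioi (0 : ℝ))) := by
  have hρ : 1 ≤ JacobiAnalysis.rho α β := by rw [JacobiAnalysis.rho]; linarith
  have hα0 : 0 < α := by linarith
  obtain ⟨B, H⟩ := JacobiAnalysis.exists_majorant hα0 hρ hβα.le c
    -- With this height `ρ + h = (1+ε)ρ`; the condition `h < ρ` is `ε < 1`.
    (h := ε * JacobiAnalysis.rho α β) (mul_pos hε.1 (by linarith)) (by nlinarith [hε.2])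
  -- The square root appears because `B` bounds a squared norm. The constant `1` suffices, and `K`
  -- alone already dominates for `t > 1`.
  refine ⟨1, √B, fun m hm => ⟨?_, fun hr t ht =>
    JacobiAnalysis.integrableOn_of_rapidlyDecreasing hα0 hρ hβα.le hm hr ht⟩⟩
  obtain ⟨J, hJ, hJB, hJle⟩ := H m hm
  obtain ⟨K, hK0, hK2, hKB, hKle⟩ := JacobiAnalysis.exists_memLp_of_majorant hJ hJB
    (fun t => by positivity) hJle
  refine ⟨K, hK0, hK2, hKB, fun t ht hi => ?_⟩
  have hKt := hK0 t
  -- For `t ≤ 1 < √R₀` the cutoff equals `1` and the left side vanishes, so the majorant is needed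
  -- only on `(1, ∞)`.
  rcases le_or_gt t 1 with h1 | h1
  · have : ψ t = 1 := hψ.eq_one t (by
      rw [abs_of_nonneg ht]
      exact h1.trans (Real.one_le_sqrt.2 hR₀.le))
    rw [this]
    simp only [sub_self, Complex.ofReal_zero, zero_mul, norm_zero]
    positivity
  · have h2 := hKle t h1 hi
    have h3 : ‖((1 - ψ t : ℝ) : ℂ)‖ ≤ 1 := by
      rw [Complex.norm_real, Real.norm_eq_abs, abs_le]
      constructor <;> linarith [hψ.nonneg t, hψ.le_one t]
    have e : Real.exp (-(1 + ε) * JacobiAnalysis.rho α β * t) *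
        Real.exp ((JacobiAnalysis.rho α β + ε * JacobiAnalysis.rho α β) * t) = 1 := by
      rw [← Real.exp_add, Real.exp_eq_one_iff]
      ring
    rw [norm_mul]
    calc _ ≤ 1 * ‖JacobiAnalysis.kernel α β m t‖ := by gcongr
      _ = Real.exp (-(1 + ε) * JacobiAnalysis.rho α β * t) *
          (Real.exp ((JacobiAnalysis.rho α β + ε * JacobiAnalysis.rho α β) * t) *
            ‖JacobiAnalysis.kernel α β m t‖) := by rw [← mul_assoc, e]
      _ ≤ Real.exp (-(1 + ε) * JacobiAnalysis.rho α β * t) * K t := by gcongr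
      _ ≤ _ := by
        rw [one_mul]
        gcongr
        linarith
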